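/- **Setting.** Vectors in $\mathbb R^n$ are indexed modulo $n$; $C_x$ is the circulant matrix with first column $x$; $\|\cdot\|$ is the Euclidean norm and $S^{n-1}$ the unit sphere. Let $0<\theta<\frac13$, $\frac1n\le\theta$, $0<\rho<10^{-3}$. The channels $x_1,\dots,x_N\in\mathbb R^n$ have entries $x_{i(j)}=A_{ij}B_{ij}$ with all $A_{ij},B_{ij}$ independent, $A_{ij}$ Rademacher ($\pm1$ with probability $\frac12$) and $B_{ij}\sim\mathrm{Ber}(\theta)$. The signal $f\in\mathbb R^n$ has $C_f$ invertible, and $\kappa$ is the ratio of the largest to the smallest magnitude of the DFT of $f$. The measurements are $y_i=x_i\circledast f$. Put $\phi(v)=-\frac14\|v\|_4^4$, $R=\bigl(\frac1{\theta nN}\sum_{i=1}^N C_{y_i}^\top C_{y_i}\bigr)^{-1/2}$, $L(h)=\frac1N\sum_{i=1}^N\phi(C_{y_i}Rh)$, $L''(h)=\frac1N\sum_{i=1}^N\phi(C_{x_i}h)$, and let $\widehat\nabla_L(h)=(I-hh^\top)\nabla L(h)$ be the Riemannian gradient on $S^{n-1}$. Let $\mathcal H_1''$ be the set of $h\in S^{n-1}$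 for which there is a stationary point $h_0$ of $\mathbb E L''$ on $S^{n-1}$ with exactly one nonzero entry and $\|h^{\odot2}-h_0^{\odot2}\|_\infty\le\rho$, and let $\mathcal H_1=(C_f^\top C_f)^{1/2}C_f^{-1}\mathcal H_1''$. **Algorithm (perturbed manifold gradient descent).** With parameters $\gamma,\mathcal D,\mathcal T,c$ and a start $h^{(0)}\in S^{n-1}$ (arbitrary; it may depend on the data), set $t_{\mathrm{perturb}}=0$. For $t=0,1,2,\dots$: if $\|\widehat\nabla_L(h^{(t)})\|<c$ and $t-t_{\mathrm{perturb}}>\mathcal T$, replace the current point $h=h^{(t)}$ by $\sqrt{1-\|z_p\|^2}\,h^{(t)}+z_p$, where, given the past, $z_p$ is uniform on the ball of radius $\mathcal D$ in the tangent space $\{z:z\perp h^{(t)}\}$, and set $t_{\mathrm{perturb}}=t$; otherwise keep $h=h^{(t)}$. Then $h^{(t+1)}=v/\|v\|$ with $v=h-\gamma\widehat\nabla_L(h)$. **Theorem.** There is an absolute constant $\xi_0$ with $1.3\cdot10^5<\xi_0<1.28\cdot10^8$ and, for every $\theta\in(0,\frac13)$, there are constants $c_1,c_1'>0$ depending only on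 $\theta$ such that the following holds in the above setting for all $n$, $\rho$, $f$, all $\xi$ with $\xi_0\le\xi<128/\rho^2$ (for $\xi=\xi_0$ this holds for every $\rho<10^{-3}$), and all $$N>\max\Bigl\{\frac{c_1n^9}{\rho^4}\log\frac n\rho,\ \frac{c_1\kappa^8n^8}{\rho^4}\log n\Bigr\}.$$ Run the algorithm with $$\gamma=\frac1{128n^3},\quad \mathcal D=\frac{\theta^2(1-3\theta)^2}{\xi^2n^6\log^2n},\quad \mathcal T=\frac{\xi n^3\log n}{25\,\theta(1-3\theta)},\quad c=c(n,\theta,\rho)=\frac{\theta(1-3\theta)\rho^2}{2n}.$$ Then with probability (over the channels and the perturbations) at least $$1-n^{-c_1'}-\frac{\xi^4n^{13-\xi/10000}\log^4n}{8\,\theta^4(1-3\theta)^4}$$ there is an integer $t$ with $$1\le t\le T=\frac{5000\,n^8}{\theta^2(1-3\theta)^2\rho^4}+\frac{\xi^4n^{12}\log^4n}{800\,\theta^4(1-3\theta)^4}\qquad\text{and}\qquad h^{(t)}\in\mathcal H_1.$$ -/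

import Mathlib

open MeasureTheory ProbabilityTheory
open scoped Matrix Gradient

noncomputable section

namespace MSBD

/-- Signals of length `n`, with the Euclidean norm; entries are indexed modulo `n`. -/
abbrev Sig (n : ℕ) : Type := EuclideanSpace ℝ (ZMod n)

/-- The circulant matrix `C_x` with first column `x`. -/
def circ {n : ℕ} (x : Sig n) : Matrix (ZMod n) (ZMod n) ℝ :=
  Matrix.circulant (fun j => x j)

section

variable {n : ℕ} [NeZero n]

/-- The circular convolution of `x` and `f`. -/
def conv (x f : Sig n) : Sig n :=
  WithLp.toLp 2 (circ x *ᵥ (fun j => f j))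

/-- The condition number `κ` of `f`: largest over smallest magnitude of its discrete Fourier
transform. -/
def condNumber (f : Sig n) : ℝ :=
  (⨆ j : ZMod n, ‖ZMod.dft (fun k : ZMod n => (f k : ℂ)) j‖) /
    (⨅ j : ZMod n, ‖ZMod.dft (fun k : ZMod n => (f k : ℂ)) j‖)

/-- `φ(v) = -(1/4) ‖v‖₄⁴`. -/
def phi (v : ZMod n → ℝ) : ℝ := -(1 / 4) * ∑ j, v j ^ 4

/-- The preconditioner `R = ((θ n N)⁻¹ ∑ᵢ C_{yᵢ}ᵀ C_{yᵢ})^{-1/2}`. -/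
def precond {N : ℕ} (θ : ℝ) (y : Fin N → Sig n) : Matrix (ZMod n) (ZMod n) ℝ :=
  cfc (fun t : ℝ => t ^ (-(1 / 2) : ℝ))
    ((1 / (θ * n * N)) • ∑ i, (circ (y i))ᵀ * circ (y i))

/-- The objective `L(h) = N⁻¹ ∑ᵢ φ(C_{yᵢ} R h)` built from the measurements `y`. -/
def objective {N : ℕ} (θ : ℝ) (y : Fin N → Sig n) (h : Sig n) : ℝ :=
  (1 / (N : ℝ)) * ∑ i, phi (circ (y i) *ᵥ (precond θ y *ᵥ (fun j => h j)))

/-- The objective `L''(h) = N⁻¹ ∑ᵢ φ(C_{xᵢ} h)` built from the channels `x`. -/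
def channelObjective {N : ℕ} (x : Fin N → Sig n) (h : Sig n) : ℝ :=
  (1 / (N : ℝ)) * ∑ i, phi (circ (x i) *ᵥ (fun j => h j))

/-- The Riemannian gradient `P_{h^⊥} ∇F(h)`, where `P_{h^⊥} = I - h hᵀ`. -/
def riemGrad (F : Sig n → ℝ) (h : Sig n) : Sig n :=
  ∇ F h - inner ℝ h (∇ F h) • h

/-- `h` is a stationary point of `F` on the unit sphere. -/
def IsStationary (F : Sig n → ℝ) (h : Sig n) : Prop :=
  ‖h‖ = 1 ∧ riemGrad F h = 0

/-- The points of the unit sphere in the `(ρ, r)`-neighbourhood of some stationary point `h₀` of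
`F` with exactly `r` nonzero entries: `‖h^{⊙2} - h₀^{⊙2}‖_∞ ≤ ρ / r`. -/
def nbhdStationary (F : Sig n → ℝ) (ρ : ℝ) (r : ℕ) : Set (Sig n) :=
  {h | ‖h‖ = 1 ∧ ∃ h₀ : Sig n, IsStationary F h₀ ∧ {j | h₀ j ≠ 0}.ncard = r ∧
    ∀ j, |h j ^ 2 - h₀ j ^ 2| ≤ ρ / r}

/-- The orthogonal matrix `(C_fᵀ C_f)^{1/2} C_f⁻¹`. -/
def rotation (f : Sig n) : Matrix (ZMod n) (ZMod n) ℝ :=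
  cfc Real.sqrt ((circ f)ᵀ * circ f) * (circ f)⁻¹

/-- The uniform distribution on the ball of radius `D` in the tangent space `h^⊥`. -/
def tangentBallUniform (D : ℝ) (h : Sig n) : Measure (Sig n) :=
  (cond (volume : Measure ((ℝ ∙ h)ᗮ : Submodule ℝ (Sig n))) (Metric.closedBall 0 D)).map
    Subtype.val

/-- One step of manifold gradient descent for `F` with step size `γ`, with the retraction
`P_{S^{n-1}}(v) = v / ‖v‖`. -/
def mgdStep (F : Sig n → ℝ) (γ : ℝ) (h : Sig n) : Sig n :=
  ‖h - γ • riemGrad F h‖⁻¹ • (h - γ • riemGrad F h)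

variable {Ω : Type*} [mΩ : MeasurableSpace Ω]

/-- The expected objective `𝔼 L''` of the random channels `x`. -/
def meanObjective {N : ℕ} (P : Measure Ω) (x : Fin N → Ω → Sig n) (h : Sig n) : ℝ :=
  ∫ ω, channelObjective (fun i => x i ω) h ∂P

/-- The region `ℋ₁`: the rotation by `(C_fᵀ C_f)^{1/2} C_f⁻¹` of the set of points of the sphere
in the `(ρ, 1)`-neighbourhoods of the stationary points of `𝔼 L''` with one nonzero entry. -/
def regionH1 {N : ℕ} (P : Measure Ω) (x : Fin N → Ω → Sig n) (f : Sig n) (ρ : ℝ) :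
    Set (Sig n) :=
  (fun h => WithLp.toLp 2 (rotation f *ᵥ (fun j => h j))) ''
    nbhdStationary (meanObjective P x) ρ 1

/-- The Bernoulli-Rademacher model: the entries of the channels are `A i j * B i j`, with all
`A i j`, `B i j` independent, `A i j` Rademacher and `B i j` Bernoulli with parameter `θ`. -/
def IsBernoulliRademacher {N : ℕ} (P : Measure Ω) (θ : ℝ) (x : Fin N → Ω → Sig n) : Prop :=
  ∃ A B : Fin N × ZMod n → Ω → ℝ,
    (∀ p, Measurable (A p)) ∧ (∀ p, Measurable (B p)) ∧
    iIndepFun (Sum.elim A B) P ∧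
    (∀ p, P {ω | A p ω = 1} = ENNReal.ofReal (1 / 2)) ∧
    (∀ p, P {ω | A p ω = -1} = ENNReal.ofReal (1 / 2)) ∧
    (∀ p, P {ω | B p ω = 1} = ENNReal.ofReal θ) ∧
    (∀ p, P {ω | B p ω = 0} = ENNReal.ofReal (1 - θ)) ∧
    ∀ i j ω, x i ω j = A (i, j) ω * B (i, j) ω

/-- The test made at iteration `t` of perturbed manifold gradient descent, at the current iterate
`h` and with the last perturbation made at iteration `s`. -/
def PerturbTest (F : Sig n → ℝ) (𝒯 c : ℝ) (t : ℕ) (h : Sig n) (s : ℕ) : Prop :=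
  ‖riemGrad F h‖ < c ∧ (t : ℝ) - (s : ℝ) > 𝒯

open Classical in
/-- A run of perturbed manifold gradient descent on the (random) objective `L`, with step size
`γ`, perturbation radius `D`, time interval `𝒯` and tolerance `c`. The σ-algebra `𝓕 t` is the
information available before the perturbation of iteration `t` is drawn, `h t` is the iterate
at the start of iteration `t`, `z t` is the perturbation drawn in iteration `t` (if one is drawn)
and `s t` is the variable `t_perturb` at the start of iteration `t`. -/
structure IsPMGD (P : Measure Ω) (𝓕 : Filtration ℕ mΩ) (L : Ω → Sig n → ℝ) (γ D 𝒯 c : ℝ)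
    (h z : ℕ → Ω → Sig n) (s : ℕ → Ω → ℕ) : Prop where
  norm_init : ∀ ω, ‖h 0 ω‖ = 1
  measurable_iterate : ∀ t, Measurable[𝓕 t] (h t)
  measurable_noise : ∀ t, Measurable[𝓕 (t + 1)] (z t)
  perturb_init : ∀ ω, s 0 ω = 0
  /-- Given the past, a perturbation is uniform on the ball of radius `D` in the tangent space. -/
  noise_law : ∀ (t : ℕ) (A : Set Ω), MeasurableSet[𝓕 t] A →
    (∀ ω ∈ A, PerturbTest (L ω) 𝒯 c t (h t ω) (s t ω)) →
    ∀ B : Set (Sig n), MeasurableSet B →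
      P (A ∩ z t ⁻¹' B) = ∫⁻ ω in A, tangentBallUniform D (h t ω) B ∂P
  iterate_step : ∀ t ω, h (t + 1) ω = mgdStep (L ω) γ
    (if PerturbTest (L ω) 𝒯 c t (h t ω) (s t ω) then
      √(1 - ‖z t ω‖ ^ 2) • h t ω + z t ω else h t ω)
  perturb_step : ∀ t ω, s (t + 1) ω =
    if PerturbTest (L ω) 𝒯 c t (h t ω) (s t ω) then t else s t ω

end

end MSBD

end

/-! On the unit sphere the objective is a constant minus a quarter of a quartic form. A multiple of
`‖h‖⁴` is constant there and may be subtracted; what remains is close to `n a ∑ⱼ ⟨b j, h⟩⁴`, with `a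
= θ(1-3θ)` and `b` the columns of the rotation. Two facts give this closeness (`exists_near_model`).
The empirical second and fourth moments of the channels concentrate, by Chebyshev's inequality. And
since circulant matrices commute, `circ f * precond` is exactly `(rotation f)ᵀ * X`, where `X` is an
inverse square root of the Gram matrix of the channels and hence close to the identity
(`exists_sqrt_inv_gram`, `norm_sqrt_inv_sub_le`).

For such an objective, a nearly stationary point far from every `± b j` has two coordinates of
comparable size, and rotating one into the other is a direction of curvature at most `-1.5 a`
(`exists_negative_curvature`). A random perturbation exploits it. If two perturbations differ by a
multiple at least `τ` of that direction and neither gains enough in `K` steps, then both runs stay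
near the point, because little gain means little movement. Their difference then follows an inexact
power iteration with the Hessian and grows like `(1 + γ lam / 2)^K`, which is impossible inside a
small ball (`growth_le_of_stuck`). So the useless perturbations contain no two points differing by
such a multiple, and a packing argument bounds their share of the tangent ball
(`tangentBallUniform_le`).

The rest is energy accounting. Outside the target, a step with large gradient gains a fixed amount
and a good perturbation gains `σ`; the objective has bounded oscillation on the sphere, so the time
spent outside is bounded (`time_le_of_good_perturbations`). Only the first `m` perturbations have to
be good, which costs `m` times the failure probability of one of them (`prob_avoid_le`). The
channels take finitely many values, so this is done separately on each event where they are fixed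
(`measure_le_of_values`); a start depending on the data is then harmless. -/

noncomputable section

namespace MSBD

/-! ### Quartic forms on the sphere and the ascent lemma for one gradient step. -/

section Quartic

variable {V : Type*} [NormedAddCommGroup V] [InnerProductSpace ℝ V]

/-- A symmetric trilinear map `S` whose associated quadrilinear form `⟪S x y z, w⟫` is symmetric,
with norm at most `M`. -/
structure SymmQuartic (S : V → V → V → V) (M : ℝ) : Prop where
  add_left : ∀ x x' y z, S (x + x') y z = S x y z + S x' y z
  smul_left : ∀ (t : ℝ) x y z, S (t • x) y z = t • S x y z
  swap_left : ∀ x y z, S x y z = S y x z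
  swap_right : ∀ x y z, S x y z = S x z y
  swap_inner : ∀ x y z w, inner ℝ (S x y z) w = inner ℝ (S x y w) z
  bound : ∀ x y z, ‖S x y z‖ ≤ M * ‖x‖ * ‖y‖ * ‖z‖

/-- The quartic form of `S`. -/
def quartic (S : V → V → V → V) (u : V) : ℝ := inner ℝ (S u u u) u

/-- The Riemannian gradient on the unit sphere of `-quartic S / 4`. -/
def sphGrad (S : V → V → V → V) (u : V) : V := quartic S u • u - S u u u

/-- A step of size `γ` along `-g`, followed by the projection to the unit sphere. -/
def retract (γ : ℝ) (g u : V) : V := ‖u - γ • g‖⁻¹ • (u - γ • g)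

/-- The gradient step on the sphere for `-quartic S / 4`. -/
def sphStep (S : V → V → V → V) (γ : ℝ) (u : V) : V := retract γ (sphGrad S u) u

/-- The component of `x` orthogonal to `h`. -/
def tproj (h : V) : V →ₗ[ℝ] V where
  toFun x := x - (inner ℝ h x : ℝ) • h
  map_add' x y := by simp only [inner_add_right, add_smul]; abel
  map_smul' t x := by
    simp only [inner_smul_right, RingHom.id_apply, smul_sub, smul_smul]

lemma tproj_apply (h x : V) : tproj h x = x - (inner ℝ h x : ℝ) • h := rfl

lemma inner_tproj_symm (h x y : V) :
    inner ℝ (tproj h x) y = inner ℝ x (tproj h y) := by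
  simp only [tproj_apply, inner_sub_left, inner_sub_right, inner_smul_left, inner_smul_right,
    RCLike.conj_to_real, real_inner_comm h x]
  ring

lemma norm_sq_tproj {h : V} (hh : ‖h‖ = 1) (x : V) :
    ‖tproj h x‖ ^ 2 = ‖x‖ ^ 2 - (inner ℝ h x) ^ 2 := by
  rw [tproj_apply, norm_sub_sq_real, inner_smul_right, norm_smul, hh, real_inner_comm h x,
    Real.norm_eq_abs, mul_one, sq_abs]
  ring

lemma norm_tproj_le {h : V} (hh : ‖h‖ = 1) (x : V) : ‖tproj h x‖ ≤ ‖x‖ := by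
  have := norm_sq_tproj hh x
  nlinarith [norm_nonneg x, norm_nonneg (tproj h x), sq_nonneg (inner ℝ h x : ℝ)]

lemma tproj_self {h : V} (hh : ‖h‖ = 1) : tproj h h = 0 := by
  simp [tproj_apply, hh]

lemma tproj_of_orthogonal {h x : V} (hx : inner ℝ h x = (0 : ℝ)) : tproj h x = x := by
  simp [tproj_apply, hx]

lemma tproj_tproj {h : V} (hh : ‖h‖ = 1) (x : V) : tproj h (tproj h x) = tproj h x := by
  apply tproj_of_orthogonal
  simp [tproj_apply, inner_sub_right, inner_smul_right, hh]

lemma inner_le_of_norm_le {x y : V} {a b : ℝ} (hx : ‖x‖ ≤ a) (hy : ‖y‖ ≤ b) :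
    |inner ℝ x y| ≤ a * b :=
  (abs_real_inner_le_norm x y).trans
    (mul_le_mul hx hy (norm_nonneg _) ((norm_nonneg _).trans hx))

namespace SymmQuartic

variable {S : V → V → V → V} {M : ℝ} (hS : SymmQuartic S M)
include hS

lemma add_mid (x y y' z : V) : S x (y + y') z = S x y z + S x y' z := by
  rw [hS.swap_left, hS.add_left, hS.swap_left y, hS.swap_left y']

lemma add_right (x y z z' : V) : S x y (z + z') = S x y z + S x y z' := by
  rw [hS.swap_right, hS.add_mid, hS.swap_right x z, hS.swap_right x z']

lemma smul_mid (t : ℝ) (x y z : V) : S x (t • y) z = t • S x y z := by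
  rw [hS.swap_left, hS.smul_left, hS.swap_left y]

lemma smul_right (t : ℝ) (x y z : V) : S x y (t • z) = t • S x y z := by
  rw [hS.swap_right, hS.smul_mid, hS.swap_right x z]

lemma neg_left (x y z : V) : S (-x) y z = -S x y z := by
  simpa using hS.smul_left (-1) x y z

lemma sub_left (x x' y z : V) : S (x - x') y z = S x y z - S x' y z := by
  rw [sub_eq_add_neg, hS.add_left, hS.neg_left, ← sub_eq_add_neg]

lemma sub_mid (x y y' z : V) : S x (y - y') z = S x y z - S x y' z := by
  rw [hS.swap_left, hS.sub_left, hS.swap_left y, hS.swap_left y']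

lemma sub_right (x y z z' : V) : S x y (z - z') = S x y z - S x y z' := by
  rw [hS.swap_right, hS.sub_mid, hS.swap_right x z, hS.swap_right x z']

lemma bound_of_le {x y z : V} {a b c : ℝ} (hM : 0 ≤ M) (hx : ‖x‖ ≤ a) (hy : ‖y‖ ≤ b)
    (hz : ‖z‖ ≤ c) : ‖S x y z‖ ≤ M * a * b * c := by
  have ha := (norm_nonneg _).trans hx
  have hb := (norm_nonneg _).trans hy
  refine (hS.bound x y z).trans ?_
  gcongr

lemma quartic_add (u w : V) : quartic S (u + w) = quartic S u + 4 * inner ℝ (S u u u) w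
    + 6 * inner ℝ (S u u w) w + 4 * inner ℝ (S u w w) w + quartic S w := by
  simp only [quartic, hS.add_left, hS.add_mid, hS.add_right, inner_add_left, inner_add_right]
  rw [hS.swap_left w u u, hS.swap_right u w u, hS.swap_left w u w, hS.swap_right w w u,
    hS.swap_left w u w, hS.swap_inner u u w u, hS.swap_inner u w w u, hS.swap_right u w u,
    hS.swap_inner w w w u, hS.swap_right w w u, hS.swap_left w u w]
  ring

lemma abs_quartic_le (u : V) : |quartic S u| ≤ M * ‖u‖ ^ 4 := by
  have := inner_le_of_norm_le (hS.bound u u u) (le_refl ‖u‖)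
  unfold quartic
  linarith [show M * ‖u‖ * ‖u‖ * ‖u‖ * ‖u‖ = M * ‖u‖ ^ 4 by ring]

lemma quartic_smul (t : ℝ) (u : V) : quartic S (t • u) = t ^ 4 * quartic S u := by
  simp only [quartic, hS.smul_left, hS.smul_mid, hS.smul_right, inner_smul_left, inner_smul_right,
    RCLike.conj_to_real]
  ring

lemma abs_quartic_le_one {u : V} (hu : ‖u‖ = 1) : |quartic S u| ≤ M := by
  simpa [hu] using hS.abs_quartic_le u

/-- First order expansion of the quartic form. -/
lemma abs_quartic_add_sub_le (hM : 0 ≤ M) (u w : V) :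
    |quartic S (u + w) - quartic S u - 4 * inner ℝ (S u u u) w|
      ≤ M * (6 * ‖u‖ ^ 2 * ‖w‖ ^ 2 + 4 * ‖u‖ * ‖w‖ ^ 3 + ‖w‖ ^ 4) := by
  have h1 := abs_le.1 (inner_le_of_norm_le (hS.bound u u w) (le_refl ‖w‖))
  have h2 := abs_le.1 (inner_le_of_norm_le (hS.bound u w w) (le_refl ‖w‖))
  have h3 := abs_le.1 (hS.abs_quartic_le w)
  rw [hS.quartic_add, abs_le]
  constructor <;> linarith

lemma inner_sphGrad_self {u : V} (hu : ‖u‖ = 1) : inner ℝ u (sphGrad S u) = 0 := by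
  simp [sphGrad, quartic, inner_sub_right, inner_smul_right, hu, real_inner_comm]

lemma sphGrad_eq_neg_tproj (u : V) : sphGrad S u = -tproj u (S u u u) := by
  simp [sphGrad, quartic, tproj_apply, real_inner_comm]

lemma norm_sphGrad_le {u : V} (hu : ‖u‖ = 1) : ‖sphGrad S u‖ ≤ M := by
  rw [hS.sphGrad_eq_neg_tproj, norm_neg]
  refine (norm_tproj_le hu _).trans ?_
  simpa [hu] using hS.bound u u u

lemma inner_cubic_sphGrad {u : V} (hu : ‖u‖ = 1) :
    inner ℝ (S u u u) (sphGrad S u) = -‖sphGrad S u‖ ^ 2 := by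
  have h := hS.inner_sphGrad_self hu
  have : S u u u = quartic S u • u - sphGrad S u := by simp [sphGrad]
  rw [this, inner_sub_left, inner_smul_left, h, real_inner_self_eq_norm_sq]
  simp

end SymmQuartic

section Retract

variable {γ : ℝ} {g u : V}

lemma norm_sq_sub_smul (hu : ‖u‖ = 1) (hg : inner ℝ u g = (0 : ℝ)) :
    ‖u - γ • g‖ ^ 2 = 1 + γ ^ 2 * ‖g‖ ^ 2 := by
  rw [norm_sub_sq_real, inner_smul_right, hg, norm_smul, hu, mul_pow, Real.norm_eq_abs, sq_abs]
  ring

lemma one_le_norm_sub_smul (hu : ‖u‖ = 1) (hg : inner ℝ u g = (0 : ℝ)) :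
    1 ≤ ‖u - γ • g‖ := by
  have := norm_sq_sub_smul (γ := γ) hu hg
  nlinarith [norm_nonneg (u - γ • g), sq_nonneg (γ * ‖g‖)]

lemma norm_retract (hu : ‖u‖ = 1) (hg : inner ℝ u g = (0 : ℝ)) : ‖retract γ g u‖ = 1 := by
  have := one_le_norm_sub_smul (γ := γ) hu hg
  rw [retract, norm_smul, norm_inv, norm_norm, inv_mul_cancel₀ (by linarith)]

/-- Since `g` is tangent, the squared chord is `2 - 2/x` with `x² = 1 + γ²‖g‖²`. It is at most `x² -
1`, because the difference of the two is `(x - 1)²(x + 2)/x`. -/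
lemma norm_retract_sub_le (hγ : 0 ≤ γ) (hu : ‖u‖ = 1) (hg : inner ℝ u g = (0 : ℝ)) :
    ‖retract γ g u - u‖ ≤ γ * ‖g‖ := by
  set x := ‖u - γ • g‖ with hx
  have h1 : 1 ≤ x := one_le_norm_sub_smul hu hg
  have h2 : x ^ 2 = 1 + γ ^ 2 * ‖g‖ ^ 2 := norm_sq_sub_smul hu hg
  have h3 : ‖retract γ g u - u‖ ^ 2 = 2 - 2 * x⁻¹ := by
    rw [norm_sub_sq_real, norm_retract hu hg, hu, retract, inner_smul_left, inner_sub_left,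
      inner_smul_left, real_inner_self_eq_norm_sq, hu, real_inner_comm, hg]
    simp only [RCLike.conj_to_real, ← hx]
    ring
  have h4 : 2 - 2 * x⁻¹ ≤ x ^ 2 - 1 := by
    have : x⁻¹ * x = 1 := inv_mul_cancel₀ (by linarith)
    have h5 : 0 < x⁻¹ := by positivity
    nlinarith [mul_nonneg (mul_nonneg h5.le (sub_nonneg.2 h1)) (sub_nonneg.2 h1),
      mul_nonneg (sub_nonneg.2 h1) (sub_nonneg.2 h1)]
  refine abs_le_of_sq_le_sq' ?_ (by positivity) |>.2
  rw [h3, mul_pow]; linarith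

end Retract

namespace SymmQuartic

variable {S : V → V → V → V} {M : ℝ} (hS : SymmQuartic S M)
include hS

lemma norm_sphStep (γ : ℝ) {u : V} (hu : ‖u‖ = 1) : ‖sphStep S γ u‖ = 1 :=
  norm_retract hu (hS.inner_sphGrad_self hu)

lemma norm_sphStep_sub_le {γ : ℝ} (hγ : 0 ≤ γ) {u : V} (hu : ‖u‖ = 1) :
    ‖sphStep S γ u - u‖ ≤ γ * ‖sphGrad S u‖ :=
  norm_retract_sub_le hγ hu (hS.inner_sphGrad_self hu)

/-- The gradient step increases the quartic form. -/
lemma quartic_sphStep_ge {γ : ℝ} (hγ : 0 ≤ γ) (hM : 0 ≤ M) (hγM : γ * M ≤ 1 / 100) {u : V}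
    (hu : ‖u‖ = 1) :
    quartic S u + 3.6 * γ * ‖sphGrad S u‖ ^ 2 ≤ quartic S (sphStep S γ u) := by
  set g := sphGrad S u with hg
  have hug := hS.inner_sphGrad_self hu
  have hGM := hS.norm_sphGrad_le hu
  rw [← hg] at hug hGM
  set G := ‖g‖ with hG
  have hG0 : 0 ≤ G := norm_nonneg _
  have hx2 : ‖u - γ • g‖ ^ 2 = 1 + γ ^ 2 * G ^ 2 := norm_sq_sub_smul hu hug
  have hx1 : 1 ≤ ‖u - γ • g‖ := one_le_norm_sub_smul hu hug
  have hq := hS.abs_quartic_le_one hu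
  have hexp := abs_le.1 (hS.abs_quartic_add_sub_le hM u (-(γ • g)))
  rw [inner_neg_right, inner_smul_right, hS.inner_cubic_sphGrad hu, norm_neg, norm_smul,
    Real.norm_of_nonneg hγ, ← sub_eq_add_neg, hu, ← hg, ← hG] at hexp
  have hγG : γ * G ≤ 1 / 100 := (mul_le_mul_of_nonneg_left hGM hγ).trans hγM
  have hγG0 : 0 ≤ γ * G := by positivity
  set y := γ * G ^ 2 with hy
  have hy0 : 0 ≤ y := by positivity
  have hxy : γ ^ 2 * G ^ 2 = γ * y := by rw [hy]; ring
  -- Before normalization: the first-order gain is `4y`, and the remainder is at most `0.07y`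
  -- because `γM ≤ 1/100`.
  have hlow : quartic S u + 3.9 * y ≤ quartic S (u - γ • g) := by
    have e1 : M * (6 * 1 ^ 2 * (γ * G) ^ 2 + 4 * 1 * (γ * G) ^ 3 + (γ * G) ^ 4)
        = (γ * M) * y * (6 + 4 * (γ * G) + (γ * G) ^ 2) := by rw [hy]; ring
    have e2 : (γ * M) * y * (6 + 4 * (γ * G) + (γ * G) ^ 2) ≤ (1 / 100) * y * 7 := by
      gcongr
      nlinarith
    have := hexp.1
    rw [e1] at this
    have e3 : 4 * -(γ * -G ^ 2) = 4 * y := by rw [hy]; ring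
    rw [e3] at this
    linarith
  -- Homogeneity of degree four turns the normalization into the factor `‖u - γg‖⁴ = (1 + γy)²`.
  -- Dividing by it lowers the gain from `3.9y` to `3.6y` at worst.
  have hfin : quartic S (sphStep S γ u) * (1 + γ * y) ^ 2 = quartic S (u - γ • g) := by
    have h0 : ‖u - γ • g‖ ≠ 0 := by linarith
    rw [sphStep, retract, ← hg, hS.quartic_smul, ← hxy, ← hx2]
    field_simp
  have hq' := abs_le.1 hq
  have hqM : quartic S u * (γ * y) ≤ y / 100 := by
    have : quartic S u * (γ * y) ≤ M * (γ * y) := by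
      apply mul_le_mul_of_nonneg_right hq'.2; positivity
    nlinarith
  have hyy : (γ * y) ≤ 1 / 10000 := by rw [← hxy]; nlinarith
  have hγy : 0 ≤ γ * y := by positivity
  have key : (quartic S u + 3.6 * y) * (1 + γ * y) ^ 2 ≤ quartic S u + 3.9 * y := by
    have : quartic S u * (γ * y) * (γ * y) ≤ y / 100 * (1 / 10000) := by
      have h1 : quartic S u * (γ * y) * (γ * y) ≤ y / 100 * (γ * y) := by
        apply mul_le_mul_of_nonneg_right hqM hγy
      have h2 : y / 100 * (γ * y) ≤ y / 100 * (1 / 10000) := by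
        apply mul_le_mul_of_nonneg_left hyy; positivity
      linarith
    have h3 : y * (1 + γ * y) ^ 2 ≤ y * (1.001) := by
      apply mul_le_mul_of_nonneg_left _ hy0
      nlinarith
    nlinarith
  have hpos : 0 < (1 + γ * y) ^ 2 := by positivity
  have : (quartic S u + 3.6 * y) ≤ quartic S (sphStep S γ u) := by
    rw [← hfin] at hlow
    exact le_of_mul_le_mul_right (key.trans hlow) hpos
  rw [hy] at this
  linarith

end SymmQuartic

end Quartic

/-! ### Inexact power iteration and the linearized gradient near a point. -/

section Escape

variable {V : Type*} [NormedAddCommGroup V] [InnerProductSpace ℝ V]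

/-- The Rayleigh quotient of a symmetric map does not decrease under an inexact power step. -/
lemma rayleigh_step {H : V →ₗ[ℝ] V} (hH : ∀ x y, inner ℝ (H x) y = inner ℝ x (H y))
    {l γ η lam : ℝ} (hl : ∀ x, ‖H x‖ ≤ l * ‖x‖) (hγ : 0 ≤ γ) (hγl : γ * l ≤ 1)
    (hη : 0 ≤ η) (hγη : γ * η ≤ 1 / 100) (hlam : 0 ≤ lam) (hlaml : lam ≤ l)
    {p e : V} (hp : lam * ‖p‖ ^ 2 ≤ -inner ℝ p (H p)) (he : ‖e‖ ≤ γ * η * ‖p‖) :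
    (lam - 5 * l * (γ * η)) * ‖p - γ • H p + e‖ ^ 2
        ≤ -inner ℝ (p - γ • H p + e) (H (p - γ • H p + e)) ∧
      (1 + γ * (lam - η)) * ‖p‖ ≤ ‖p - γ • H p + e‖ := by
  set w := p - γ • H p with hw
  have hl0 : 0 ≤ l := hlam.trans hlaml
  set B : V →ₗ[ℝ] V := -H - lam • LinearMap.id with hB
  have hBapp : ∀ x, B x = -H x - lam • x := fun x => by simp [hB]
  have hBsymm : ∀ x y, inner ℝ (B x) y = inner ℝ x (B y) := fun x y => by
    simp only [hBapp, inner_sub_left, inner_sub_right, inner_neg_left, inner_neg_right,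
      inner_smul_left, inner_smul_right, hH, RCLike.conj_to_real]
  have hBnorm : ∀ x, ‖B x‖ ≤ 2 * l * ‖x‖ := fun x => by
    rw [hBapp]
    refine (norm_sub_le _ _).trans ?_
    rw [norm_neg, norm_smul, Real.norm_of_nonneg hlam]
    nlinarith [hl x, norm_nonneg x]
  have hBform : ∀ x, inner ℝ x (B x) = -inner ℝ x (H x) - lam * ‖x‖ ^ 2 := fun x => by
    rw [hBapp, inner_sub_right, inner_neg_right, inner_smul_right, real_inner_self_eq_norm_sq]
  have hpB : 0 ≤ inner ℝ p (B p) := by rw [hBform]; linarith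
  -- lower bound on the norm of `w`
  have hwn : (1 + γ * lam) * ‖p‖ ≤ ‖w‖ := by
    have h1 : inner ℝ p w = ‖p‖ ^ 2 - γ * inner ℝ p (H p) := by
      rw [hw, inner_sub_right, inner_smul_right, real_inner_self_eq_norm_sq]
    have h2 : (1 + γ * lam) * ‖p‖ ^ 2 ≤ ‖p‖ * ‖w‖ := by
      have := real_inner_le_norm p w
      nlinarith [mul_le_mul_of_nonneg_left hp hγ]
    rcases (norm_nonneg p).eq_or_lt with h | h
    · rw [← h]; simp
    · nlinarith
  have hwp : ‖p‖ ≤ ‖w‖ := by nlinarith [mul_nonneg (mul_nonneg hγ hlam) (norm_nonneg p)]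
  have hwB : 0 ≤ inner ℝ w (B w) := by
    -- In terms of `B = -H - lam` the step is `(1 + γ lam) + γ B`, so the form of `B` at `w` expands
    -- into its value at `p`, the nonnegative `‖B p‖²` and a cubic term in `B`.
    have hwe : w = (1 + γ * lam) • p + γ • B p := by
      rw [hw, hBapp]; module
    have hBB : -(2 * l) * ‖B p‖ ^ 2 ≤ inner ℝ (B p) (B (B p)) := by
      have h1 := (abs_le.1 (abs_real_inner_le_norm (B p) (B (B p)))).1
      nlinarith [hBnorm (B p), norm_nonneg (B p)]
    have hexp : inner ℝ w (B w) = (1 + γ * lam) ^ 2 * inner ℝ p (B p)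
        + 2 * γ * (1 + γ * lam) * ‖B p‖ ^ 2 + γ ^ 2 * inner ℝ (B p) (B (B p)) := by
      rw [hwe]
      simp only [map_add, map_smul, inner_add_left, inner_add_right, inner_smul_left,
        inner_smul_right, RCLike.conj_to_real]
      rw [← hBsymm p (B p), real_inner_self_eq_norm_sq]
      ring
    rw [hexp]
    -- The cubic term is at worst `-2l γ²‖B p‖²`, and `γ l ≤ 1` lets the middle term absorb it.
    have h2 : 0 ≤ 2 * γ * (1 + γ * lam) * ‖B p‖ ^ 2 + γ ^ 2 * inner ℝ (B p) (B (B p)) := by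
      have h3 : γ ^ 2 * (-(2 * l) * ‖B p‖ ^ 2) ≤ γ ^ 2 * inner ℝ (B p) (B (B p)) :=
        mul_le_mul_of_nonneg_left hBB (by positivity)
      have h4 : 0 ≤ γ * ‖B p‖ ^ 2 := by positivity
      nlinarith [mul_nonneg h4 (sub_nonneg.2 hγl), mul_nonneg h4 (mul_nonneg hγ hlam)]
    nlinarith [mul_nonneg (sq_nonneg (1 + γ * lam)) hpB]
  have hew : ‖e‖ ≤ γ * η * ‖w‖ := he.trans (by gcongr)
  have hwe : (1 - γ * η) * ‖w‖ ≤ ‖w + e‖ := by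
    have := norm_sub_norm_le w (-e)
    rw [norm_neg, sub_neg_eq_add] at this
    linarith
  constructor
  · have hform : inner ℝ (w + e) (B (w + e))
        = inner ℝ w (B w) + 2 * inner ℝ e (B w) + inner ℝ e (B e) := by
      simp only [map_add, inner_add_left, inner_add_right]
      rw [← hBsymm w e, real_inner_comm e (B w)]
      ring
    have h1 := (abs_le.1 (abs_real_inner_le_norm e (B w))).1
    have h2 := (abs_le.1 (abs_real_inner_le_norm e (B e))).1
    have h3 : ‖e‖ * ‖B w‖ ≤ (γ * η * ‖w‖) * (2 * l * ‖w‖) := by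
      gcongr; exact hBnorm w
    have h4 : ‖e‖ * ‖B e‖ ≤ (γ * η * ‖w‖) * (2 * l * (γ * η * ‖w‖)) := by
      gcongr; exact (hBnorm e).trans (by gcongr)
    -- The error costs relative order `γη` in the form of `B`, which is the loss `5 l γη` in the
    -- Rayleigh quotient.
    have h5 : -(l * (γ * η)) * (4 + 2 * (γ * η)) * ‖w‖ ^ 2 ≤ inner ℝ (w + e) (B (w + e)) := by
      rw [hform]; nlinarith
    have h6 : (1 - γ * η) ^ 2 * ‖w‖ ^ 2 ≤ ‖w + e‖ ^ 2 := by
      rw [← mul_pow]; gcongr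
      apply mul_nonneg _ (norm_nonneg _); linarith
    have hge0 : 0 ≤ γ * η := by positivity
    have h7 : l * (γ * η) * (4 + 2 * (γ * η)) * ‖w‖ ^ 2
        ≤ 5 * l * (γ * η) * ‖w + e‖ ^ 2 := by
      have h8 : (4 + 2 * (γ * η)) * ‖w‖ ^ 2 ≤ 5 * ((1 - γ * η) ^ 2 * ‖w‖ ^ 2) := by
        have h10 : 4 + 2 * (γ * η) ≤ 5 * (1 - γ * η) ^ 2 := by nlinarith
        linarith [mul_le_mul_of_nonneg_right h10 (sq_nonneg ‖w‖)]
      have h9 : 0 ≤ l * (γ * η) := by positivity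
      nlinarith
    rw [hBform] at h5
    linarith
  · have hγe : 0 ≤ γ * η := by positivity
    have := norm_sub_norm_le w (-e)
    rw [norm_neg, sub_neg_eq_add] at this
    nlinarith

/-- Growth of an inexact power iteration started in a direction of negative curvature. -/
lemma rayleigh_growth {H : V →ₗ[ℝ] V} (hH : ∀ x y, inner ℝ (H x) y = inner ℝ x (H y))
    {l γ η lam : ℝ} (hl : ∀ x, ‖H x‖ ≤ l * ‖x‖) (hγ : 0 ≤ γ) (hγl : γ * l ≤ 1)
    (hη : 0 ≤ η) (hγη : γ * η ≤ 1 / 100) (hlam : 0 ≤ lam) (hlaml : lam ≤ l)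
    {K : ℕ} (hK : 5 * l * (γ * η) * K ≤ lam / 4) (hη4 : η ≤ lam / 4) {p : ℕ → V}
    (hp : lam * ‖p 0‖ ^ 2 ≤ -inner ℝ (p 0) (H (p 0)))
    (hstep : ∀ k < K, ‖p (k + 1) - (p k - γ • H (p k))‖ ≤ γ * η * ‖p k‖) :
    (1 + γ * (lam / 2)) ^ K * ‖p 0‖ ≤ ‖p K‖ := by
  have hl0 : 0 ≤ l := hlam.trans hlaml
  set d := 5 * l * (γ * η) with hd
  have hd0 : 0 ≤ d := by positivity
  suffices h : ∀ k ≤ K, (lam - d * k) * ‖p k‖ ^ 2 ≤ -inner ℝ (p k) (H (p k)) ∧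
      (1 + γ * (lam / 2)) ^ k * ‖p 0‖ ≤ ‖p k‖ from (h K le_rfl).2
  intro k
  induction k with
  | zero => intro _; simpa using hp
  | succ k ih =>
    intro hk
    obtain ⟨h1, h2⟩ := ih (by omega)
    have hkK : (k : ℝ) ≤ K := by exact_mod_cast (by omega : k ≤ K)
    have hdk : d * k ≤ lam / 4 := (mul_le_mul_of_nonneg_left hkK hd0).trans hK
    have hdk0 : 0 ≤ d * k := by positivity
    -- The Rayleigh quotient has lost at most `d k ≤ lam/4`, and the error rate `η` costs another
    -- `lam/4`; half of `lam` remains for the growth.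
    have h3 := rayleigh_step hH hl hγ hγl hη hγη (lam := lam - d * k) (by linarith) (by linarith)
      h1 (hstep k (by omega))
    rw [add_sub_cancel] at h3
    refine ⟨?_, ?_⟩
    · have := h3.1
      push_cast
      rw [← hd] at this
      rw [show lam - d * ((k : ℝ) + 1) = lam - d * k - d by ring]
      exact this
    · calc (1 + γ * (lam / 2)) ^ (k + 1) * ‖p 0‖
          = (1 + γ * (lam / 2)) * ((1 + γ * (lam / 2)) ^ k * ‖p 0‖) := by ring
        _ ≤ (1 + γ * (lam - d * k - η)) * ‖p k‖ := by
          have h4 : 1 + γ * (lam / 2) ≤ 1 + γ * (lam - d * k - η) := by gcongr; linarith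
          exact mul_le_mul h4 h2 (by positivity) (le_trans (by positivity) h4)
        _ ≤ _ := h3.2

/-- On a sphere `u + u'` is orthogonal to `u' - u`, so `h` may be replaced by `h - (u + u')/2`,
which is short. Chords near `h` are therefore almost tangent at `h`. -/
lemma abs_inner_sub_le_of_norm_eq_one {h u u' : V} {r : ℝ} (hu : ‖u‖ = 1) (hu' : ‖u'‖ = 1)
    (hr : ‖u - h‖ ≤ r) (hr' : ‖u' - h‖ ≤ r) : |inner ℝ h (u' - u)| ≤ r * ‖u' - u‖ := by
  set δ := u' - u with hδ
  have e : inner ℝ h δ = -(1 / 2) * inner ℝ ((u - h) + (u' - h)) δ := by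
    have : inner ℝ (u + u') δ = (0 : ℝ) := by
      rw [hδ, inner_add_left, inner_sub_right, inner_sub_right, real_inner_self_eq_norm_sq,
        real_inner_self_eq_norm_sq, hu, hu', real_inner_comm u u']
      ring
    rw [show (u - h) + (u' - h) = (u + u') - (2 : ℝ) • h by rw [two_smul]; abel,
      inner_sub_left, this, inner_smul_left]
    simp
  rw [e, abs_mul]
  have := inner_le_of_norm_le ((norm_add_le (u - h) (u' - h)).trans (add_le_add hr hr'))
    (le_refl ‖δ‖)
  rw [show |-(1 / 2 : ℝ)| = 1 / 2 by rw [abs_neg, abs_of_pos]; norm_num]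
  linarith

/-- The Riemannian Hessian at `h` of `-quartic S / 4`, extended by zero along `h`. -/
def sphHess (S : V → V → V → V) {M : ℝ} (hS : SymmQuartic S M) (h : V) : V →ₗ[ℝ] V where
  toFun x := tproj h (quartic S h • tproj h x - (3 : ℝ) • S h h (tproj h x))
  map_add' x y := by
    rw [← map_add]; congr 1
    rw [map_add, hS.add_right]; module
  map_smul' t x := by
    simp only [map_smul, hS.smul_right, RingHom.id_apply, map_sub]; module

namespace SymmQuartic

variable {S : V → V → V → V} {M : ℝ} (hS : SymmQuartic S M)
include hS

lemma sphHess_apply (h x : V) : sphHess S hS h x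
    = tproj h (quartic S h • tproj h x - (3 : ℝ) • S h h (tproj h x)) := rfl

lemma inner_sphHess_symm (h x y : V) :
    inner ℝ (sphHess S hS h x) y = inner ℝ x (sphHess S hS h y) := by
  rw [sphHess_apply, sphHess_apply, inner_tproj_symm, ← inner_tproj_symm h x]
  simp only [inner_sub_left, inner_sub_right, inner_smul_left, inner_smul_right,
    RCLike.conj_to_real]
  rw [hS.swap_inner h h (tproj h x) (tproj h y), real_inner_comm (tproj h x)]

lemma norm_sphHess_le (hM : 0 ≤ M) {h : V} (hh : ‖h‖ = 1) (x : V) :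
    ‖sphHess S hS h x‖ ≤ 4 * M * ‖x‖ := by
  rw [sphHess_apply]
  refine (norm_tproj_le hh _).trans ((norm_sub_le _ _).trans ?_)
  have h1 := hS.bound h h (tproj h x)
  have h2 := norm_tproj_le hh x
  have h3 := hS.abs_quartic_le_one hh
  rw [norm_smul, norm_smul, Real.norm_eq_abs, Real.norm_ofNat]
  rw [hh, mul_one, mul_one] at h1
  have h4 : |quartic S h| * ‖tproj h x‖ ≤ M * ‖x‖ := by gcongr
  have h5 : M * ‖tproj h x‖ ≤ M * ‖x‖ := by gcongr
  linarith

lemma inner_sphHess_self {h v : V} (hv : inner ℝ h v = (0 : ℝ)) :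
    inner ℝ v (sphHess S hS h v) = quartic S h * ‖v‖ ^ 2 - 3 * inner ℝ (S h h v) v := by
  rw [sphHess_apply, ← inner_tproj_symm, tproj_of_orthogonal hv, inner_sub_right,
    inner_smul_right, inner_smul_right, real_inner_self_eq_norm_sq, real_inner_comm v]

lemma cubic_sub (u u' : V) : S u' u' u' - S u u u
    = S u' u' (u' - u) + S u u' (u' - u) + S u u (u' - u) := by
  simp only [hS.sub_right, hS.swap_right u u' u]
  rw [hS.swap_right u' u' u, hS.swap_left u' u u']
  abel

lemma norm_cubic_sub_le {u u' : V} (hu : ‖u‖ = 1) (hu' : ‖u'‖ = 1) :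
    ‖S u' u' u' - S u u u‖ ≤ 3 * M * ‖u' - u‖ := by
  rw [hS.cubic_sub]
  have h1 := hS.bound u' u' (u' - u)
  have h2 := hS.bound u u' (u' - u)
  have h3 := hS.bound u u (u' - u)
  rw [hu', mul_one, mul_one] at h1
  rw [hu, hu', mul_one, mul_one] at h2
  rw [hu, mul_one, mul_one] at h3
  have := norm_add₃_le (a := S u' u' (u' - u)) (b := S u u' (u' - u)) (c := S u u (u' - u))
  linarith

lemma abs_quartic_sub_le {u u' : V} (hu : ‖u‖ = 1) (hu' : ‖u'‖ = 1) :
    |quartic S u' - quartic S u| ≤ 4 * M * ‖u' - u‖ := by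
  have e : quartic S u' - quartic S u
      = inner ℝ (S u' u' u' - S u u u) u' + inner ℝ (S u u u) (u' - u) := by
    simp only [quartic, inner_sub_left, inner_sub_right]; ring
  have h1 := inner_le_of_norm_le (hS.norm_cubic_sub_le hu hu') hu'.le
  have h2 := inner_le_of_norm_le (hS.bound u u u) (le_refl ‖u' - u‖)
  rw [hu, mul_one, mul_one, mul_one] at h2
  rw [e]
  refine (abs_add_le _ _).trans ?_
  linarith

lemma norm_sphGrad_sub_le (hM : 0 ≤ M) {u u' : V} (hu : ‖u‖ = 1) (hu' : ‖u'‖ = 1) :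
    ‖sphGrad S u' - sphGrad S u‖ ≤ 8 * M * ‖u' - u‖ := by
  have e : sphGrad S u' - sphGrad S u = quartic S u • (u' - u)
      + (quartic S u' - quartic S u) • u' - (S u' u' u' - S u u u) := by
    simp only [sphGrad]; module
  rw [e]
  refine (norm_sub_le _ _).trans ?_
  have h1 := hS.norm_cubic_sub_le hu hu'
  have h2 := norm_add_le (quartic S u • (u' - u)) ((quartic S u' - quartic S u) • u')
  rw [norm_smul, norm_smul, hu', Real.norm_eq_abs, Real.norm_eq_abs, mul_one] at h2
  have h3 := hS.abs_quartic_sub_le hu hu'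
  have h4 : |quartic S u| * ‖u' - u‖ ≤ M * ‖u' - u‖ := by
    gcongr; exact hS.abs_quartic_le_one hu
  linarith

/-- The tangential part of the difference of two gradients near `h` is governed by the Hessian
at `h`. -/
lemma norm_tproj_sphGrad_sub_le (hM : 0 ≤ M) {h u u' : V} {r : ℝ} (hh : ‖h‖ = 1) (hu : ‖u‖ = 1)
    (hu' : ‖u'‖ = 1) (hr : ‖u - h‖ ≤ r) (hr' : ‖u' - h‖ ≤ r) :
    ‖tproj h (sphGrad S u' - sphGrad S u) - sphHess S hS h (tproj h (u' - u))‖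
      ≤ 17 * M * r * ‖u' - u‖ := by
  set δ := u' - u with hδ
  have hr0 : 0 ≤ r := (norm_nonneg _).trans hr
  have hhδ : |inner ℝ h δ| ≤ r * ‖δ‖ := abs_inner_sub_le_of_norm_eq_one hu hu' hr hr'
  -- Exact identity in which each error term carries a factor `u - h`, `u' - h` or the small number
  -- `⟨h, δ⟩`. The four groups contribute `4 + 6 + 4 + 3 = 17` to the constant.
  have e : tproj h (sphGrad S u' - sphGrad S u) - sphHess S hS h (tproj h δ)
      = tproj h ((quartic S u - quartic S h) • δ
          - (S (u' - h) u' δ + S h (u' - h) δ + (S (u - h) u' δ + S h (u' - h) δ)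
            + (S (u - h) u δ + S h (u - h) δ)))
        + (quartic S u' - quartic S u) • tproj h (u' - h)
        - (3 * inner ℝ h δ) • tproj h (S h h h) := by
    rw [sphHess_apply, tproj_tproj hh]
    have e1 : sphGrad S u' - sphGrad S u = quartic S u • δ
        + (quartic S u' - quartic S u) • u' - (S u' u' u' - S u u u) := by
      simp only [sphGrad, hδ]; module
    have e2 : tproj h u' = tproj h (u' - h) := by rw [map_sub, tproj_self hh, sub_zero]
    have e3 : S h h (tproj h δ) = S h h δ - (inner ℝ h δ : ℝ) • S h h h := by
      rw [tproj_apply, hS.sub_right, hS.smul_right]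
    rw [e1, hS.cubic_sub, e3, ← hδ]
    simp only [hS.sub_left, hS.sub_mid, map_sub, map_add, map_smul, ← e2, tproj_tproj hh]
    module
  have hq := hS.abs_quartic_sub_le hh hu
  have hq' := hS.abs_quartic_sub_le hu hu'
  have b1 : ‖(quartic S u - quartic S h) • δ‖ ≤ 4 * M * r * ‖δ‖ := by
    rw [norm_smul, Real.norm_eq_abs]
    have : |quartic S u - quartic S h| ≤ 4 * M * r := hq.trans (by gcongr)
    gcongr
  have c1 := hS.bound_of_le hM hr' hu'.le (le_refl ‖δ‖)
  have c2 := hS.bound_of_le hM hh.le hr' (le_refl ‖δ‖)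
  have c3 := hS.bound_of_le hM hr hu'.le (le_refl ‖δ‖)
  have c4 := hS.bound_of_le hM hr hu.le (le_refl ‖δ‖)
  have c5 := hS.bound_of_le hM hh.le hr (le_refl ‖δ‖)
  have b2 : ‖S (u' - h) u' δ + S h (u' - h) δ + (S (u - h) u' δ + S h (u' - h) δ)
            + (S (u - h) u δ + S h (u - h) δ)‖ ≤ 6 * (M * r * ‖δ‖) := by
    have d1 := norm_add₃_le (a := S (u' - h) u' δ + S h (u' - h) δ)
      (b := S (u - h) u' δ + S h (u' - h) δ) (c := S (u - h) u δ + S h (u - h) δ)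
    have d2 := norm_add_le (S (u' - h) u' δ) (S h (u' - h) δ)
    have d3 := norm_add_le (S (u - h) u' δ) (S h (u' - h) δ)
    have d4 := norm_add_le (S (u - h) u δ) (S h (u - h) δ)
    linarith
  have b3 : ‖(quartic S u' - quartic S u) • tproj h (u' - h)‖ ≤ 4 * M * ‖δ‖ * r := by
    rw [norm_smul, Real.norm_eq_abs]
    gcongr
    exact (norm_tproj_le hh _).trans hr'
  have b4 : ‖(3 * inner ℝ h δ) • tproj h (S h h h)‖ ≤ 3 * (r * ‖δ‖) * M := by
    rw [norm_smul, Real.norm_eq_abs, abs_mul, abs_of_pos (by norm_num : (0 : ℝ) < 3)]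
    gcongr
    refine (norm_tproj_le hh _).trans ?_
    simpa [hh] using hS.bound h h h
  rw [e]
  refine (norm_sub_le _ _).trans ?_
  have d1 := norm_add_le (tproj h ((quartic S u - quartic S h) • δ
          - (S (u' - h) u' δ + S h (u' - h) δ + (S (u - h) u' δ + S h (u' - h) δ)
            + (S (u - h) u δ + S h (u - h) δ)))) ((quartic S u' - quartic S u) • tproj h (u' - h))
  have d2 := (norm_tproj_le hh ((quartic S u - quartic S h) • δ
          - (S (u' - h) u' δ + S h (u' - h) δ + (S (u - h) u' δ + S h (u' - h) δ)
            + (S (u - h) u δ + S h (u - h) δ)))).trans (norm_sub_le _ _)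
  linarith

end SymmQuartic

end Escape

/-! ### Coupling of two runs started from nearby perturbations. -/

section Stuck

variable {V : Type*} [NormedAddCommGroup V] [InnerProductSpace ℝ V]

/-- The point of the sphere reached from `h` by the tangential perturbation `z`. -/
def perturb (h z : V) : V := √(1 - ‖z‖ ^ 2) • h + z

lemma norm_perturb {h z : V} (hh : ‖h‖ = 1) (hz : inner ℝ h z = (0 : ℝ)) (hz1 : ‖z‖ ≤ 1) :
    ‖perturb h z‖ = 1 := by
  have h1 : 0 ≤ 1 - ‖z‖ ^ 2 := by nlinarith [norm_nonneg z]
  have : ‖perturb h z‖ ^ 2 = 1 := by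
    rw [perturb, norm_add_sq_real, norm_smul, hh, inner_smul_left, hz, Real.norm_eq_abs, mul_one,
      sq_abs, Real.sq_sqrt h1]
    simp
  nlinarith [norm_nonneg (perturb h z)]

lemma one_sub_sqrt_le {t : ℝ} (ht0 : 0 ≤ t) (ht : t ≤ 1) : 1 - t ≤ √(1 - t) := by
  apply Real.le_sqrt_of_sq_le
  nlinarith

lemma tproj_perturb {h z : V} (hh : ‖h‖ = 1) (hz : inner ℝ h z = (0 : ℝ)) :
    tproj h (perturb h z) = z := by
  rw [perturb, map_add, map_smul, tproj_self hh, smul_zero, zero_add, tproj_of_orthogonal hz]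

lemma norm_perturb_sub_le {h z : V} (hh : ‖h‖ = 1) (hz1 : ‖z‖ ≤ 1) :
    ‖perturb h z - h‖ ≤ 2 * ‖z‖ := by
  have h0 := norm_nonneg z
  have h1 := one_sub_sqrt_le (sq_nonneg ‖z‖) (by nlinarith)
  have h2 : √(1 - ‖z‖ ^ 2) ≤ 1 := Real.sqrt_le_one.2 (by nlinarith)
  have : perturb h z - h = (√(1 - ‖z‖ ^ 2) - 1) • h + z := by rw [perturb]; module
  rw [this]
  refine (norm_add_le _ _).trans ?_
  rw [norm_smul, hh, Real.norm_eq_abs, mul_one, abs_of_nonpos (by linarith)]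
  nlinarith

/-- Used for normalization factors, whose squared norms are explicit. For `x, y ≥ 1` inversion is a
contraction, and `x + y ≥ 2` passes from `x - y` to `x² - y²`. -/
lemma abs_sub_le_of_sq {x y b : ℝ} (hx : 1 ≤ x) (hy : 1 ≤ y) (h : |x ^ 2 - y ^ 2| ≤ 2 * b) :
    |x⁻¹ - y⁻¹| ≤ b := by
  have e : x⁻¹ - y⁻¹ = (y - x) / (x * y) := by field_simp
  have hxy : 1 ≤ x * y := by nlinarith
  rw [e, abs_div, abs_of_pos (by linarith : 0 < x * y)]
  refine (div_le_self (abs_nonneg _) hxy).trans ?_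
  rw [show x ^ 2 - y ^ 2 = (x - y) * (x + y) by ring, abs_mul, abs_of_pos (by linarith : 0 < x + y),
    abs_sub_comm] at h
  nlinarith [abs_nonneg (y - x)]

/-- Lets a nearly tangent chord be measured by its tangential part, the quantity that the power
iteration controls. -/
lemma norm_le_of_abs_inner_le {h x : V} {r : ℝ} (hh : ‖h‖ = 1) (hr0 : 0 ≤ r) (hr1 : r ≤ 1 / 10)
    (hx : |inner ℝ h x| ≤ r * ‖x‖) : ‖x‖ ≤ 1.1 * ‖tproj h x‖ := by
  have h1 := norm_sq_tproj hh x
  have h2 : (inner ℝ h x) ^ 2 ≤ (r * ‖x‖) ^ 2 := by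
    rw [← sq_abs (inner ℝ h x)]; gcongr
  have h3 : (r * ‖x‖) ^ 2 ≤ (1 / 10 * ‖x‖) ^ 2 := by gcongr
  refine abs_le_of_sq_le_sq' ?_ (by positivity) |>.2
  nlinarith

namespace SymmQuartic

variable {S : V → V → V → V} {M : ℝ} (hS : SymmQuartic S M)
include hS

set_option maxHeartbeats 800000 in
/-- Linearization of the gradient step around a point `h` of the sphere. -/
theorem norm_tproj_sphStep_sub_le {γ : ℝ} (hγ : 0 ≤ γ) (hM : 0 ≤ M) (hγM : γ * M ≤ 1 / 100)
    {h u u' : V} {r G : ℝ} (hr1 : r ≤ 1 / 10) (hGM : G ≤ M) (hh : ‖h‖ = 1) (hu : ‖u‖ = 1)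
    (hu' : ‖u'‖ = 1) (hr : ‖u - h‖ ≤ r) (hr' : ‖u' - h‖ ≤ r)
    (hG : ‖sphGrad S u‖ ≤ G) (hG' : ‖sphGrad S u'‖ ≤ G) :
    ‖tproj h (sphStep S γ u' - sphStep S γ u)
        - (tproj h (u' - u) - γ • sphHess S hS h (tproj h (u' - u)))‖
      ≤ γ * (20 * M * r + 2 * γ * G ^ 2) * ‖tproj h (u' - u)‖ := by
  have hr0 : 0 ≤ r := (norm_nonneg _).trans hr
  have hG0 : 0 ≤ G := (norm_nonneg _).trans hG
  have hγG : γ * G ≤ 1 / 100 := (mul_le_mul_of_nonneg_left hGM hγ).trans hγM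
  have hlin := hS.norm_tproj_sphGrad_sub_le hM hh hu hu' hr hr'
  have hlip := hS.norm_sphGrad_sub_le hM hu hu'
  have hin := abs_inner_sub_le_of_norm_eq_one hu hu' hr hr'
  set g := sphGrad S u with hg
  set g' := sphGrad S u' with hg'
  set δ := u' - u with hδ
  set p := tproj h δ with hp
  have hδ0 := norm_nonneg δ
  have hδp : ‖δ‖ ≤ 1.1 * ‖p‖ := norm_le_of_abs_inner_le hh hr0 hr1 hin
  set v := u - γ • g with hv
  set v' := u' - γ • g' with hv'
  have hvs : ‖v‖ ^ 2 = 1 + γ ^ 2 * ‖g‖ ^ 2 := norm_sq_sub_smul hu (hS.inner_sphGrad_self hu)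
  have hvs' : ‖v'‖ ^ 2 = 1 + γ ^ 2 * ‖g'‖ ^ 2 := norm_sq_sub_smul hu' (hS.inner_sphGrad_self hu')
  have hv1 : 1 ≤ ‖v‖ := one_le_norm_sub_smul hu (hS.inner_sphGrad_self hu)
  have hv1' : 1 ≤ ‖v'‖ := one_le_norm_sub_smul hu' (hS.inner_sphGrad_self hu')
  have hα' : |‖v'‖⁻¹ - 1| ≤ γ ^ 2 * G ^ 2 / 2 := by
    have : |‖v'‖⁻¹ - 1⁻¹| ≤ γ ^ 2 * G ^ 2 / 2 := by
      apply abs_sub_le_of_sq hv1' le_rfl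
      rw [hvs', abs_of_nonneg (by linarith [mul_nonneg (sq_nonneg γ) (sq_nonneg ‖g'‖)])]
      have : γ ^ 2 * ‖g'‖ ^ 2 ≤ γ ^ 2 * G ^ 2 := by gcongr
      linarith
    simpa using this
  have hαα : |‖v'‖⁻¹ - ‖v‖⁻¹| ≤ γ ^ 2 * G * (8 * M * ‖δ‖) := by
    apply abs_sub_le_of_sq hv1' hv1
    rw [hvs, hvs', show 1 + γ ^ 2 * ‖g'‖ ^ 2 - (1 + γ ^ 2 * ‖g‖ ^ 2)
      = γ ^ 2 * ((‖g'‖ + ‖g‖) * (‖g'‖ - ‖g‖)) by ring, abs_mul, abs_mul,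
      abs_of_nonneg (sq_nonneg γ), abs_of_nonneg (add_nonneg (norm_nonneg g') (norm_nonneg g))]
    have : (‖g'‖ + ‖g‖) * |‖g'‖ - ‖g‖| ≤ (G + G) * (8 * M * ‖δ‖) := by
      gcongr
      exact (abs_norm_sub_norm_le _ _).trans hlip
    linarith [mul_le_mul_of_nonneg_left this (sq_nonneg γ)]
  have hvv : ‖v' - v‖ ≤ 1.08 * ‖δ‖ := by
    have : v' - v = δ - γ • (g' - g) := by rw [hv, hv', hδ]; module
    rw [this]
    refine (norm_sub_le _ _).trans ?_
    rw [norm_smul, Real.norm_of_nonneg hγ]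
    have h1 : γ * ‖g' - g‖ ≤ γ * (8 * M * ‖δ‖) := by gcongr
    have h2 := mul_le_mul_of_nonneg_right hγM hδ0
    linarith
  have hPv : ‖tproj h v‖ ≤ r + γ * G := by
    have : tproj h v = tproj h (u - h) - γ • tproj h g := by
      rw [hv, map_sub, map_sub, map_smul, tproj_self hh, sub_zero]
    rw [this]
    refine (norm_sub_le _ _).trans ?_
    rw [norm_smul, Real.norm_of_nonneg hγ]
    have h1 := (norm_tproj_le hh (u - h)).trans hr
    have h2 := (norm_tproj_le hh g).trans hG
    gcongr
  -- The deviation from the linear step has three sources: normalization of the difference, change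
  -- of the normalization factor, and nonlinearity of the gradient.
  have e : tproj h (sphStep S γ u' - sphStep S γ u) - (p - γ • sphHess S hS h p)
      = (‖v'‖⁻¹ - 1) • tproj h (v' - v) + (‖v'‖⁻¹ - ‖v‖⁻¹) • tproj h v
        - γ • (tproj h (g' - g) - sphHess S hS h p) := by
    simp only [sphStep, retract, ← hg, ← hg', ← hv, ← hv']
    have : u' - u = v' - v + γ • (g' - g) := by rw [hv, hv']; module
    rw [hp, hδ, this]
    simp only [map_sub, map_add, map_smul]
    module
  rw [e]
  have b1 : ‖(‖v'‖⁻¹ - 1) • tproj h (v' - v)‖ ≤ (γ ^ 2 * G ^ 2 / 2) * (1.08 * ‖δ‖) := by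
    rw [norm_smul, Real.norm_eq_abs]
    gcongr
    exact (norm_tproj_le hh _).trans hvv
  have b2 : ‖(‖v'‖⁻¹ - ‖v‖⁻¹) • tproj h v‖ ≤ (γ ^ 2 * G * (8 * M * ‖δ‖)) * (r + γ * G) := by
    rw [norm_smul, Real.norm_eq_abs]
    gcongr
  have b3 : ‖γ • (tproj h (g' - g) - sphHess S hS h p)‖ ≤ γ * (17 * M * r * ‖δ‖) := by
    rw [norm_smul, Real.norm_of_nonneg hγ]
    gcongr
  have b4 : (γ ^ 2 * G * (8 * M * ‖δ‖)) * (r + γ * G)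
      ≤ γ * (0.08 * M * r + 0.08 * γ * G ^ 2) * ‖δ‖ := by
    have c1 : (γ ^ 2 * G * (8 * M * ‖δ‖)) * (r + γ * G)
      = γ * ‖δ‖ * (8 * (M * r) * (γ * G) + 8 * (γ * G ^ 2) * (γ * M)) := by ring
    rw [c1]
    have c2 : (M * r) * (γ * G) ≤ (M * r) * (1 / 100) := by gcongr
    have c3 : (γ * G ^ 2) * (γ * M) ≤ (γ * G ^ 2) * (1 / 100) := by gcongr
    have c4 : 0 ≤ γ * ‖δ‖ := by positivity
    have c5 : 8 * (M * r) * (γ * G) + 8 * (γ * G ^ 2) * (γ * M)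
        ≤ 0.08 * M * r + 0.08 * γ * G ^ 2 := by linarith
    linarith [mul_le_mul_of_nonneg_left c5 c4]
  have b5 := norm_sub_le ((‖v'‖⁻¹ - 1) • tproj h (v' - v) + (‖v'‖⁻¹ - ‖v‖⁻¹) • tproj h v)
    (γ • (tproj h (g' - g) - sphHess S hS h p))
  have b6 := norm_add_le ((‖v'‖⁻¹ - 1) • tproj h (v' - v)) ((‖v'‖⁻¹ - ‖v‖⁻¹) • tproj h v)
  have hb : 0 ≤ γ * (17.08 * M * r + 0.62 * γ * G ^ 2) := by positivity
  have b7 : γ * (17.08 * M * r + 0.62 * γ * G ^ 2) * ‖δ‖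
      ≤ γ * (17.08 * M * r + 0.62 * γ * G ^ 2) * (1.1 * ‖p‖) := by gcongr
  have b8 : γ * (17.08 * M * r + 0.62 * γ * G ^ 2) * (1.1 * ‖p‖)
      ≤ γ * (20 * M * r + 2 * γ * G ^ 2) * ‖p‖ := by
    have c1 : 0 ≤ γ * (M * r) * ‖p‖ := by positivity
    have c2 : 0 ≤ γ * (γ * G ^ 2) * ‖p‖ := by positivity
    linarith
  linarith

lemma norm_iterate (γ : ℝ) {u : ℕ → V} (hu0 : ‖u 0‖ = 1)
    (hu : ∀ k, u (k + 1) = sphStep S γ (u k)) (k : ℕ) : ‖u k‖ = 1 := by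
  induction k with
  | zero => exact hu0
  | succ k ih => rw [hu, hS.norm_sphStep γ ih]

lemma quartic_iterate_mono {γ : ℝ} (hγ : 0 ≤ γ) (hM : 0 ≤ M) (hγM : γ * M ≤ 1 / 100)
    {u : ℕ → V} (hu0 : ‖u 0‖ = 1) (hu : ∀ k, u (k + 1) = sphStep S γ (u k)) :
    Monotone fun k => quartic S (u k) := by
  refine monotone_nat_of_le_succ fun k => ?_
  have := hS.quartic_sphStep_ge hγ hM hγM (hS.norm_iterate γ hu0 hu k)
  rw [← hu] at this
  have h2 : 0 ≤ 3.6 * γ * ‖sphGrad S (u k)‖ ^ 2 := by positivity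
  linarith

/-- If the quartic form increases by at most `Δ` along `K` gradient steps, then the iterates stay
close to the starting point. -/
lemma norm_iterate_sub_sq_le {γ : ℝ} (hγ : 0 ≤ γ) (hM : 0 ≤ M) (hγM : γ * M ≤ 1 / 100)
    {u : ℕ → V} (hu0 : ‖u 0‖ = 1) (hu : ∀ k, u (k + 1) = sphStep S γ (u k)) {K : ℕ} {Δ : ℝ}
    (hΔ : quartic S (u K) - quartic S (u 0) ≤ Δ) {k : ℕ} (hk : k ≤ K) :
    ‖u k - u 0‖ ^ 2 ≤ K * γ * Δ / 3.6 := by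
  have hsum : ∀ m, ∑ i ∈ Finset.range m, 3.6 * γ * ‖sphGrad S (u i)‖ ^ 2
      ≤ quartic S (u m) - quartic S (u 0) := by
    intro m
    induction m with
    | zero => simp
    | succ m ih =>
      rw [Finset.sum_range_succ]
      have := hS.quartic_sphStep_ge hγ hM hγM (hS.norm_iterate γ hu0 hu m)
      rw [← hu] at this
      linarith
  have hdist : ∀ m, ‖u m - u 0‖ ≤ ∑ i ∈ Finset.range m, γ * ‖sphGrad S (u i)‖ := by
    intro m
    induction m with
    | zero => simp
    | succ m ih =>
      rw [Finset.sum_range_succ]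
      have h1 := hS.norm_sphStep_sub_le hγ (hS.norm_iterate γ hu0 hu m)
      rw [← hu] at h1
      have h2 := norm_add_le (u (m + 1) - u m) (u m - u 0)
      rw [sub_add_sub_cancel] at h2
      linarith
  have hmono := hS.quartic_iterate_mono hγ hM hγM hu0 hu hk
  -- Cauchy–Schwarz turns the bound on the sum of squared gradients, paid for by the total gain,
  -- into a bound on the path length.
  have hcs := sq_sum_le_card_mul_sum_sq (s := Finset.range k)
    (f := fun i => γ * ‖sphGrad S (u i)‖)
  have h1 : ‖u k - u 0‖ ^ 2 ≤ (∑ i ∈ Finset.range k, γ * ‖sphGrad S (u i)‖) ^ 2 := by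
    gcongr; exact hdist k
  have h2 : ∑ i ∈ Finset.range k, (γ * ‖sphGrad S (u i)‖) ^ 2 ≤ γ * Δ / 3.6 := by
    have : ∑ i ∈ Finset.range k, (γ * ‖sphGrad S (u i)‖) ^ 2
        = γ / 3.6 * ∑ i ∈ Finset.range k, 3.6 * γ * ‖sphGrad S (u i)‖ ^ 2 := by
      rw [Finset.mul_sum]
      refine Finset.sum_congr rfl fun i _ => ?_
      ring
    rw [this, mul_div_right_comm]
    have := hsum k
    have h4 : quartic S (u k) ≤ quartic S (u K) := hmono
    gcongr
    linarith
  have h0 : 0 ≤ γ * Δ / 3.6 := le_trans (Finset.sum_nonneg fun i _ => sq_nonneg _) h2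
  have hkK : (k : ℝ) ≤ K := by exact_mod_cast hk
  rw [Finset.card_range] at hcs
  calc ‖u k - u 0‖ ^ 2 ≤ k * ∑ i ∈ Finset.range k, (γ * ‖sphGrad S (u i)‖) ^ 2 := h1.trans hcs
    _ ≤ K * (γ * Δ / 3.6) := by gcongr
    _ = K * γ * Δ / 3.6 := by ring

/-- Two runs of gradient descent whose initial difference is a direction of negative curvature
cannot both remain near `h`. -/
lemma growth_le_of_near {γ : ℝ} (hγ : 0 ≤ γ) (hM : 0 ≤ M) (hγM : γ * M ≤ 1 / 100)
    {h : V} {r c lam : ℝ} {K : ℕ} (hr1 : r ≤ 1 / 10) (hh : ‖h‖ = 1)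
    (hc : ‖sphGrad S h‖ ≤ c) (hcM : c + 8 * M * r ≤ M) (hlam : 0 ≤ lam) (hlamM : lam ≤ 4 * M)
    (hη : 20 * M * r + 2 * γ * (c + 8 * M * r) ^ 2 ≤ lam / 4)
    (hK : 20 * M * (γ * (20 * M * r + 2 * γ * (c + 8 * M * r) ^ 2)) * K ≤ lam / 4)
    {u u' : ℕ → V} (hu0 : ‖u 0‖ = 1) (hu : ∀ k, u (k + 1) = sphStep S γ (u k))
    (hu0' : ‖u' 0‖ = 1) (hu' : ∀ k, u' (k + 1) = sphStep S γ (u' k))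
    (hr : ∀ k ≤ K, ‖u k - h‖ ≤ r) (hr' : ∀ k ≤ K, ‖u' k - h‖ ≤ r)
    (hneg : lam * ‖tproj h (u' 0 - u 0)‖ ^ 2
      ≤ -inner ℝ (tproj h (u' 0 - u 0)) (sphHess S hS h (tproj h (u' 0 - u 0)))) :
    (1 + γ * (lam / 2)) ^ K * ‖tproj h (u' 0 - u 0)‖ ≤ 2 * r := by
  have hr0 : 0 ≤ r := (norm_nonneg _).trans (hr 0 (Nat.zero_le _))
  set η := 20 * M * r + 2 * γ * (c + 8 * M * r) ^ 2 with hηdef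
  have hη0 : 0 ≤ η := by positivity
  have hG : ∀ w : V, ‖w‖ = 1 → ‖w - h‖ ≤ r → ‖sphGrad S w‖ ≤ c + 8 * M * r := fun w hw hwr => by
    have h1 := hS.norm_sphGrad_sub_le hM hh hw
    have h2 := norm_add_le (sphGrad S w - sphGrad S h) (sphGrad S h)
    rw [sub_add_cancel] at h2
    have h3 : 8 * M * ‖w - h‖ ≤ 8 * M * r := by gcongr
    linarith
  have hγη : γ * η ≤ 1 / 100 := by
    have : γ * η ≤ γ * (lam / 4) := by gcongr
    nlinarith
  have hgrow := rayleigh_growth (hS.inner_sphHess_symm h) (l := 4 * M) (γ := γ) (η := η)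
    (lam := lam) (K := K) (hS.norm_sphHess_le hM hh) hγ (by linarith) hη0 hγη hlam hlamM
    (by rw [show 5 * (4 * M) = 20 * M by ring]; exact hK) hη
    (p := fun k => tproj h (u' k - u k)) hneg (fun k hk => by
      simp only [hu, hu']
      exact hS.norm_tproj_sphStep_sub_le hγ hM hγM hr1 hcM hh (hS.norm_iterate γ hu0 hu k)
        (hS.norm_iterate γ hu0' hu' k) (hr k hk.le) (hr' k hk.le)
        (hG _ (hS.norm_iterate γ hu0 hu k) (hr k hk.le))
        (hG _ (hS.norm_iterate γ hu0' hu' k) (hr' k hk.le)))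
  refine hgrow.trans ((norm_tproj_le hh _).trans ?_)
  have : u' K - u K = (u' K - h) - (u K - h) := by abel
  rw [this]
  refine (norm_sub_le _ _).trans ?_
  linarith [hr K le_rfl, hr' K le_rfl]

/-- The perturbation decreases the quartic form by little at a nearly stationary point. -/
lemma quartic_perturb_ge (hM : 0 ≤ M) {h z : V} {c : ℝ} (hh : ‖h‖ = 1)
    (hz : inner ℝ h z = (0 : ℝ)) (hz1 : ‖z‖ ≤ 1 / 10) (hc : ‖sphGrad S h‖ ≤ c) :
    quartic S h - 4 * c * ‖z‖ - 32 * M * ‖z‖ ^ 2 ≤ quartic S (perturb h z) := by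
  have h0 := norm_nonneg z
  have hs1 := one_sub_sqrt_le (sq_nonneg ‖z‖) (by nlinarith)
  have hs2 : √(1 - ‖z‖ ^ 2) ≤ 1 := Real.sqrt_le_one.2 (by nlinarith)
  set w := perturb h z - h with hw
  have hwn : ‖w‖ ≤ 2 * ‖z‖ := norm_perturb_sub_le hh (by linarith)
  have hw' : w = (√(1 - ‖z‖ ^ 2) - 1) • h + z := by rw [hw, perturb]; module
  have hexp := (abs_le.1 (hS.abs_quartic_add_sub_le hM h w)).1
  rw [show h + w = perturb h z by rw [hw]; abel, hh] at hexp
  -- The radial part of the displacement is of size `‖z‖²`, so at first order only the tangential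
  -- part counts, and the gradient there is at most `c`.
  have hin : inner ℝ (S h h h) w = (√(1 - ‖z‖ ^ 2) - 1) * quartic S h
      - inner ℝ (sphGrad S h) z := by
    rw [hw', inner_add_right, inner_smul_right, sphGrad, inner_sub_left, inner_smul_left, hz]
    simp [quartic]
  have hg := abs_le.1 (inner_le_of_norm_le hc (le_refl ‖z‖))
  have hq := abs_le.1 (hS.abs_quartic_le_one hh)
  have hin' : -(c * ‖z‖) - M * ‖z‖ ^ 2 ≤ inner ℝ (S h h h) w := by
    rw [hin]
    have : -(M * ‖z‖ ^ 2) ≤ (√(1 - ‖z‖ ^ 2) - 1) * quartic S h := by nlinarith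
    linarith
  have hpoly : M * (6 * 1 ^ 2 * ‖w‖ ^ 2 + 4 * 1 * ‖w‖ ^ 3 + ‖w‖ ^ 4) ≤ 28 * M * ‖z‖ ^ 2 := by
    have h1 : 6 * 1 ^ 2 * ‖w‖ ^ 2 + 4 * 1 * ‖w‖ ^ 3 + ‖w‖ ^ 4
        ≤ 6 * 1 ^ 2 * (2 * ‖z‖) ^ 2 + 4 * 1 * (2 * ‖z‖) ^ 3 + (2 * ‖z‖) ^ 4 := by
      gcongr
    have h2 : 6 * 1 ^ 2 * (2 * ‖z‖) ^ 2 + 4 * 1 * (2 * ‖z‖) ^ 3 + (2 * ‖z‖) ^ 4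
        ≤ 28 * ‖z‖ ^ 2 := by
      have : ‖z‖ ^ 2 * ‖z‖ ≤ ‖z‖ ^ 2 * (1 / 10) := by gcongr
      nlinarith [mul_le_mul_of_nonneg_left hz1 (mul_nonneg (sq_nonneg ‖z‖) h0)]
    calc _ ≤ M * (28 * ‖z‖ ^ 2) := by gcongr; exact h1.trans h2
      _ = _ := by ring
  linarith

/-- Two perturbations that differ by a multiple of a direction of negative curvature cannot both
fail to increase the quartic form by more than `Δ` in `K` steps. -/
lemma growth_le_of_stuck {γ : ℝ} (hγ : 0 ≤ γ) (hM : 0 ≤ M) (hγM : γ * M ≤ 1 / 100)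
    {h v : V} {D r c lam Δ τ : ℝ} {K : ℕ} (hr1 : r ≤ 1 / 10) (hD1 : D ≤ 1) (hh : ‖h‖ = 1)
    (hc : ‖sphGrad S h‖ ≤ c) (hcM : c + 8 * M * r ≤ M) (hlam : 0 ≤ lam) (hlamM : lam ≤ 4 * M)
    (hη : 20 * M * r + 2 * γ * (c + 8 * M * r) ^ 2 ≤ lam / 4)
    (hK : 20 * M * (γ * (20 * M * r + 2 * γ * (c + 8 * M * r) ^ 2)) * K ≤ lam / 4)
    (hDr : 2 * D + √(K * γ * Δ / 3.6) ≤ r)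
    (hv : ‖v‖ = 1) (hhv : inner ℝ h v = (0 : ℝ))
    (hneg : inner ℝ v (sphHess S hS h v) ≤ -lam) (hτ : 0 ≤ τ)
    {z : V} (hz : inner ℝ h z = (0 : ℝ)) (hzD : ‖z‖ ≤ D) (hzD' : ‖z + τ • v‖ ≤ D)
    (hstuck : quartic S ((sphStep S γ)^[K] (perturb h z)) - quartic S (perturb h z) ≤ Δ)
    (hstuck' : quartic S ((sphStep S γ)^[K] (perturb h (z + τ • v)))
      - quartic S (perturb h (z + τ • v)) ≤ Δ) :
    (1 + γ * (lam / 2)) ^ K * τ ≤ 2 * r := by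
  have hz' : inner ℝ h (z + τ • v) = (0 : ℝ) := by
    rw [inner_add_right, inner_smul_right, hz, hhv]; simp
  have hnear : ∀ z : V, inner ℝ h z = (0 : ℝ) → ‖z‖ ≤ D →
      quartic S ((sphStep S γ)^[K] (perturb h z)) - quartic S (perturb h z) ≤ Δ →
      ∀ k ≤ K, ‖(sphStep S γ)^[k] (perturb h z) - h‖ ≤ r := by
    intro z hz hzD hst k hk
    have h1 := hS.norm_iterate_sub_sq_le hγ hM hγM (u := fun k => (sphStep S γ)^[k] (perturb h z))
      (norm_perturb hh hz (hzD.trans hD1)) (fun k => Function.iterate_succ_apply' _ _ _) hst hk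
    have h2 := Real.le_sqrt_of_sq_le h1
    have h3 := norm_perturb_sub_le (z := z) hh (hzD.trans hD1)
    have h4 := norm_add_le ((sphStep S γ)^[k] (perturb h z) - perturb h z) (perturb h z - h)
    rw [sub_add_sub_cancel] at h4
    simp only [Function.iterate_zero, id_eq] at h2
    linarith
  -- The projection to the tangent space undoes the lift to the sphere, so the initial difference is
  -- exactly `τ v`.
  have hdiff : tproj h (perturb h (z + τ • v) - perturb h z) = τ • v := by
    rw [map_sub, tproj_perturb hh hz', tproj_perturb hh hz, add_sub_cancel_left]
  have := hS.growth_le_of_near hγ hM hγM hr1 hh hc hcM hlam hlamM hη hK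
    (u := fun k => (sphStep S γ)^[k] (perturb h z))
    (u' := fun k => (sphStep S γ)^[k] (perturb h (z + τ • v)))
    (norm_perturb hh hz (hzD.trans hD1)) (fun k => Function.iterate_succ_apply' _ _ _)
    (norm_perturb hh hz' (hzD'.trans hD1)) (fun k => Function.iterate_succ_apply' _ _ _)
    (hnear z hz hzD hstuck) (hnear _ hz' hzD' hstuck') (by
      simp only [Function.iterate_zero, id_eq]
      rw [hdiff, map_smul, inner_smul_left, inner_smul_right, norm_smul, hv, mul_one,
        Real.norm_of_nonneg hτ]
      simp only [RCLike.conj_to_real]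
      nlinarith [mul_nonneg hτ hτ])
  simp only [Function.iterate_zero, id_eq] at this
  rwa [hdiff, norm_smul, hv, mul_one, Real.norm_of_nonneg hτ] at this

end SymmQuartic

end Stuck

/-! ### Saddle points of the `ℓ⁴` objective have a direction of negative curvature. -/

section Geometry

variable {ι : Type*} [Fintype ι]

/-- A nearly stationary point of the `ℓ⁴` norm on the sphere which is not close to a basis vector
has two large coordinates. -/
lemma exists_two_large_coordinates {t : ι → ℝ} (ht : ∑ j, t j ^ 2 = 1) {ρ β : ℝ} (hρ0 : 0 < ρ)
    (hρ : ρ < 1 / 1000) (hβ : β ≤ 0.52 * ρ ^ 2 / (Fintype.card ι : ℝ) ^ 2)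
    (hcrit : ∀ j, |t j * (∑ k, t k ^ 4 - t j ^ 2)| ≤ β) (hfar : ∀ j, t j ^ 2 < 1 - ρ) :
    1 ≤ Fintype.card ι * ∑ k, t k ^ 4 ∧ ∃ j k, j ≠ k ∧
      0.9 * ∑ k, t k ^ 4 ≤ t j ^ 2 ∧ 0.9 * ∑ k, t k ^ 4 ≤ t k ^ 2 := by
  set s := ∑ k, t k ^ 4 with hs
  set n : ℝ := (Fintype.card ι : ℝ) with hn
  have hns : 1 ≤ n * s := by
    have := sq_sum_le_card_mul_sum_sq (s := Finset.univ) (f := fun j => t j ^ 2)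
    rw [ht, Finset.card_univ] at this
    calc (1 : ℝ) = 1 ^ 2 := by norm_num
      _ ≤ _ := this
      _ = n * s := by
        rw [hs, hn]; congr 1; exact Finset.sum_congr rfl fun j _ => by ring
  refine ⟨hns, ?_⟩
  -- `n s ≥ 1` also rules out an empty index set.
  have hn1 : 1 ≤ n := by
    rcases Nat.eq_zero_or_pos (Fintype.card ι) with h | h
    · rw [hn, h] at hns; norm_num at hns
    · rw [hn]; exact_mod_cast h
  have hs0 : 0 < s := by
    by_contra h
    nlinarith
  have hβ0 : 0 ≤ β := by
    obtain ⟨j⟩ : Nonempty ι := by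
      by_contra h
      rw [not_nonempty_iff] at h
      simp at ht
    exact (abs_nonneg _).trans (hcrit j)
  have hβn : β * n ^ 2 ≤ 0.52 * ρ ^ 2 := by
    rwa [le_div_iff₀ (by positivity)] at hβ
  have hsq : ∀ j, t j ^ 2 * (s - t j ^ 2) ^ 2 ≤ β ^ 2 := fun j => by
    rw [← mul_pow, ← sq_abs]
    exact pow_le_pow_left₀ (abs_nonneg _) (hcrit j) 2
  have hβ2 : β ^ 2 * n ^ 4 ≤ 0.2704 * ρ ^ 4 := by
    calc β ^ 2 * n ^ 4 = (β * n ^ 2) ^ 2 := by ring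
      _ ≤ (0.52 * ρ ^ 2) ^ 2 := by gcongr
      _ = _ := by ring
  have hρ4 : ρ ^ 4 ≤ 1 / 1000 * ρ ^ 3 := by
    have : 0 < ρ ^ 3 := by positivity
    nlinarith
  have hρ3 : ρ ^ 3 ≤ 1 / 1000 * ρ := by
    nlinarith [mul_pos hρ0 hρ0]
  -- coordinates are large or tiny
  have hlarge : ∀ j, s / 2 ≤ t j ^ 2 → 0.9 * s ≤ t j ^ 2 := fun j hj => by
    by_contra hlt
    push Not at hlt
    have h1 : s / 2 * (0.1 * s) ^ 2 ≤ t j ^ 2 * (s - t j ^ 2) ^ 2 := by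
      gcongr
      linarith
    have h2 : s ^ 3 / 200 ≤ β ^ 2 := by linarith [hsq j]
    have h3 : 1 ≤ (n * s) ^ 3 := one_le_pow₀ hns
    have h4 : n ^ 3 * (s ^ 3 / 200) ≤ n ^ 3 * β ^ 2 := by gcongr
    have h5 : n ^ 3 * β ^ 2 ≤ n * (n ^ 3 * β ^ 2) := le_mul_of_one_le_left (by positivity) hn1
    nlinarith
  have hsmall : ∀ j, t j ^ 2 < s / 2 → t j ^ 2 ≤ 1.1 * ρ ^ 4 / n ^ 2 := fun j hj => by
    have h1 : t j ^ 2 * (s / 2) ^ 2 ≤ t j ^ 2 * (s - t j ^ 2) ^ 2 := by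
      gcongr
      linarith
    have h2 : t j ^ 2 * s ^ 2 ≤ 4 * β ^ 2 := by nlinarith [hsq j]
    rw [le_div_iff₀ (by positivity)]
    have h3 : t j ^ 2 * 1 ≤ t j ^ 2 * (n * s) ^ 2 := by
      gcongr; exact one_le_pow₀ hns
    have h4 : t j ^ 2 * n ^ 2 ≤ n ^ 4 * (t j ^ 2 * s ^ 2) := by
      have := mul_le_mul_of_nonneg_right h3 (sq_nonneg n)
      linarith
    have h5 : n ^ 4 * (t j ^ 2 * s ^ 2) ≤ n ^ 4 * (4 * β ^ 2) := by gcongr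
    nlinarith [pow_pos hρ0 4]
  by_contra hno
  push Not at hno
  -- Without two large coordinates all but one are tiny. The remaining one then has square at least
  -- `1 - 1.1 ρ⁴`, against the assumption of being far from the basis.
  have hone : ∃ i, ∀ j, j ≠ i → t j ^ 2 < s / 2 := by
    by_cases h : ∃ i, s / 2 ≤ t i ^ 2
    · obtain ⟨i, hi⟩ := h
      refine ⟨i, fun j hj => ?_⟩
      by_contra hlt
      push Not at hlt
      exact absurd (hlarge i hi) (not_le.2 (hno j i hj (hlarge j hlt)))
    · push Not at h
      obtain ⟨j⟩ : Nonempty ι := by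
        by_contra h
        rw [not_nonempty_iff] at h
        simp at ht
      exact ⟨j, fun k _ => h k⟩
  obtain ⟨i, hi⟩ := hone
  classical
  have hsplit := Finset.add_sum_erase Finset.univ (fun j => t j ^ 2) (Finset.mem_univ i)
  rw [ht] at hsplit
  have hrest : ∑ j ∈ Finset.univ.erase i, t j ^ 2 ≤ n * (1.1 * ρ ^ 4 / n ^ 2) := by
    have h1 := Finset.sum_le_card_nsmul (Finset.univ.erase i) (fun j => t j ^ 2) _
      (fun j hj => hsmall j (hi j (Finset.ne_of_mem_erase hj)))
    rw [nsmul_eq_mul] at h1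
    refine h1.trans ?_
    gcongr
    rw [hn]
    exact_mod_cast Finset.card_le_univ _
  have h6 : n * (1.1 * ρ ^ 4 / n ^ 2) ≤ 1.1 * ρ ^ 4 := by
    rw [show n * (1.1 * ρ ^ 4 / n ^ 2) = 1.1 * ρ ^ 4 / n by field_simp]
    exact div_le_self (by positivity) hn1
  have := hfar i
  linarith

variable {V : Type*} [NormedAddCommGroup V] [InnerProductSpace ℝ V]

/-- The cubic map whose quartic form is `α` times the fourth power of the `ℓ⁴` norm of the
coordinates in the basis `b`. -/
def diagCubic (b : OrthonormalBasis ι ℝ V) (α : ℝ) (x y z : V) : V :=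
  α • ∑ j, (inner ℝ (b j) x * inner ℝ (b j) y * inner ℝ (b j) z : ℝ) • b j

lemma inner_diagCubic (b : OrthonormalBasis ι ℝ V) (α : ℝ) (x y z w : V) :
    inner ℝ (diagCubic b α x y z) w
      = α * ∑ j, inner ℝ (b j) x * inner ℝ (b j) y * inner ℝ (b j) z * inner ℝ (b j) w := by
  simp only [diagCubic, inner_smul_left, sum_inner, RCLike.conj_to_real]

lemma inner_basis_diagCubic (b : OrthonormalBasis ι ℝ V) (α : ℝ) (x y z : V) (j : ι) :
    inner ℝ (b j) (diagCubic b α x y z)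
      = α * (inner ℝ (b j) x * inner ℝ (b j) y * inner ℝ (b j) z) := by
  classical
  rw [real_inner_comm, inner_diagCubic]
  congr 1
  simp [b.inner_eq_ite]

set_option maxHeartbeats 400000 in
/-- Near-stationary points of a perturbation of the `ℓ⁴` objective which are not close to a basis
vector have a tangent direction of negative curvature. -/
lemma exists_negative_curvature {S : V → V → V → V} {M : ℝ} (hS : SymmQuartic S M)
    (b : OrthonormalBasis ι ℝ V) {a ρ ε : ℝ} (ha : 0 < a) (hρ0 : 0 < ρ) (hρ : ρ < 1 / 1000)
    (hε : ε ≤ a * ρ ^ 2 / (100 * Fintype.card ι))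
    (hE : ∀ x y z, ‖S x y z - diagCubic b (Fintype.card ι * a) x y z‖ ≤ ε * ‖x‖ * ‖y‖ * ‖z‖)
    {h : V} (hh : ‖h‖ = 1) (hgrad : ‖sphGrad S h‖ ≤ a * ρ ^ 2 / (2 * Fintype.card ι))
    (hfar : ∀ j, inner ℝ (b j) h ^ 2 < 1 - ρ) :
    ∃ v, ‖v‖ = 1 ∧ inner ℝ h v = (0 : ℝ) ∧ inner ℝ v (sphHess S hS h v) ≤ -(1.5 * a) := by
  set n : ℝ := (Fintype.card ι : ℝ) with hn
  set t : ι → ℝ := fun j => inner ℝ (b j) h with ht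
  set s := ∑ k, t k ^ 4 with hs
  have hsum : ∑ j, t j ^ 2 = 1 := by
    have := b.sum_sq_norm_inner_right h
    simpa [hh] using this
  have hn1 : 1 ≤ n := by
    have : Nonempty ι := by
      by_contra h
      rw [not_nonempty_iff] at h
      simp at hsum
    rw [hn]; exact_mod_cast Fintype.card_pos
  have hn0 : 0 < n := by linarith
  have hq : |quartic S h - n * a * s| ≤ ε := by
    have h1 := inner_le_of_norm_le (hE h h h) hh.le
    rw [inner_sub_left, inner_diagCubic, hh] at h1
    simp only [mul_one] at h1
    have e : ∑ j, inner ℝ (b j) h * inner ℝ (b j) h * inner ℝ (b j) h * inner ℝ (b j) h = s :=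
      Finset.sum_congr rfl fun j _ => by simp only [ht]; ring
    rwa [e] at h1
  have ht1 : ∀ j, |t j| ≤ 1 := fun j => by
    have := abs_real_inner_le_norm (b j) h
    simpa [hh] using this
  have hcoord : ∀ j, |t j * (s - t j ^ 2)| ≤ (a * ρ ^ 2 / (2 * n) + 2 * ε) / (n * a) := fun j => by
    have h1 := inner_le_of_norm_le (b.norm_eq_one j).le hgrad
    have h2 := inner_le_of_norm_le (b.norm_eq_one j).le (hE h h h)
    rw [inner_sub_right, inner_basis_diagCubic, hh] at h2
    rw [sphGrad, inner_sub_right, inner_smul_right] at h1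
    simp only [mul_one, one_mul] at h1 h2
    have h3 : |(quartic S h - n * a * s) * t j| ≤ ε * 1 := by
      rw [abs_mul]
      exact mul_le_mul hq (ht1 j) (abs_nonneg _) ((abs_nonneg _).trans hq)
    rw [le_div_iff₀ (by positivity)]
    have hna : 0 < n * a := by positivity
    rw [show |t j * (s - t j ^ 2)| * (n * a) = |t j * (s - t j ^ 2) * (n * a)| by
      rw [abs_mul _ (n * a), abs_of_pos hna]]
    rw [show inner ℝ (b j) h = t j from rfl] at h1 h2
    have := abs_le.1 h1
    have := abs_le.1 h2
    have := abs_le.1 h3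
    rw [abs_le]
    constructor <;> linarith
  -- The constant `0.52` is `0.5` from the gradient tolerance plus `0.02` from twice the model
  -- error.
  have hβ : (a * ρ ^ 2 / (2 * n) + 2 * ε) / (n * a) ≤ 0.52 * ρ ^ 2 / n ^ 2 := by
    have h1 : a * ρ ^ 2 / (2 * n) + 2 * ε ≤ 0.52 * (a * ρ ^ 2 / n) := by
      have e1 : a * ρ ^ 2 / (100 * n) = 0.01 * (a * ρ ^ 2 / n) := by field_simp; norm_num
      have e2 : a * ρ ^ 2 / (2 * n) = 0.5 * (a * ρ ^ 2 / n) := by field_simp; norm_num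
      rw [e1] at hε; rw [e2]; linarith
    calc _ ≤ 0.52 * (a * ρ ^ 2 / n) / (n * a) := by gcongr
      _ = _ := by field_simp
  obtain ⟨hns, j, k, hjk, hj, hk⟩ := exists_two_large_coordinates hsum hρ0 hρ hβ hcoord hfar
  rw [← hs] at hj hk hns
  have hs0 : 0 < s := by
    by_contra h
    nlinarith
  set N := t j ^ 2 + t k ^ 2 with hN
  have hN0 : 0 < N := by linarith
  classical
  -- The infinitesimal rotation in the plane of the two large coordinates; it is tangent at `h`.
  set w : V := t k • b j - t j • b k with hw
  have hbj : ∀ i, inner ℝ (b i) w = t k * (if i = j then 1 else 0) - t j * (if i = k then 1 else 0) :=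
    fun i => by
      rw [hw, inner_sub_right, inner_smul_right, inner_smul_right, b.inner_eq_ite, b.inner_eq_ite]
  have hwn : ‖w‖ ^ 2 = N := by
    rw [hw, norm_sub_sq_real, norm_smul, norm_smul, inner_smul_left, inner_smul_right,
      b.inner_eq_ite]
    simp [hjk, hN]
    ring
  have hwn' : ‖w‖ = √N := by rw [← hwn, Real.sqrt_sq (norm_nonneg _)]
  have hwpos : 0 < ‖w‖ := by rw [hwn']; positivity
  have hhw : inner ℝ h w = (0 : ℝ) := by
    rw [hw, inner_sub_right, inner_smul_right, inner_smul_right, real_inner_comm (b j),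
      real_inner_comm (b k)]
    simp only [ht]; ring
  have hform : inner ℝ w (sphHess S hS h w) ≤ -(1.5 * a) * N := by
    rw [hS.inner_sphHess_self hhw, hwn]
    have h1 := inner_le_of_norm_le (hE h h w) (le_refl ‖w‖)
    rw [inner_sub_left, inner_diagCubic, hh, mul_one, mul_one, mul_assoc ε, ← sq, hwn] at h1
    have h2 : ∑ i, inner ℝ (b i) h * inner ℝ (b i) h * inner ℝ (b i) w * inner ℝ (b i) w
        = 2 * t j ^ 2 * t k ^ 2 := by
      have : ∀ i, inner ℝ (b i) h * inner ℝ (b i) h * inner ℝ (b i) w * inner ℝ (b i) w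
          = (if i = j then t j ^ 2 * t k ^ 2 else 0) + (if i = k then t j ^ 2 * t k ^ 2 else 0) := by
        intro i
        rw [hbj]
        by_cases hij : i = j
        · subst hij; simp [hjk]; simp only [ht]; ring
        · by_cases hik : i = k
          · subst hik; simp [hij]; simp only [ht]; ring
          · simp [hij, hik]
      rw [Finset.sum_congr rfl fun i _ => this i, Finset.sum_add_distrib]
      simp
      ring
    rw [h2] at h1
    have h3 := (abs_le.1 h1).1
    have h4 := (abs_le.1 hq).2
    -- Since both squares are at least `0.9 s`, the Hessian form is at most `n a s N (1 - 2.7) + 4 ε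
    -- N`. With `n s ≥ 1` and `ε ≤ 0.01 a` this is below `-1.5 a N`.
    have h5 : 0.9 * s * N ≤ 2 * t j ^ 2 * t k ^ 2 := by
      linarith [mul_nonneg (sub_nonneg.2 hj) (sq_nonneg (t k)),
        mul_nonneg (sub_nonneg.2 hk) (sq_nonneg (t j))]
    have h6 : n * a * (0.9 * s * N) ≤ n * a * (2 * t j ^ 2 * t k ^ 2) := by gcongr
    have h7 : quartic S h * N ≤ (n * a * s + ε) * N := by gcongr; linarith
    have h8 : a ≤ n * a * s := by linarith [mul_le_mul_of_nonneg_left hns ha.le]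
    have h9 : ε ≤ 0.01 * a := by
      refine hε.trans ?_
      rw [div_le_iff₀ (by positivity)]
      have h10 : a * ρ ^ 2 ≤ a * 1 := by
        gcongr
        exact pow_le_one₀ hρ0.le (by linarith)
      linarith [mul_le_mul_of_nonneg_left hn1 ha.le]
    have h10 : a * N ≤ n * a * s * N := by gcongr
    have h11 : ε * N ≤ 0.01 * a * N := by gcongr
    have h12 : 0 < a * N := by positivity
    linarith
  refine ⟨‖w‖⁻¹ • w, ?_, ?_, ?_⟩
  · rw [norm_smul, norm_inv, norm_norm, inv_mul_cancel₀ hwpos.ne']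
  · rw [inner_smul_right, hhw, mul_zero]
  · rw [map_smul, inner_smul_left, inner_smul_right, ← mul_assoc]
    simp only [RCLike.conj_to_real]
    have : ‖w‖⁻¹ * ‖w‖⁻¹ * N = 1 := by rw [← hwn]; field_simp
    have h1 : 0 ≤ ‖w‖⁻¹ * ‖w‖⁻¹ := by positivity
    nlinarith [mul_le_mul_of_nonneg_left hform h1]

end Geometry

/-! ### Packing bound for sets without long translates. -/

section Packing

open scoped ENNReal

/-- This is the growth of the volume of a `d`-dimensional ball when its radius is multiplied by `1 +
1/d`. -/
lemma one_add_inv_pow_le_three (d : ℕ) : (1 + 1 / (d : ℝ)) ^ d ≤ 3 := by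
  rcases Nat.eq_zero_or_pos d with rfl | hd
  · norm_num
  have hd' : (0 : ℝ) < d := by exact_mod_cast hd
  have h1 : 1 + 1 / (d : ℝ) ≤ Real.exp (1 / d) := by
    linarith [Real.add_one_le_exp (1 / (d : ℝ))]
  calc (1 + 1 / (d : ℝ)) ^ d ≤ Real.exp (1 / d) ^ d := by gcongr
    _ = Real.exp 1 := by rw [← Real.exp_nat_mul]; congr 1; field_simp
    _ ≤ 3 := Real.exp_one_lt_three.le

/-- A subset of a ball which contains no two points that differ by a large multiple of a fixed unit
vector has small measure. -/
theorem measure_le_of_no_translate {E : Type*} [NormedAddCommGroup E] [NormedSpace ℝ E]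
    [MeasurableSpace E] [BorelSpace E] [FiniteDimensional ℝ E] (μ : Measure E)
    [μ.IsAddHaarMeasure] {D τ : ℝ} (hD : 0 < D) (hτ : 0 < τ) {v : E} (hv : ‖v‖ = 1) {T : Set E}
    (hT : MeasurableSet T) (hTD : T ⊆ Metric.closedBall 0 D)
    (hno : ∀ z ∈ T, ∀ s, τ ≤ s → z + s • v ∉ T) :
    μ T ≤ ENNReal.ofReal (3 * Module.finrank ℝ E * τ / D) * μ (Metric.closedBall 0 D) := by
  have : Nontrivial E := ⟨v, 0, by intro h; simp [h] at hv⟩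
  set d := Module.finrank ℝ E with hd
  have hd0 : 0 < d := Module.finrank_pos
  have hd' : (0 : ℝ) < d := by exact_mod_cast hd0
  set m := ⌊D / (d * τ)⌋₊ with hm
  set U : ℕ → Set E := fun j => (fun z => (-((j * τ) • v)) + z) ⁻¹' T with hU
  have hmem : ∀ j z, z ∈ U j ↔ -((j * τ) • v) + z ∈ T := fun j z => Iff.rfl
  have hUmeas : ∀ j, MeasurableSet (U j) := fun j => (measurable_const_add _) hT
  have hlt : ∀ i j : ℕ, i < j → Disjoint (U i) (U j) := by
    intro i j hij
    rw [Set.disjoint_left]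
    intro z hi hj
    rw [hmem] at hi hj
    refine hno _ hj ((j - i : ℝ) * τ) ?_ ?_
    · have : (1 : ℝ) ≤ j - i := by
        have : (i : ℝ) + 1 ≤ j := by exact_mod_cast hij
        linarith
      nlinarith
    · convert hi using 1
      module
  have hdisj : Set.PairwiseDisjoint (↑(Finset.range (m + 1))) U := by
    intro i _ j _ hij
    rcases lt_or_gt_of_ne hij with h | h
    · exact hlt i j h
    · exact (hlt j i h).symm
  have hmD : m * τ ≤ D / d := by
    have h1 : (m : ℝ) ≤ D / (d * τ) := Nat.floor_le (by positivity)
    calc m * τ ≤ D / (d * τ) * τ := by gcongr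
      _ = D / d := by field_simp
  have hsub : (⋃ j ∈ Finset.range (m + 1), U j) ⊆ Metric.closedBall 0 ((1 + 1 / (d : ℝ)) * D) := by
    refine Set.iUnion₂_subset fun j hj z hz => ?_
    rw [hmem] at hz
    have h1 := hTD hz
    rw [mem_closedBall_zero_iff] at h1 ⊢
    have hjm : (j : ℝ) ≤ m := by
      exact_mod_cast Nat.lt_succ_iff.1 (Finset.mem_range.1 hj)
    have h2 : z = (-((j * τ) • v) + z) + (j * τ) • v := by abel
    rw [h2]
    refine (norm_add_le _ _).trans ?_
    rw [norm_smul, hv, mul_one, Real.norm_of_nonneg (by positivity)]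
    have h3 : j * τ ≤ m * τ := by gcongr
    have h4 : (1 + 1 / (d : ℝ)) * D = D + D / d := by field_simp
    linarith
  have hcount : ((m : ℝ≥0∞) + 1) * μ T
      ≤ ENNReal.ofReal 3 * μ (Metric.closedBall 0 D) := by
    calc ((m : ℝ≥0∞) + 1) * μ T = ∑ j ∈ Finset.range (m + 1), μ (U j) := by
          simp [hU, measure_preimage_add]
      _ = μ (⋃ j ∈ Finset.range (m + 1), U j) :=
          (measure_biUnion_finset hdisj fun j _ => hUmeas j).symm
      _ ≤ μ (Metric.closedBall 0 ((1 + 1 / (d : ℝ)) * D)) := measure_mono hsub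
      _ = ENNReal.ofReal ((1 + 1 / (d : ℝ)) ^ d) * μ (Metric.closedBall 0 D) :=
          Measure.addHaar_closedBall_mul μ 0 (by positivity) hD.le
      _ ≤ _ := by gcongr; exact one_add_inv_pow_le_three d
  have hm1 : ENNReal.ofReal (D / (d * τ)) ≤ (m : ℝ≥0∞) + 1 := by
    rw [← ENNReal.ofReal_natCast, ← ENNReal.ofReal_one, ← ENNReal.ofReal_add (by positivity)
      (by norm_num)]
    exact ENNReal.ofReal_le_ofReal (Nat.lt_floor_add_one _).le
  have hone : ENNReal.ofReal (d * τ / D) * ENNReal.ofReal (D / (d * τ)) = 1 := by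
    rw [← ENNReal.ofReal_mul (by positivity), ← ENNReal.ofReal_one]
    congr 1
    field_simp
  calc μ T = ENNReal.ofReal (d * τ / D) * ENNReal.ofReal (D / (d * τ)) * μ T := by
        rw [hone, one_mul]
    _ ≤ ENNReal.ofReal (d * τ / D) * (((m : ℝ≥0∞) + 1) * μ T) := by
        rw [mul_assoc]; gcongr
    _ ≤ ENNReal.ofReal (d * τ / D) * (ENNReal.ofReal 3 * μ (Metric.closedBall 0 D)) := by gcongr
    _ = _ := by
        rw [← mul_assoc, ← ENNReal.ofReal_mul (by positivity)]
        congr 2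
        ring

end Packing

/-! ### The uniform law on tangent balls as a measurable kernel. -/

section TangentBall

variable {n : ℕ} [NeZero n]

lemma mem_orthogonal_span_singleton {h z : Sig n} :
    z ∈ (ℝ ∙ h)ᗮ ↔ inner ℝ h z = (0 : ℝ) := Submodule.mem_orthogonal_singleton_iff_inner_right

lemma finrank_tangent_le (h : Sig n) :
    Module.finrank ℝ ((ℝ ∙ h)ᗮ : Submodule ℝ (Sig n)) ≤ n := by
  refine (Submodule.finrank_le _).trans ?_
  rw [finrank_euclideanSpace, ZMod.card]

lemma tangentBallUniform_apply (D : ℝ) (h : Sig n) {B : Set (Sig n)} (hB : MeasurableSet B) :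
    tangentBallUniform D h B
      = (volume (Metric.closedBall (0 : ((ℝ ∙ h)ᗮ : Submodule ℝ (Sig n))) D))⁻¹
        * volume (Metric.closedBall (0 : ((ℝ ∙ h)ᗮ : Submodule ℝ (Sig n))) D
          ∩ Subtype.val ⁻¹' B) := by
  rw [tangentBallUniform, Measure.map_apply measurable_subtype_coe hB,
    cond_apply Metric.isClosed_closedBall.measurableSet]

/-- The perturbation is unlikely to fall into a set which contains no two points that differ by
a large multiple of a fixed tangent vector. -/
theorem tangentBallUniform_le {D τ : ℝ} (hD : 0 < D) (hτ : 0 < τ) {h v : Sig n} (hv : ‖v‖ = 1)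
    (hhv : inner ℝ h v = (0 : ℝ)) {T : Set (Sig n)} (hT : MeasurableSet T)
    (hno : ∀ z, inner ℝ h z = (0 : ℝ) → ‖z‖ ≤ D → z ∈ T → ∀ s, τ ≤ s → ‖z + s • v‖ ≤ D →
      z + s • v ∉ T) :
    tangentBallUniform D h {z | ¬(inner ℝ h z = (0 : ℝ) ∧ ‖z‖ ≤ D) ∨ z ∈ T}
      ≤ ENNReal.ofReal (3 * n * τ / D) := by
  set E : Submodule ℝ (Sig n) := (ℝ ∙ h)ᗮ with hE
  have hmeas : MeasurableSet {z : Sig n | ¬(inner ℝ h z = (0 : ℝ) ∧ ‖z‖ ≤ D) ∨ z ∈ T} := by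
    refine MeasurableSet.union (MeasurableSet.compl (MeasurableSet.inter ?_ ?_)) hT
    · exact measurableSet_eq_fun (f := fun z : Sig n => inner ℝ h z) (g := fun _ => (0 : ℝ))
        (by fun_prop) measurable_const
    · exact measurableSet_le (f := fun z : Sig n => ‖z‖) (g := fun _ => D) (by fun_prop)
        measurable_const
  rw [tangentBallUniform_apply D h hmeas]
  set B := Metric.closedBall (0 : E) D with hB
  have hBpos : 0 < volume B := Metric.measure_closedBall_pos _ _ hD
  have hBtop : volume B ≠ ⊤ := measure_closedBall_lt_top.ne
  have hle : volume (B ∩ Subtype.val ⁻¹' {z : Sig n | ¬(inner ℝ h z = (0 : ℝ) ∧ ‖z‖ ≤ D) ∨ z ∈ T})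
      ≤ ENNReal.ofReal (3 * Module.finrank ℝ E * τ / D) * volume B := by
    -- The first alternative of the event has probability zero: a point of the tangent ball
    -- satisfies both constraints.
    have hsub : B ∩ Subtype.val ⁻¹' {z : Sig n | ¬(inner ℝ h z = (0 : ℝ) ∧ ‖z‖ ≤ D) ∨ z ∈ T}
        = B ∩ Subtype.val ⁻¹' T := by
      ext z
      have h1 : inner ℝ h (z : Sig n) = (0 : ℝ) := mem_orthogonal_span_singleton.1 z.2
      simp only [hB, Set.mem_inter_iff, mem_closedBall_zero_iff, Set.mem_preimage,
        Set.mem_ofPred_eq, h1, true_and, and_congr_right_iff, Submodule.coe_norm]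
      intro h2
      simp [h2]
    rw [hsub]
    refine measure_le_of_no_translate (v := ⟨v, mem_orthogonal_span_singleton.2 hhv⟩) volume hD hτ
      hv (Metric.isClosed_closedBall.measurableSet.inter (measurable_subtype_coe hT))
      Set.inter_subset_left ?_
    rintro z ⟨hzB, hzT⟩ s hs ⟨hzB', hzT'⟩
    rw [mem_closedBall_zero_iff] at hzB hzB'
    exact hno z (mem_orthogonal_span_singleton.1 z.2) hzB hzT s hs hzB' hzT'
  calc (volume B)⁻¹ * _
      ≤ (volume B)⁻¹ * (ENNReal.ofReal (3 * Module.finrank ℝ E * τ / D) * volume B) := by gcongr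
    _ = ENNReal.ofReal (3 * Module.finrank ℝ E * τ / D) := by
        rw [mul_comm, mul_assoc, ENNReal.mul_inv_cancel hBpos.ne' hBtop, mul_one]
    _ ≤ _ := by
        apply ENNReal.ofReal_le_ofReal
        have : (Module.finrank ℝ E : ℝ) ≤ n := by exact_mod_cast finrank_tangent_le h
        gcongr

/-- The reflection exchanging the unit vectors `e` and `h`, as an explicit formula. -/
def householder (e h x : Sig n) : Sig n :=
  x - (2 * inner ℝ (e - h) x / ‖e - h‖ ^ 2) • (e - h)

/-- Division by zero makes the formula the identity when `e = h`, which is also the degenerate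
reflection. -/
lemma householder_eq_reflection (e h x : Sig n) :
    householder e h x = (ℝ ∙ (e - h))ᗮ.reflection x := by
  rw [Submodule.reflection_orthogonal_apply, Submodule.reflection_singleton_apply, householder]
  simp only [RCLike.ofReal_real_eq_id, id]
  module

lemma measurable_householder (e : Sig n) :
    Measurable fun p : Sig n × Sig n => householder e p.1 p.2 := by
  unfold householder
  fun_prop

lemma measurable_householder_right (e h : Sig n) : Measurable (householder e h) :=
  (measurable_householder e).comp measurable_prodMk_left

/-- The reflection is an isometry carrying the tangent space at `e` to that at `h`, hence it carries
one uniform law to the other. The dependence on `h` thus moves into a jointly measurable map applied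
to one fixed measure. -/
lemma tangentBallUniform_eq_map (D : ℝ) {e h : Sig n} (he : ‖e‖ = 1) (hh : ‖h‖ = 1) :
    tangentBallUniform D h = (tangentBallUniform D e).map (householder e h) := by
  set ρ : Sig n ≃ₗᵢ[ℝ] Sig n := (ℝ ∙ (e - h))ᗮ.reflection with hρ
  have hρe : ρ e = h := Submodule.reflection_sub (by rw [he, hh])
  have hmap : ((ℝ ∙ e)ᗮ : Submodule ℝ (Sig n)).map (ρ.toLinearEquiv : Sig n →ₗ[ℝ] Sig n)
      = (ℝ ∙ h)ᗮ := by
    ext z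
    rw [Submodule.mem_map, mem_orthogonal_span_singleton]
    constructor
    · rintro ⟨y, hy, rfl⟩
      rw [mem_orthogonal_span_singleton] at hy
      rw [← hρe]
      exact (ρ.inner_map_map e y).trans hy
    · intro hz
      refine ⟨ρ.symm z, ?_, ρ.apply_symm_apply z⟩
      rw [mem_orthogonal_span_singleton, ← ρ.inner_map_map, hρe, ρ.apply_symm_apply]
      exact hz
  set g : ((ℝ ∙ e)ᗮ : Submodule ℝ (Sig n)) ≃ₗᵢ[ℝ] ((ℝ ∙ h)ᗮ : Submodule ℝ (Sig n)) :=
    (ρ.submoduleMap _).trans (LinearIsometryEquiv.ofEq _ _ hmap) with hg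
  have hgv : ∀ z, ((g z : ((ℝ ∙ h)ᗮ : Submodule ℝ (Sig n))) : Sig n) = ρ z := fun z => rfl
  have hgm : MeasurePreserving g volume volume := g.measurePreserving
  have hball : g ⁻¹' Metric.closedBall 0 D = Metric.closedBall 0 D := by
    ext z
    simp
  ext B hB
  have hmh := measurable_householder_right e h
  rw [Measure.map_apply hmh hB, tangentBallUniform_apply D h hB,
    tangentBallUniform_apply D e (hmh hB)]
  have hgme := g.toHomeomorph.toMeasurableEquiv.measurableEmbedding
  have h1 : ∀ s, volume (g ⁻¹' s) = volume s := fun s => hgm.measure_preimage_emb hgme s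
  rw [← h1 (Metric.closedBall 0 D), ← h1 (Metric.closedBall 0 D ∩ Subtype.val ⁻¹' B),
    Set.preimage_inter, hball]
  congr 3
  ext z
  simp only [Set.mem_preimage, hgv, householder_eq_reflection]
  rfl

/-- The kernel which draws the perturbation at a point of the sphere. -/
def noiseKernel (D : ℝ) (e : Sig n) : Kernel (Sig n) (Sig n) where
  toFun h := (tangentBallUniform D e).map (householder e h)
  measurable' := by
    have : IsFiniteMeasure (tangentBallUniform D e) := by
      unfold tangentBallUniform; infer_instance
    refine Measure.measurable_of_measurable_coe _ fun B hB => ?_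
    have : ∀ h, (tangentBallUniform D e).map (householder e h) B
        = tangentBallUniform D e (Prod.mk h ⁻¹' ((fun p : Sig n × Sig n =>
          householder e p.1 p.2) ⁻¹' B)) := fun h => by
      rw [Measure.map_apply (measurable_householder_right e h) hB]
      rfl
    simp_rw [this]
    exact measurable_measure_prodMk_left (measurable_householder e hB)

lemma noiseKernel_apply (D : ℝ) {e h : Sig n} (he : ‖e‖ = 1) (hh : ‖h‖ = 1) :
    noiseKernel D e h = tangentBallUniform D h := (tangentBallUniform_eq_map D he hh).symm

instance (D : ℝ) (e : Sig n) : IsFiniteKernel (noiseKernel D e) := by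
  have : IsFiniteMeasure (tangentBallUniform D e) := by
    unfold tangentBallUniform; infer_instance
  refine ⟨⟨tangentBallUniform D e Set.univ, measure_lt_top _ _, fun h => ?_⟩⟩
  change (tangentBallUniform D e).map (householder e h) Set.univ ≤ _
  rw [Measure.map_apply (measurable_householder_right e h) MeasurableSet.univ]
  simp

end TangentBall

/-! ### From the conditional law of the noise to joint events. -/

section JointLaw

open scoped ENNReal

/-- If the conditional law of `Z` given the past is `κ X`, then a set of pairs whose sections have
probability at most `δ` is hit with conditional probability at most `δ`. -/
theorem measure_inter_le_of_cond_law {Ω E : Type*} [MeasurableSpace E] {m mΩ : MeasurableSpace Ω}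
    (hm : m ≤ mΩ) {P : Measure Ω} [IsFiniteMeasure P] (κ : Kernel E E) [IsFiniteKernel κ]
    {X Z : Ω → E} (hX : Measurable[m] X) (hZ : Measurable Z) {A : Set Ω}
    (hA : MeasurableSet[m] A)
    (hlaw : ∀ A', A' ⊆ A → MeasurableSet[m] A' → ∀ B, MeasurableSet B →
      P (A' ∩ Z ⁻¹' B) = ∫⁻ ω in A', κ (X ω) B ∂P)
    {T : Set (E × E)} (hT : MeasurableSet T) {δ : ℝ≥0∞}
    (hδ : ∀ ω ∈ A, κ (X ω) (Prod.mk (X ω) ⁻¹' T) ≤ δ) :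
    P (A ∩ {ω | (X ω, Z ω) ∈ T}) ≤ δ * P A := by
  have hX' : Measurable X := hX.mono hm le_rfl
  have hA' : MeasurableSet A := hm A hA
  -- The hypothesis determines the joint law of `(X, Z)` on rectangles, hence everywhere; events
  -- depending on both then reduce to their sections.
  have heq : (P.restrict A).map (fun ω => (X ω, Z ω)) = ((P.restrict A).map X) ⊗ₘ κ := by
    refine Measure.ext_prod fun {U B} hU hB => ?_
    rw [Measure.map_apply (hX'.prodMk hZ) (hU.prod hB), Measure.compProd_apply_prod hU hB,
      Measure.restrict_apply (hX'.prodMk hZ (hU.prod hB)),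
      setLIntegral_map hU (κ.measurable_coe hB) hX', Measure.restrict_restrict (hX' hU)]
    rw [← hlaw (X ⁻¹' U ∩ A) Set.inter_subset_right ((hX hU).inter hA) B hB]
    congr 1
    ext ω
    simp only [Set.mem_inter_iff, Set.mem_preimage, Set.mem_prod]
    tauto
  have h1 : P (A ∩ {ω | (X ω, Z ω) ∈ T}) = (P.restrict A).map (fun ω => (X ω, Z ω)) T := by
    rw [Measure.map_apply (hX'.prodMk hZ) hT, Measure.restrict_apply (hX'.prodMk hZ hT),
      Set.inter_comm]
    rfl
  rw [h1, heq, Measure.compProd_apply hT,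
    lintegral_map (Kernel.measurable_kernel_prodMk_left hT) hX']
  calc ∫⁻ ω in A, κ (X ω) (Prod.mk (X ω) ⁻¹' T) ∂P ≤ ∫⁻ _ in A, δ ∂P :=
        setLIntegral_mono measurable_const hδ
    _ = δ * P A := by simp

end JointLaw

/-! ### Deterministic energy accounting along one run. -/

section Path

lemma iterate_le_of_le {V : Type*} {sph : Set V} {F : V → ℝ} {step : V → V}
    (hstep : ∀ u ∈ sph, step u ∈ sph ∧ F (step u) ≤ F u) {w : V} (hw : w ∈ sph) {k m : ℕ}
    (hkm : k ≤ m) : step^[m] w ∈ sph ∧ F (step^[m] w) ≤ F (step^[k] w) := by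
  have hmem : ∀ m, step^[m] w ∈ sph := fun m => by
    induction m with
    | zero => exact hw
    | succ m ih => rw [Function.iterate_succ_apply']; exact (hstep _ ih).1
  refine ⟨hmem m, ?_⟩
  induction m, hkm using Nat.le_induction with
  | base => exact le_rfl
  | succ m hm ih =>
    rw [Function.iterate_succ_apply']
    exact (hstep _ (hmem m)).2.trans ih

open Classical in
/-- Energy accounting for perturbed descent: if all of the first `m` perturbations made up to time
`T` decrease the objective by `σ`, then `T` is bounded. -/
theorem time_le_of_good_perturbations {V : Type*} {sph : Set V} {F : V → ℝ} {small : V → Prop}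
    {step : V → V} {pt : V → V → V} {good : V → V → Prop} {g e σ E 𝒯 : ℝ} {K m T : ℕ}
    (hg : 0 < g) (he : 0 ≤ e) (hK : (K : ℝ) ≤ 𝒯)
    (hstep : ∀ u ∈ sph, step u ∈ sph ∧ F (step u) ≤ F u)
    (hdec : ∀ u ∈ sph, ¬small u → F (step u) ≤ F u - g)
    (hE : ∀ u ∈ sph, ∀ u' ∈ sph, F u - F u' ≤ E) (hm : E < σ * m) (hσ : 0 < σ)
    (hgood : ∀ u ∈ sph, ∀ z, small u → good u z → pt u z ∈ sph ∧ F (pt u z) ≤ F u + e ∧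
      F (step^[K] (pt u z)) ≤ F u - σ)
    {h z : ℕ → V} {s : ℕ → ℕ} (h0 : h 0 ∈ sph) (s0 : s 0 = 0)
    (hh : ∀ t, h (t + 1) = step (if small (h t) ∧ (t : ℝ) - s t > 𝒯 then pt (h t) (z t) else h t))
    (hs : ∀ t, s (t + 1) = if small (h t) ∧ (t : ℝ) - s t > 𝒯 then t else s t)
    (hz : ∀ t < T, small (h t) ∧ (t : ℝ) - s t > 𝒯 → h t ∈ sph →
      Nat.count (fun t => small (h t) ∧ (t : ℝ) - s t > 𝒯) t < m → good (h t) (z t)) :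
    (T : ℝ) ≤ m + (E + e * m) / g + (m + 1) * (𝒯 + 1) := by
  set test : ℕ → Prop := fun t => small (h t) ∧ (t : ℝ) - s t > 𝒯 with htest
  set p : ℕ → ℕ := fun t => Nat.count test t with hp
  have hps : ∀ t, p (t + 1) = p t + if test t then 1 else 0 := fun t => Nat.count_succ _ _
  have h𝒯 : 0 ≤ 𝒯 := (Nat.cast_nonneg K).trans hK
  -- Here `p t` counts perturbations, `a` steps with large gradient and `b` steps spent waiting,
  -- while `w` is the last perturbed point. A waiting step needs `t - s t ≤ 𝒯`, so there are at most
  -- `𝒯 + 1` of them for each value of `s t`.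
  have key : ∀ t ≤ T, h t ∈ sph ∧ p t ≤ m ∧ s t ≤ t ∧
      ((p t = 0 ∧ F (h t) ≤ F (h 0)) ∨
        (1 ≤ p t ∧ ∃ w ∈ sph, h t = step^[t - s t] w ∧
          F (step^[K] w) ≤ F (h 0) - σ * p t)) ∧
      ∃ a b : ℕ, t = p t + a + b ∧ (b : ℝ) ≤ p t * (𝒯 + 1) + min ((t : ℝ) - s t) (𝒯 + 1) ∧
        g * a ≤ F (h 0) - F (h t) + e * p t := by
    intro t
    induction t with
    | zero =>
      intro _
      refine ⟨h0, by simp [hp], by simp [s0], Or.inl ⟨by simp [hp], le_rfl⟩, 0, 0, by simp [hp], ?_,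
        by simp [hp]⟩
      simp [hp, s0]
      linarith
    | succ t ih =>
      intro htT
      obtain ⟨hsph, hpm, hst, hcase, a, b, hab, hb, ha⟩ := ih (by omega)
      have hstR : (s t : ℝ) ≤ t := by exact_mod_cast hst
      by_cases hte : test t
      · -- a perturbation is made
        -- A new test comes more than `𝒯 ≥ K` steps after the last perturbation, so the full gain of
        -- that perturbation has been realized. As the total gain is at most `E < σ m`, fewer than
        -- `m` perturbations have occurred.
        have hV : σ * p t ≤ F (h 0) - F (h t) := by
          rcases hcase with ⟨hp0, hF⟩ | ⟨hp1, w, hw, hhw, hF⟩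
          · rw [hp0]; simp; exact hF
          · have hKt : K ≤ t - s t := by
              have h1 : (K : ℝ) < t - s t := hK.trans_lt hte.2
              rw [← Nat.cast_sub hst] at h1
              exact_mod_cast h1.le
            have := (iterate_le_of_le hstep hw hKt).2
            rw [← hhw] at this
            linarith
        have hlt : p t < m := by
          have h1 := hE _ h0 _ hsph
          have h2 : σ * p t < σ * m := by linarith
          exact_mod_cast lt_of_mul_lt_mul_left h2 hσ.le
        obtain ⟨hw, hFe, hFσ⟩ := hgood _ hsph _ hte.1 (hz t (by omega) hte hsph hlt)
        have hh' : h (t + 1) = step (pt (h t) (z t)) := by rw [hh, if_pos hte]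
        have hs' : s (t + 1) = t := by rw [hs, if_pos hte]
        have hp' : p (t + 1) = p t + 1 := by rw [hps, if_pos hte]
        refine ⟨by rw [hh']; exact (hstep _ hw).1, by omega, by omega, Or.inr ⟨by omega, _, hw, ?_, ?_⟩,
          a, b, by omega, ?_, ?_⟩
        · rw [hs', hh']; simp
        · rw [hp']; push_cast; linarith
        · rw [hp', hs']
          have h1 : min ((t : ℝ) - s t) (𝒯 + 1) ≤ 𝒯 + 1 := min_le_right _ _
          have h2 : 0 ≤ min (((t + 1 : ℕ) : ℝ) - t) (𝒯 + 1) := by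
            apply le_min <;> push_cast <;> linarith
          push_cast at h2 ⊢
          linarith
        · have h1 := (hstep _ hw).2
          rw [hp', hh']
          push_cast
          linarith
      · have hh' : h (t + 1) = step (h t) := by rw [hh, if_neg hte]
        have hs' : s (t + 1) = s t := by rw [hs, if_neg hte]
        have hp' : p (t + 1) = p t := by rw [hps, if_neg hte, add_zero]
        have hst' := hstep _ hsph
        refine ⟨by rw [hh']; exact hst'.1, by omega, by omega, ?_, ?_⟩
        · rw [hp']
          rcases hcase with ⟨hp0, hF⟩ | ⟨hp1, w, hw, hhw, hF⟩
          · left; rw [hh']; exact ⟨hp0, hst'.2.trans hF⟩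
          · right
            refine ⟨hp1, w, hw, ?_, hF⟩
            rw [hh', hs', hhw, ← Function.iterate_succ_apply' step]
            congr 1
            omega
        · rw [hp', hs', hh']
          by_cases hsm : small (h t)
          · have hle : (t : ℝ) - s t ≤ 𝒯 := by
              by_contra hc
              push Not at hc
              exact hte ⟨hsm, hc⟩
            refine ⟨a, b + 1, by omega, ?_, by linarith [hst'.2]⟩
            rw [min_eq_left (by linarith)] at hb
            push_cast
            rw [min_eq_left (by linarith)]
            linarith
          · refine ⟨a + 1, b, by omega, ?_, ?_⟩
            · refine hb.trans ?_
              gcongr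
              linarith
            · have := hdec _ hsph hsm
              push_cast
              linarith
  obtain ⟨hsph, hpm, hst, -, a, b, hab, hb, ha⟩ := key T le_rfl
  have h1 := hE _ h0 _ hsph
  have hpm' : (p T : ℝ) ≤ m := by exact_mod_cast hpm
  have h2 : (a : ℝ) ≤ (E + e * m) / g := by
    rw [le_div_iff₀ hg]
    have : e * p T ≤ e * m := by gcongr
    linarith
  have h3 : (b : ℝ) ≤ (m + 1) * (𝒯 + 1) := by
    have h4 : min ((T : ℝ) - s T) (𝒯 + 1) ≤ 𝒯 + 1 := min_le_right _ _
    have h5 : (p T : ℝ) * (𝒯 + 1) ≤ m * (𝒯 + 1) := by gcongr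
    linarith
  have h6 : (T : ℝ) = p T + a + b := by exact_mod_cast hab
  linarith

open Classical in
-- Only the first `m` occurrences of `q` are counted. This makes the union bound cost a factor `m`
-- and not `T`.
lemma sum_indicator_count_lt_le (q : ℕ → Prop) (m T : ℕ) :
    ∑ t ∈ Finset.range T, (if q t ∧ Nat.count q t < m then 1 else 0) ≤ m := by
  suffices h : ∑ t ∈ Finset.range T, (if q t ∧ Nat.count q t < m then 1 else 0)
      = min (Nat.count q T) m by rw [h]; exact min_le_right _ _
  induction T with
  | zero => simp
  | succ T ih =>
    rw [Finset.sum_range_succ, ih, Nat.count_succ]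
    by_cases h : q T <;> simp [h]
    split_ifs <;> omega

end Path

/-! ### The random run: measurability and the union bound over perturbations. -/

section Dynamics

open scoped ENNReal

variable {n : ℕ} [NeZero n]

lemma measurable_gradient (F : Sig n → ℝ) : Measurable (∇ F) := by
  unfold gradient
  exact (LinearIsometryEquiv.continuous _).measurable.comp (measurable_fderiv ℝ F)

lemma measurable_riemGrad (F : Sig n → ℝ) : Measurable (riemGrad F) := by
  have := measurable_gradient F
  unfold riemGrad
  fun_prop

lemma measurable_mgdStep (F : Sig n → ℝ) (γ : ℝ) : Measurable (mgdStep F γ) := by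
  have := measurable_riemGrad F
  unfold mgdStep
  fun_prop

lemma measurable_perturb : Measurable fun p : Sig n × Sig n => perturb p.1 p.2 := by
  unfold perturb
  fun_prop

lemma measurableSet_perturbTest {Ω : Type*} {m : MeasurableSpace Ω} (F : Sig n → ℝ) (𝒯 c : ℝ)
    (t : ℕ) {X : Ω → Sig n} {s : Ω → ℕ} (hX : Measurable[m] X) (hs : Measurable[m] s) :
    MeasurableSet[m] {ω | PerturbTest F 𝒯 c t (X ω) (s ω)} := by
  have h1 := measurable_riemGrad F
  refine MeasurableSet.inter ?_ ?_
  · exact measurableSet_lt (f := fun ω => ‖riemGrad F (X ω)‖) (g := fun _ => c)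
      (h1.norm.comp hX) measurable_const
  · exact measurableSet_lt (f := fun _ => 𝒯) (g := fun ω => (t : ℝ) - (s ω : ℝ))
      measurable_const (measurable_const.sub ((measurable_of_countable _).comp hs))

open Classical in
/-- The variable `t_perturb`, recomputed for a fixed objective. -/
def perturbTime {Ω : Type*} (F : Sig n → ℝ) (𝒯 c : ℝ) (h : ℕ → Ω → Sig n) : ℕ → Ω → ℕ
  | 0, _ => 0
  | t + 1, ω => if PerturbTest F 𝒯 c t (h t ω) (perturbTime F 𝒯 c h t ω) then t
      else perturbTime F 𝒯 c h t ω

variable {Ω : Type*} [mΩ : MeasurableSpace Ω]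

lemma measurable_perturbTime {𝓕 : Filtration ℕ mΩ} (F : Sig n → ℝ) (𝒯 c : ℝ)
    {h : ℕ → Ω → Sig n} (hh : ∀ t, Measurable[𝓕 t] (h t)) (t : ℕ) :
    Measurable[𝓕 t] (perturbTime F 𝒯 c h t) := by
  induction t with
  | zero => exact measurable_const
  | succ t ih =>
    refine Measurable.mono ?_ (𝓕.mono t.le_succ) le_rfl
    exact Measurable.ite (measurableSet_perturbTest F 𝒯 c t (hh t) ih) measurable_const ih

open Classical in
lemma measurable_count {𝓕 : Filtration ℕ mΩ} {q : ℕ → Ω → Prop}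
    (hq : ∀ t, MeasurableSet[𝓕 t] {ω | q t ω}) (t : ℕ) :
    Measurable[𝓕 t] fun ω => Nat.count (fun t => q t ω) t := by
  induction t with
  | zero => simp only [Nat.count_zero]; exact measurable_const
  | succ t ih =>
    simp only [Nat.count_succ]
    refine Measurable.mono ?_ (𝓕.mono t.le_succ) le_rfl
    exact ih.add (Measurable.ite (hq t) measurable_const measurable_const)

/-- Perturbed gradient descent on a fixed objective avoids the target `H` up to time `T` with
small probability, if at nearly stationary points outside of `H` a perturbation fails to decrease
the objective with probability at most `δ`. -/
theorem prob_avoid_le {P : Measure Ω} [IsProbabilityMeasure P] {𝓕 : Filtration ℕ mΩ}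
    {L : Ω → Sig n → ℝ} {γ D 𝒯 c : ℝ} {h z : ℕ → Ω → Sig n} {s : ℕ → Ω → ℕ}
    (hrun : IsPMGD P 𝓕 L γ D 𝒯 c h z s) {F : Sig n → ℝ} (hFm : Measurable F) {Ω₀ : Set Ω}
    (hΩ₀ : MeasurableSet[𝓕 0] Ω₀) (hLF : ∀ ω ∈ Ω₀, L ω = F) {g e σ E : ℝ} {K m T : ℕ}
    (hg : 0 < g) (he : 0 ≤ e) (hK : (K : ℝ) ≤ 𝒯) (hσ : 0 < σ) (hm : E < σ * m)
    (hstep : ∀ u : Sig n, ‖u‖ = 1 → ‖mgdStep F γ u‖ = 1 ∧ F (mgdStep F γ u) ≤ F u)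
    (hdec : ∀ u : Sig n, ‖u‖ = 1 → c ≤ ‖riemGrad F u‖ → F (mgdStep F γ u) ≤ F u - g)
    (hE : ∀ u : Sig n, ‖u‖ = 1 → ∀ u' : Sig n, ‖u'‖ = 1 → F u - F u' ≤ E)
    (hpert : ∀ u : Sig n, ‖u‖ = 1 → ‖riemGrad F u‖ < c → ∀ z, inner ℝ u z = (0 : ℝ) → ‖z‖ ≤ D →
      ‖perturb u z‖ = 1 ∧ F (perturb u z) ≤ F u + e)
    {H : Set (Sig n)} (hH : MeasurableSet H) {δ : ℝ≥0∞}
    (hescape : ∀ u : Sig n, ‖u‖ = 1 → ‖riemGrad F u‖ < c → u ∉ H →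
      tangentBallUniform D u {z | ¬(inner ℝ u z = (0 : ℝ) ∧ ‖z‖ ≤ D) ∨
        z ∈ {z | F u - σ < F ((mgdStep F γ)^[K] (perturb u z))}} ≤ δ)
    (hT : m + (E + e * m) / g + (m + 1) * (𝒯 + 1) < T) :
    P (Ω₀ ∩ {ω | ∀ t, 1 ≤ t → t ≤ T → h t ω ∉ H}) ≤ m * δ * P Ω₀ := by
  classical
  -- No measurability is assumed of `s`. The clock recomputed for the fixed objective `F` is
  -- adapted, and it agrees with `s` on `Ω₀`.
  set s' := perturbTime F 𝒯 c h with hs'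
  set q : ℕ → Ω → Prop := fun t ω => PerturbTest F 𝒯 c t (h t ω) (s' t ω) with hq
  have hqm : ∀ t, MeasurableSet[𝓕 t] {ω | q t ω} := fun t =>
    measurableSet_perturbTest F 𝒯 c t (hrun.measurable_iterate t)
      (measurable_perturbTime F 𝒯 c hrun.measurable_iterate t)
  have hss : ∀ t, ∀ ω ∈ Ω₀, s t ω = s' t ω := by
    intro t
    induction t with
    | zero => intro ω _; exact hrun.perturb_init ω
    | succ t ih =>
      intro ω hω
      rw [hrun.perturb_step, hLF ω hω, ih ω hω, hs', perturbTime]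
  set cnt : ℕ → Ω → ℕ := fun t ω => Nat.count (fun t => q t ω) t with hcnt
  -- The event, known before the noise is drawn, that one of the first `m` perturbations is made at
  -- time `t` from a point outside `H`.
  set A : ℕ → Set Ω := fun t => Ω₀ ∩ {ω | ‖h t ω‖ = 1} ∩ {ω | q t ω} ∩ {ω | cnt t ω < m}
    ∩ {ω | h t ω ∉ H} with hA
  have hAm : ∀ t, MeasurableSet[𝓕 t] (A t) := fun t => by
    have hht := hrun.measurable_iterate t
    refine ((((𝓕.mono (Nat.zero_le t) _ hΩ₀).inter ?_).inter (hqm t)).inter ?_).inter ?_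
    · exact measurableSet_eq_fun (f := fun ω => ‖h t ω‖) (g := fun _ => (1 : ℝ))
        (measurable_norm.comp hht) measurable_const
    · exact measurableSet_lt (f := fun ω => cnt t ω) (g := fun _ => m)
        (measurable_count hqm t) measurable_const
    · exact (hht hH).compl
  set G : Set (Sig n × Sig n) := {p | ¬(inner ℝ p.1 p.2 = (0 : ℝ) ∧ ‖p.2‖ ≤ D) ∨
    F p.1 - σ < F ((mgdStep F γ)^[K] (perturb p.1 p.2))} with hG
  have hGm : MeasurableSet G := by
    refine MeasurableSet.union (MeasurableSet.compl (MeasurableSet.inter ?_ ?_)) ?_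
    · exact measurableSet_eq_fun (f := fun p : Sig n × Sig n => (inner ℝ p.1 p.2 : ℝ))
        (g := fun _ => (0 : ℝ)) (by fun_prop) measurable_const
    · exact measurableSet_le (f := fun p : Sig n × Sig n => ‖p.2‖) (g := fun _ => D) (by fun_prop)
        measurable_const
    · exact measurableSet_lt (f := fun p : Sig n × Sig n => F p.1 - σ)
        (g := fun p => F ((mgdStep F γ)^[K] (perturb p.1 p.2)))
        ((hFm.comp measurable_fst).sub measurable_const)
        (hFm.comp (((measurable_mgdStep F γ).iterate K).comp measurable_perturb))
  set e₀ : Sig n := EuclideanSpace.single 0 1 with he₀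
  have he₀n : ‖e₀‖ = 1 := by simp [he₀]
  have hbad : ∀ t, P (A t ∩ {ω | (h t ω, z t ω) ∈ G}) ≤ δ * P (A t) := fun t => by
    refine measure_inter_le_of_cond_law (𝓕.le t) (noiseKernel D e₀) (hrun.measurable_iterate t)
      ((hrun.measurable_noise t).mono (𝓕.le _) le_rfl) (hAm t) ?_ hGm ?_
    · intro A' hA' hA'm B hB
      rw [hrun.noise_law t A' hA'm ?_ B hB]
      · refine setLIntegral_congr_fun (𝓕.le t _ hA'm) fun ω hω => ?_
        rw [noiseKernel_apply D he₀n (hA' hω).1.1.1.2]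
      · intro ω hω
        have h1 := (hA' hω).1.1.2
        have h2 := (hA' hω).1.1.1.1
        rw [hLF ω h2, hss t ω h2]
        exact h1
    · intro ω hω
      rw [noiseKernel_apply D he₀n hω.1.1.1.2]
      exact hescape _ hω.1.1.1.2 hω.1.1.2.1 hω.2
  -- A path that avoids `H` and sees no bad perturbation would contradict the deterministic time
  -- bound.
  have hsub : Ω₀ ∩ {ω | ∀ t, 1 ≤ t → t ≤ T → h t ω ∉ H}
      ⊆ ⋃ t ∈ Finset.range T, A t ∩ {ω | (h t ω, z t ω) ∈ G} := by
    rintro ω ⟨hω, hav⟩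
    by_contra hnot
    simp only [Set.mem_iUnion, not_exists] at hnot
    have h𝒯 : 0 ≤ 𝒯 := (Nat.cast_nonneg K).trans hK
    refine absurd (time_le_of_good_perturbations (sph := {u : Sig n | ‖u‖ = 1}) (F := F)
      (small := fun u => ‖riemGrad F u‖ < c) (step := mgdStep F γ) (pt := perturb)
      (good := fun u z => (inner ℝ u z = (0 : ℝ) ∧ ‖z‖ ≤ D) ∧
        F ((mgdStep F γ)^[K] (perturb u z)) ≤ F u - σ) (𝒯 := 𝒯) (K := K) (m := m) (T := T)
      (h := fun t => h t ω) (z := fun t => z t ω) (s := fun t => s' t ω) hg he hK hstep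
      (fun u hu hs => hdec u hu (not_lt.1 hs)) (fun u hu u' hu' => hE u hu u' hu') hm hσ
      (fun u hu z hs hz => ⟨(hpert u hu hs z hz.1.1 hz.1.2).1, (hpert u hu hs z hz.1.1 hz.1.2).2,
        hz.2⟩) (hrun.norm_init ω) rfl ?_ ?_ ?_) (not_le.2 hT)
    · intro t
      have := hrun.iterate_step t ω
      rw [hLF ω hω, hss t ω hω] at this
      refine this.trans ?_
      by_cases hqt : PerturbTest F 𝒯 c t (h t ω) (s' t ω)
      · rw [if_pos hqt, if_pos (show ‖riemGrad F (h t ω)‖ < c ∧ (t : ℝ) - s' t ω > 𝒯 from hqt)]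
        rfl
      · rw [if_neg hqt, if_neg (show ¬(‖riemGrad F (h t ω)‖ < c ∧ (t : ℝ) - s' t ω > 𝒯) from hqt)]
    · intro t
      simp only [hs']
      rw [perturbTime]
      by_cases hqt : PerturbTest F 𝒯 c t (h t ω) (s' t ω)
      · rw [if_pos hqt, if_pos (show ‖riemGrad F (h t ω)‖ < c ∧
          (t : ℝ) - perturbTime F 𝒯 c h t ω > 𝒯 from hqt)]
      · rw [if_neg hqt, if_neg (show ¬(‖riemGrad F (h t ω)‖ < c ∧
          (t : ℝ) - perturbTime F 𝒯 c h t ω > 𝒯) from hqt)]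
    · intro t htT htest hsph hc
      have hmem : ω ∈ A t := by
        refine ⟨⟨⟨⟨hω, hsph⟩, htest⟩, ?_⟩, ?_⟩
        · change Nat.count (fun t => q t ω) t < m
          convert hc
          exact Iff.rfl
        -- Avoidance is only assumed for `t ≥ 1`. No perturbation happens at `t = 0`, where `t - s t
        -- > 𝒯 ≥ 0` fails.
        · refine hav t ?_ htT.le
          by_contra h0
          have h0 : t = 0 := by omega
          subst h0
          have := htest.2
          simp at this
          have h2 : (0 : ℝ) ≤ (s' 0 ω : ℝ) := Nat.cast_nonneg _
          linarith
      have h1 := hnot t (Finset.mem_range.2 htT)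
      have h2 : (h t ω, z t ω) ∉ G := fun h2 => h1 ⟨hmem, h2⟩
      rw [hG, Set.mem_ofPred_eq, not_or, not_not, not_lt] at h2
      exact h2
  -- Each outcome lies in at most `m` of the events `A t`, and in none of them outside `Ω₀`.
  have hsum : ∑ t ∈ Finset.range T, P (A t) ≤ m * P Ω₀ := by
    have h1 : ∀ t, P (A t) = ∫⁻ ω, (A t).indicator 1 ω ∂P := fun t => by
      rw [lintegral_indicator_one (𝓕.le t _ (hAm t))]
    calc ∑ t ∈ Finset.range T, P (A t)
        = ∫⁻ ω, ∑ t ∈ Finset.range T, (A t).indicator 1 ω ∂P := by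
          rw [lintegral_finsetSum _ fun t _ => measurable_one.indicator (𝓕.le t _ (hAm t))]
          exact Finset.sum_congr rfl fun t _ => h1 t
      _ ≤ ∫⁻ ω, Ω₀.indicator (fun _ => (m : ℝ≥0∞)) ω ∂P := by
          refine lintegral_mono fun ω => ?_
          by_cases hω : ω ∈ Ω₀
          · rw [Set.indicator_of_mem hω]
            calc ∑ t ∈ Finset.range T, (A t).indicator (1 : Ω → ℝ≥0∞) ω
                ≤ ∑ t ∈ Finset.range T, ((if q t ω ∧ Nat.count (fun t => q t ω) t < m then 1 else 0
                  : ℕ) : ℝ≥0∞) := by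
                  refine Finset.sum_le_sum fun t _ => ?_
                  by_cases hA : ω ∈ A t
                  · rw [Set.indicator_of_mem hA, if_pos ⟨hA.1.1.2, hA.1.2⟩]
                    simp
                  · rw [Set.indicator_of_notMem hA]
                    exact bot_le
              _ ≤ m := by
                  rw [← Nat.cast_sum]
                  have := sum_indicator_count_lt_le (fun t => q t ω) m T
                  refine Nat.cast_le.2 (le_trans (le_of_eq ?_) this)
                  refine Finset.sum_congr rfl fun t _ => ?_
                  congr
          · rw [Set.indicator_of_notMem hω]
            refine le_of_eq (Finset.sum_eq_zero fun t _ => ?_)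
            rw [Set.indicator_of_notMem]
            exact fun h => hω h.1.1.1.1
      _ = m * P Ω₀ := by
          rw [lintegral_indicator_const (𝓕.le 0 _ hΩ₀)]
  calc P (Ω₀ ∩ {ω | ∀ t, 1 ≤ t → t ≤ T → h t ω ∉ H})
      ≤ P (⋃ t ∈ Finset.range T, A t ∩ {ω | (h t ω, z t ω) ∈ G}) := measure_mono hsub
    _ ≤ ∑ t ∈ Finset.range T, P (A t ∩ {ω | (h t ω, z t ω) ∈ G}) := measure_biUnion_finset_le _ _
    _ ≤ ∑ t ∈ Finset.range T, δ * P (A t) := Finset.sum_le_sum fun t _ => hbad t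
    _ = δ * ∑ t ∈ Finset.range T, P (A t) := by rw [Finset.mul_sum]
    _ ≤ δ * (m * P Ω₀) := by gcongr
    _ = m * δ * P Ω₀ := by ring

end Dynamics

/-! ### Numerical inequalities between the parameters. -/

section Parameters

/-- The numerical relations between the parameters of the algorithm. Here `q = a / (ξ n³)`, the
perturbation radius is `q² / l²`, the gradient tolerance is `c`, and `k` bounds the number of steps
between two perturbations times the step size. -/
structure ParamBounds (n a l q c k : ℝ) : Prop where
  n_ge : 4 ≤ n
  a_pos : 0 < a
  a_le : a ≤ 1 / 12
  l_ge : 1 ≤ l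
  l_le : l ≤ n
  q_pos : 0 < q
  q_le : q * n ^ 3 ≤ a / 100000
  c_pos : 0 < c
  c_le : c ≤ 64 * q * n ^ 2
  k_nonneg : 0 ≤ k
  k_le : k * (3200 * n ^ 3 * q) ≤ l

namespace ParamBounds

variable {n a l q c k : ℝ} (h : ParamBounds n a l q c k)
include h

lemma n_pos : 0 < n := by linarith [h.n_ge]

lemma l_pos : 0 < l := by linarith [h.l_ge]

lemma sixteen_le_n_sq : 16 ≤ n ^ 2 := by nlinarith [h.n_ge]

lemma q_le_n_sq : q * n ^ 2 ≤ a / 400000 := by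
  have h1 := h.n_ge
  have h2 := h.q_le
  have h3 := mul_le_mul_of_nonneg_left h1 (mul_nonneg h.q_pos.le (sq_nonneg n))
  linarith

lemma q_le_n : q * n ≤ a / 1600000 := by
  have h1 := h.n_ge
  have h2 := h.q_le_n_sq
  have h3 := mul_le_mul_of_nonneg_left h1 (mul_nonneg h.q_pos.le h.n_pos.le)
  linarith

lemma q_le_a : q ≤ a / 6400000 := by
  have h1 := h.n_ge
  have h2 := h.q_le_n
  have h3 := mul_le_mul_of_nonneg_left h1 h.q_pos.le
  linarith

lemma stepSize_mul_le : 1 / (128 * n ^ 3) * (1.01 * n * a) ≤ 1 / 100 := by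
  have h1 := h.n_pos
  have h2 := h.sixteen_le_n_sq
  have e : 1 / (128 * n ^ 3) * (1.01 * n * a) = 1.01 * a / (128 * n ^ 2) := by field_simp
  rw [e, div_le_iff₀ (by positivity)]
  linarith [h.a_le]

lemma radius_le : q / 5 ≤ 1 / 10 := by
  linarith [h.q_le_a, h.a_le]

lemma perturb_radius_le : q ^ 2 / l ^ 2 ≤ q / 100 := by
  have h1 := h.q_le_a
  have h2 := h.a_le
  have h3 := h.q_pos
  have h4 : 1 ≤ l ^ 2 := one_le_pow₀ h.l_ge
  calc q ^ 2 / l ^ 2 ≤ q ^ 2 := div_le_self (by positivity) h4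
    _ ≤ q / 100 := by nlinarith

lemma lipschitz_radius : 8 * (1.01 * n * a) * (q / 5) ≤ q * n ^ 2 := by
  have e : 8 * (1.01 * n * a) * (q / 5) = (q * n) * (1.616 * a) := by ring
  have h1 := mul_pos h.q_pos h.n_pos
  rw [e, show q * n ^ 2 = (q * n) * n by ring]
  gcongr
  linarith [h.a_le, h.n_ge]

/-- With Lipschitz constant `8M` for `M = 1.01 n a` and radius `q/5`, this bounds the gradient
throughout the localization ball. -/
lemma grad_near_le : c + 8 * (1.01 * n * a) * (q / 5) ≤ 65 * q * n ^ 2 := by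
  linarith [h.lipschitz_radius, h.c_le]

lemma grad_near_le_lipschitz : c + 8 * (1.01 * n * a) * (q / 5) ≤ 1.01 * n * a := by
  have h1 := h.grad_near_le
  have h2 := h.q_le_n_sq
  have h3 := mul_le_mul_of_nonneg_right h.n_ge h.a_pos.le
  linarith [h.a_pos]

lemma error_rate_le : 20 * (1.01 * n * a) * (q / 5)
    + 2 * (1 / (128 * n ^ 3)) * (c + 8 * (1.01 * n * a) * (q / 5)) ^ 2 ≤ 4.05 * n * a * q := by
  have hn := h.n_pos
  have hq := h.q_pos
  have ha := h.a_pos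
  have h1 : (c + 8 * (1.01 * n * a) * (q / 5)) ^ 2 ≤ (65 * q * n ^ 2) ^ 2 := by
    have := h.grad_near_le
    have := h.c_pos
    gcongr
  have h2 : 2 * (1 / (128 * n ^ 3)) * (65 * q * n ^ 2) ^ 2 = 4225 / 64 * (q * n) * q := by
    field_simp; ring
  have h3 : 4225 / 64 * (q * n) * q ≤ 4225 / 64 * (q * n) * (a / 6400000) := by
    have := h.q_le_a
    gcongr
  have h4 : 2 * (1 / (128 * n ^ 3)) * (c + 8 * (1.01 * n * a) * (q / 5)) ^ 2
      ≤ 2 * (1 / (128 * n ^ 3)) * (65 * q * n ^ 2) ^ 2 := by gcongr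
  have h5 : 0 < n * a * q := by positivity
  linarith

lemma error_rate_le_curvature : 20 * (1.01 * n * a) * (q / 5)
    + 2 * (1 / (128 * n ^ 3)) * (c + 8 * (1.01 * n * a) * (q / 5)) ^ 2 ≤ 1.5 * a / 4 := by
  have h1 := h.error_rate_le
  have h2 := mul_le_mul_of_nonneg_right h.q_le_n h.a_pos.le
  nlinarith [h.a_pos, h.a_le]

/-- The loss of Rayleigh quotient over a whole escape episode: `k` bounds `γK`, and `l ≤ n` cancels
the last power of `n`. -/
lemma total_error_le {γ K : ℝ} (hγ : 0 ≤ γ) (hK0 : 0 ≤ K) (hγK : γ * K ≤ k)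
    {η : ℝ} (hη : η ≤ 4.05 * n * a * q) :
    20 * (1.01 * n * a) * (γ * η) * K ≤ 1.5 * a / 4 := by
  have hn := h.n_pos
  have hq := h.q_pos
  have ha := h.a_pos
  have h0 : 0 ≤ γ * K := by positivity
  have e : 20 * (1.01 * n * a) * (γ * η) * K = 20.2 * n * a * (γ * K) * η := by ring
  have h1 : 20.2 * n * a * (γ * K) * η ≤ 20.2 * n * a * k * (4.05 * n * a * q) := by
    have := h.k_nonneg
    have h2 : 20.2 * n * a * (γ * K) * η ≤ 20.2 * n * a * (γ * K) * (4.05 * n * a * q) := by gcongr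
    refine h2.trans ?_
    gcongr
  have h2 : k * (n ^ 2 * q) ≤ 1 / 3200 := by
    have h3 := h.k_le
    have h4 := h.l_le
    have h5 : k * (n ^ 2 * q) * n ≤ 1 / 3200 * n := by nlinarith
    exact le_of_mul_le_mul_right h5 hn
  have e2 : 20.2 * n * a * k * (4.05 * n * a * q) = 81.81 * a ^ 2 * (k * (n ^ 2 * q)) := by ring
  rw [e]
  refine h1.trans ?_
  rw [e2]
  have h3 : 81.81 * a ^ 2 * (k * (n ^ 2 * q)) ≤ 81.81 * a ^ 2 * (1 / 3200) := by gcongr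
  nlinarith [h.a_le]

/-- The localization radius `q/5` covers the perturbation, at most `q/50`, and the drift of a run
with little gain, at most `0.16 q`. -/
lemma localization {γ K : ℝ} (hγK : γ * K ≤ k) :
    2 * (q ^ 2 / l ^ 2) + √(K * γ * (16 * (64 * q ^ 3 * n ^ 2 / l ^ 2)) / 3.6) ≤ q / 5 := by
  have hn := h.n_pos
  have hq := h.q_pos
  have hl := h.l_pos
  have h1 : √(K * γ * (16 * (64 * q ^ 3 * n ^ 2 / l ^ 2)) / 3.6) ≤ q * 0.16 := by
    apply Real.sqrt_le_iff.2
    refine ⟨by positivity, ?_⟩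
    have h2 : k * (3200 * n ^ 3 * q) ≤ l := h.k_le
    have h3 : K * γ * (16 * (64 * q ^ 3 * n ^ 2 / l ^ 2)) / 3.6
        ≤ k * (16 * (64 * q ^ 3 * n ^ 2 / l ^ 2)) / 3.6 := by
      rw [mul_comm K γ]; gcongr
    have e : k * (16 * (64 * q ^ 3 * n ^ 2 / l ^ 2)) / 3.6
        = (k * (3200 * n ^ 3 * q)) * (1024 / 11520 * q ^ 2 / (n * l ^ 2)) := by
      field_simp; ring
    have h4 : (k * (3200 * n ^ 3 * q)) * (1024 / 11520 * q ^ 2 / (n * l ^ 2))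
        ≤ l * (1024 / 11520 * q ^ 2 / (n * l ^ 2)) := by gcongr
    have e2 : l * (1024 / 11520 * q ^ 2 / (n * l ^ 2)) = 1024 / 11520 * q ^ 2 / (n * l) := by
      field_simp
    have h5 : 1024 / 11520 * q ^ 2 / (n * l) ≤ 1024 / 11520 * q ^ 2 / 4 := by
      gcongr
      nlinarith [h.n_ge, h.l_ge]
    rw [e] at h3
    rw [e2] at h4
    nlinarith [sq_nonneg q]
  linarith [h.perturb_radius_le]

/-- With `σ = 128 q³n²/l²`, the perturbation costs at most `4σ` in the quartic form, that is `σ` in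
the objective. Adding the `4σ` to be gained leads to the threshold `Δ = 8σ`. -/
lemma perturb_cost_le : 4 * c * (q ^ 2 / l ^ 2) + 32 * (1.01 * n * a) * (q ^ 2 / l ^ 2) ^ 2
    ≤ 4 * (2 * (64 * q ^ 3 * n ^ 2 / l ^ 2)) := by
  have hn := h.n_pos
  have hq := h.q_pos
  have hl := h.l_pos
  have ha := h.a_pos
  have h1 : 4 * c * (q ^ 2 / l ^ 2) ≤ 4 * (64 * q * n ^ 2) * (q ^ 2 / l ^ 2) := by
    have := h.c_le
    gcongr
  have e1 : 4 * (64 * q * n ^ 2) * (q ^ 2 / l ^ 2) = 4 * (64 * q ^ 3 * n ^ 2 / l ^ 2) := by ring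
  have h2 : 32 * (1.01 * n * a) * (q ^ 2 / l ^ 2) ^ 2
      ≤ 32 * (1.01 * n * a) * ((q ^ 2 / l ^ 2) * (q / 100)) := by
    rw [sq (q ^ 2 / l ^ 2)]
    have := h.perturb_radius_le
    gcongr
  have e2 : 32 * (1.01 * n * a) * ((q ^ 2 / l ^ 2) * (q / 100))
      = (0.3232 * (n * a)) * (q ^ 3 / l ^ 2) := by ring
  have h3 : (0.3232 * (n * a)) * (q ^ 3 / l ^ 2) ≤ (256 * n ^ 2) * (q ^ 3 / l ^ 2) := by
    gcongr
    · norm_num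
    · rw [sq]
      gcongr
      linarith [h.a_le, h.n_ge]
  have e3 : (256 * n ^ 2) * (q ^ 3 / l ^ 2) = 4 * (64 * q ^ 3 * n ^ 2 / l ^ 2) := by ring
  linarith

end ParamBounds

end Parameters

/-! ### Failure probability of a single perturbation. -/

section Escape

lemma iterate_eq_of_eqOn {V : Type*} {A : Set V} {f g : V → V} (hfg : ∀ u ∈ A, f u = g u)
    (hg : ∀ u ∈ A, g u ∈ A) {u : V} (hu : u ∈ A) (k : ℕ) : f^[k] u = g^[k] u ∧ g^[k] u ∈ A := by
  induction k with
  | zero => exact ⟨rfl, hu⟩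
  | succ k ih =>
    rw [Function.iterate_succ_apply', Function.iterate_succ_apply', ih.1, hfg _ ih.2]
    exact ⟨rfl, hg _ ih.2⟩

variable {n : ℕ} [NeZero n] {S : Sig n → Sig n → Sig n → Sig n}

/-- The objective agrees on the sphere, up to a constant, with `-quartic S / 4`. -/
structure AgreesOnSphere (F : Sig n → ℝ) (S : Sig n → Sig n → Sig n → Sig n) (C : ℝ) : Prop where
  value : ∀ u, ‖u‖ = 1 → F u = C - quartic S u / 4
  grad : ∀ u, ‖u‖ = 1 → riemGrad F u = sphGrad S u

namespace AgreesOnSphere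

variable {F : Sig n → ℝ} {C : ℝ} (hF : AgreesOnSphere F S C)
include hF

lemma mgdStep_eq (γ : ℝ) {u : Sig n} (hu : ‖u‖ = 1) : mgdStep F γ u = sphStep S γ u := by
  rw [mgdStep, sphStep, retract, hF.grad u hu]

lemma mgdStep_iterate_eq {M : ℝ} (hS : SymmQuartic S M) (γ : ℝ) {u : Sig n} (hu : ‖u‖ = 1)
    (k : ℕ) : (mgdStep F γ)^[k] u = (sphStep S γ)^[k] u ∧ ‖(sphStep S γ)^[k] u‖ = 1 := by
  exact iterate_eq_of_eqOn (A := {u : Sig n | ‖u‖ = 1}) (fun u hu => hF.mgdStep_eq γ hu)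
    (fun u hu => hS.norm_sphStep γ hu) hu k

end AgreesOnSphere

/-- If the objective has negative curvature in a tangent direction at a nearly stationary point,
then a random perturbation followed by gradient descent decreases it with high probability. -/
theorem escape_probability_le {F : Sig n → ℝ} (hFm : Measurable F) {C γ M D r c lam σ Δ τ : ℝ}
    {K : ℕ} (hS : SymmQuartic S M) (hF : AgreesOnSphere F S C) (hγ : 0 ≤ γ) (hM : 0 ≤ M)
    (hγM : γ * M ≤ 1 / 100) (hr1 : r ≤ 1 / 10) (hD0 : 0 < D) (hD1 : D ≤ 1 / 10) (hc0 : 0 ≤ c)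
    (hcM : c + 8 * M * r ≤ M) (hlam : 0 ≤ lam) (hlamM : lam ≤ 4 * M)
    (hη : 20 * M * r + 2 * γ * (c + 8 * M * r) ^ 2 ≤ lam / 4)
    (hK : 20 * M * (γ * (20 * M * r + 2 * γ * (c + 8 * M * r) ^ 2)) * K ≤ lam / 4)
    (hDr : 2 * D + √(K * γ * Δ / 3.6) ≤ r) (hcost : 4 * c * D + 32 * M * D ^ 2 + 4 * σ ≤ Δ)
    (hτ : 0 < τ) (hgrow : 2 * r < (1 + γ * (lam / 2)) ^ K * τ)
    {u : Sig n} (hu : ‖u‖ = 1) (hgrad : ‖riemGrad F u‖ < c)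
    (hcurv : ∃ v, ‖v‖ = 1 ∧ inner ℝ u v = (0 : ℝ) ∧ inner ℝ v (sphHess S hS u v) ≤ -lam) :
    tangentBallUniform D u {z | ¬(inner ℝ u z = (0 : ℝ) ∧ ‖z‖ ≤ D) ∨
        z ∈ {z | F u - σ < F ((mgdStep F γ)^[K] (perturb u z))}}
      ≤ ENNReal.ofReal (3 * n * τ / D) := by
  obtain ⟨v, hv, huv, hneg⟩ := hcurv
  have hgrad' : ‖sphGrad S u‖ ≤ c := by rw [← hF.grad u hu]; exact hgrad.le
  -- A failure to decrease the objective by `σ` bounds the gain of the quartic form along the run by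
  -- `4σ` plus the cost of the perturbation, hence by `Δ`.
  have hstuck : ∀ z, inner ℝ u z = (0 : ℝ) → ‖z‖ ≤ D →
      F u - σ < F ((mgdStep F γ)^[K] (perturb u z)) →
      quartic S ((sphStep S γ)^[K] (perturb u z)) - quartic S (perturb u z) ≤ Δ := by
    intro z hz hzD hlt
    have hw := norm_perturb hu hz (hzD.trans (by linarith))
    have hit := hF.mgdStep_iterate_eq hS γ hw K
    rw [hit.1, hF.value u hu, hF.value _ hit.2] at hlt
    have h1 := hS.quartic_perturb_ge hM hu hz (hzD.trans hD1) hgrad'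
    have h3 : 4 * c * ‖z‖ ≤ 4 * c * D := by gcongr
    have h4 : 32 * M * ‖z‖ ^ 2 ≤ 32 * M * D ^ 2 := by gcongr
    linarith
  have hmeas : Measurable fun z => F ((mgdStep F γ)^[K] (perturb u z)) := by
    have h1 : Measurable fun z => perturb u z := by
      unfold perturb
      fun_prop
    have h2 : Measurable (mgdStep F γ)^[K] := (measurable_mgdStep F γ).iterate K
    exact hFm.comp (h2.comp h1)
  refine tangentBallUniform_le hD0 hτ hv huv (measurableSet_lt measurable_const hmeas) ?_
  intro z hz hzD hzT s hs hzD' hzT'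
  have hz' : inner ℝ u (z + s • v) = (0 : ℝ) := by
    rw [inner_add_right, inner_smul_right, hz, huv]; simp
  have hs0 : 0 ≤ s := hτ.le.trans hs
  have := hS.growth_le_of_stuck hγ hM hγM hr1 (hD1.trans (by norm_num)) hu hgrad' hcM hlam hlamM
    hη hK hDr hv huv hneg hs0 hz hzD hzD' (hstuck z hz hzD hzT) (hstuck _ hz' hzD' hzT')
  have h2 : (1 + γ * (lam / 2)) ^ K * τ ≤ (1 + γ * (lam / 2)) ^ K * s := by gcongr
  linarith

end Escape

/-! ### The avoidance probability for a fixed objective close to the model. -/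

section Assembly

namespace ParamBounds

variable {n a l q c k : ℝ} (h : ParamBounds n a l q c k)
include h

lemma decrease_pos : 0 < 2 * (64 * q ^ 3 * n ^ 2 / l ^ 2) := by
  have := h.q_pos
  have := h.n_pos
  have := h.l_pos
  positivity

lemma energy_ratio_eq : 1.01 * n * a / 2 / (2 * (64 * q ^ 3 * n ^ 2 / l ^ 2))
    = 0.505 / 128 * (a * l ^ 2 / (n * q ^ 3)) := by
  have := h.q_pos
  have := h.n_pos
  have := h.l_pos
  field_simp
  ring

lemma ratio_ge : 100000 ≤ a * l ^ 2 / (n * q ^ 3) := by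
  have hq := h.q_pos
  have hn := h.n_pos
  have ha := h.a_pos
  rw [le_div_iff₀ (by positivity)]
  have h1 : n * q ^ 3 = (q * n) * q * q := by ring
  have h2 : (q * n) * q * q ≤ (a / 1600000) * 1 * 1 := by
    have := h.q_le_n
    have : q ≤ 1 := by linarith [h.q_le_a, h.a_le]
    gcongr
  have h3 : 1 ≤ l ^ 2 := one_le_pow₀ h.l_ge
  nlinarith

/-- A bound for the number of perturbations. -/
lemma count_le {m : ℕ}
    (hm : m = ⌊1.01 * n * a / 2 / (2 * (64 * q ^ 3 * n ^ 2 / l ^ 2))⌋₊ + 1) :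
    (m : ℝ) ≤ 0.004 * (a * l ^ 2 / (n * q ^ 3)) := by
  have h1 := h.ratio_ge
  have h2 : (⌊1.01 * n * a / 2 / (2 * (64 * q ^ 3 * n ^ 2 / l ^ 2))⌋₊ : ℝ)
      ≤ 0.505 / 128 * (a * l ^ 2 / (n * q ^ 3)) := by
    rw [← h.energy_ratio_eq]
    apply Nat.floor_le
    rw [h.energy_ratio_eq]
    linarith
  rw [hm]
  push_cast
  linarith

/-- A union bound over `m` perturbations, each failing with probability at most `3nτ/D`, where `τ =
q w` and `D = q²/l²`. -/
lemma failure_le {m w : ℝ} (hw : 0 ≤ w) (hm : m ≤ 0.004 * (a * l ^ 2 / (n * q ^ 3))) :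
    m * (3 * n * (q * w) / (q ^ 2 / l ^ 2)) ≤ n * w * l ^ 4 / (8 * q ^ 4) := by
  have hq := h.q_pos
  have hn := h.n_pos
  have hl := h.l_pos
  have e1 : 0.004 * (a * l ^ 2 / (n * q ^ 3)) * (3 * n * (q * w) / (q ^ 2 / l ^ 2))
      = (0.012 * a) * (w * l ^ 4 / q ^ 4) := by
    field_simp
    ring
  have e2 : n * w * l ^ 4 / (8 * q ^ 4) = (n / 8) * (w * l ^ 4 / q ^ 4) := by
    field_simp
  calc m * (3 * n * (q * w) / (q ^ 2 / l ^ 2))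
      ≤ 0.004 * (a * l ^ 2 / (n * q ^ 3)) * (3 * n * (q * w) / (q ^ 2 / l ^ 2)) := by gcongr
    _ = (0.012 * a) * (w * l ^ 4 / q ^ 4) := e1
    _ ≤ (n / 8) * (w * l ^ 4 / q ^ 4) := by
        gcongr
        linarith [h.a_le, h.n_ge]
    _ = _ := e2.symm

/-- The term `1250 n⁶/c²` pays for the steps with large gradient, since `E + σ m ≤ 3E`; the term
`l⁴/(800 q⁴)` pays for the perturbations and for the `m + 1` waiting periods. The spare `1` absorbs
the rounding of the time bound. -/
lemma time_le {m : ℕ}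
    (hm : m = ⌊1.01 * n * a / 2 / (2 * (64 * q ^ 3 * n ^ 2 / l ^ 2))⌋₊ + 1) :
    m + (1.01 * n * a / 2 + 2 * (64 * q ^ 3 * n ^ 2 / l ^ 2) * m)
      / (0.9 * (1 / (128 * n ^ 3)) * c ^ 2) + (m + 1) * (l / (25 * q) + 1)
      < 1250 * n ^ 6 / c ^ 2 + l ^ 4 / (800 * q ^ 4) - 1 := by
  have hq := h.q_pos
  have hn := h.n_pos
  have hl := h.l_pos
  have hc := h.c_pos
  have ha := h.a_pos
  have hσ := h.decrease_pos
  have hml := h.count_le hm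
  set σ := 2 * (64 * q ^ 3 * n ^ 2 / l ^ 2) with hσdef
  set E := 1.01 * n * a / 2 with hE
  have hE0 : 0 < E := by positivity
  have hm1 : (1 : ℝ) ≤ m := by
    rw [hm]; push_cast; linarith [(Nat.cast_nonneg ⌊E / σ⌋₊ : (0 : ℝ) ≤ ⌊E / σ⌋₊)]
  have hσm : σ * m ≤ 2 * E := by
    have h1 : (m : ℝ) ≤ E / σ + 1 := by
      rw [hm]; push_cast
      have := Nat.floor_le (div_nonneg hE0.le hσ.le)
      linarith
    have h2 : 1 ≤ E / σ := by
      rw [h.energy_ratio_eq]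
      linarith [h.ratio_ge]
    have h3 : (m : ℝ) ≤ 2 * (E / σ) := by linarith
    calc σ * m ≤ σ * (2 * (E / σ)) := by gcongr
      _ = 2 * E := by field_simp
  have h1 : (E + σ * m) / (0.9 * (1 / (128 * n ^ 3)) * c ^ 2) ≤ 1250 * n ^ 6 / c ^ 2 := by
    rw [div_le_div_iff₀ (by positivity) (by positivity)]
    have e : 1250 * n ^ 6 * (0.9 * (1 / (128 * n ^ 3)) * c ^ 2)
        = (1125 / 128 * n ^ 3) * c ^ 2 := by
      field_simp; norm_num
    rw [e]
    gcongr
    have h2 := h.sixteen_le_n_sq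
    have h3 : n * a ≤ n * (1 / 12) := by gcongr; exact h.a_le
    have h4 : n * 16 ≤ n * n ^ 2 := by gcongr
    have h5 : E = 0.505 * (n * a) := by rw [hE]; ring
    nlinarith
  have hq1 : q ≤ 1 / 1000 := by linarith [h.q_le_a, h.a_le]
  have h𝒯 : 1 ≤ l / (25 * q) := by
    rw [le_div_iff₀ (by positivity)]
    linarith [h.l_ge]
  have h2 : (m : ℝ) * (l / (25 * q)) ≤ 0.004 * (a * l ^ 2 / (n * q ^ 3)) * (l / (25 * q)) := by
    gcongr
  have e2 : 0.004 * (a * l ^ 2 / (n * q ^ 3)) * (l / (25 * q))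
      = (0.00016 * a / (n * l)) * (l ^ 4 / q ^ 4) := by
    field_simp; norm_num
  have h3 : 0.00016 * a / (n * l) ≤ 0.0001 := by
    rw [div_le_iff₀ (by positivity)]
    nlinarith [h.a_le, h.n_ge, h.l_ge]
  have h4 : 0 < l ^ 4 / q ^ 4 := by positivity
  have h5 : (0.00016 * a / (n * l)) * (l ^ 4 / q ^ 4) ≤ 0.0001 * (l ^ 4 / q ^ 4) := by gcongr
  have e3 : l ^ 4 / (800 * q ^ 4) = 0.00125 * (l ^ 4 / q ^ 4) := by field_simp; norm_num
  rw [e3]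
  have h6 : (m : ℝ) ≤ m * (l / (25 * q)) := le_mul_of_one_le_right (by linarith) h𝒯
  have h7 : l / (25 * q) ≤ m * (l / (25 * q)) := le_mul_of_one_le_left (by linarith) hm1
  nlinarith

end ParamBounds

/-- The bounds hold for the parameters of the theorem. -/
lemma paramBounds_of {n a ξ ρ : ℝ} (hn : 4 ≤ n) (ha : 0 < a) (ha' : a ≤ 1 / 12)
    (hξ : 100000 ≤ ξ) (hρ0 : 0 < ρ) (hρ : ρ < 1 / 1000) (hξρ : ξ < 128 / ρ ^ 2) :
    ParamBounds n a (Real.log n) (a / (ξ * n ^ 3)) (a * ρ ^ 2 / (2 * n))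
      (Real.log n * ξ / (3200 * a)) := by
  have hn0 : 0 < n := by linarith
  have hξ0 : 0 < ξ := by linarith
  have hl : 1 ≤ Real.log n := by
    rw [Real.le_log_iff_exp_le hn0]
    linarith [Real.exp_one_lt_three]
  have hl' : Real.log n ≤ n := by linarith [Real.log_le_sub_one_of_pos hn0]
  have hρ2 : ρ ^ 2 ≤ 1 / 1000 := by nlinarith
  rw [lt_div_iff₀ (by positivity)] at hξρ
  refine ⟨hn, ha, ha', hl, hl', by positivity, ?_, by positivity, ?_, by positivity, ?_⟩
  · have : a / (ξ * n ^ 3) * n ^ 3 = a / ξ := by field_simp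
    rw [this]
    gcongr
  -- The bound `ξ < 128/ρ²` says exactly that the gradient tolerance is below `64 q n²`.
  · have : 64 * (a / (ξ * n ^ 3)) * n ^ 2 = 64 * a / (ξ * n) := by field_simp
    rw [this, div_le_div_iff₀ (by positivity) (by positivity)]
    have : 0 < a * n := by positivity
    nlinarith
  · apply le_of_eq
    field_simp

/-- For `y ≤ 1/3` one has `exp y ≤ 1/(1 - y) ≤ 1 + 1.5y`. The exponent is about `ξ log n / 6400`;
rounding `K` down is absorbed by weakening `6400` to `10000`. -/
lemma growth_ge {n a ξ : ℝ} (hn : 4 ≤ n) (ha : 0 < a) (ha' : a ≤ 1 / 12) (hξ : 100000 ≤ ξ)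
    {K : ℕ} (hK : ξ * n ^ 3 * Real.log n / (25 * a) < K + 1) :
    n ^ (ξ / 10000) ≤ (1 + 1 / (128 * n ^ 3) * (1.5 * a / 2)) ^ K := by
  have hn0 : 0 < n := by linarith
  have hl : 1 ≤ Real.log n := by
    rw [Real.le_log_iff_exp_le hn0]
    linarith [Real.exp_one_lt_three]
  set y := 1 / (128 * n ^ 3) * (a / 2) with hy
  have hy0 : 0 < y := by positivity
  have hy1 : y ≤ 1 / 3 := by
    have h1 : 1 ≤ n ^ 3 := one_le_pow₀ (by linarith)
    have h2 : 1 / (128 * n ^ 3) ≤ 1 := by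
      rw [div_le_one (by positivity)]; linarith
    calc y ≤ 1 * (a / 2) := by rw [hy]; gcongr
      _ ≤ 1 / 3 := by linarith
  have hexp : Real.exp y ≤ 1 + 1.5 * y := by
    have h1 := Real.exp_bound_div_one_sub_of_interval hy0.le (by linarith)
    refine h1.trans ?_
    rw [div_le_iff₀ (by linarith)]
    nlinarith
  have e : 1 + 1 / (128 * n ^ 3) * (1.5 * a / 2) = 1 + 1.5 * y := by rw [hy]; ring
  rw [e, Real.rpow_def_of_pos hn0]
  calc Real.exp (Real.log n * (ξ / 10000)) ≤ Real.exp (K * y) := by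
        apply Real.exp_le_exp.2
        have h1 : (ξ * n ^ 3 * Real.log n / (25 * a) - 1) * y ≤ K * y := by
          apply mul_le_mul_of_nonneg_right _ hy0.le
          linarith
        have h2 : ξ * n ^ 3 * Real.log n / (25 * a) * y = ξ * Real.log n / 6400 := by
          rw [hy]; field_simp; norm_num
        nlinarith
    _ = Real.exp y ^ K := by rw [Real.exp_nat_mul]
    _ ≤ (1 + 1.5 * y) ^ K := by gcongr

variable {n : ℕ} [NeZero n] {Ω : Type*} [mΩ : MeasurableSpace Ω]

/-- If the objective is close to the `ℓ⁴` objective in the basis `b`, then with high probability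
the iterates of perturbed manifold gradient descent come close to a vector of the basis. -/
theorem prob_avoid_le_of_near_model {P : Measure Ω} [IsProbabilityMeasure P]
    {𝓕 : Filtration ℕ mΩ} {L : Ω → Sig n → ℝ} {θ ρ ξ : ℝ} (hn : 4 ≤ n)
    (ha : 0 < θ * (1 - 3 * θ)) (ha' : θ * (1 - 3 * θ) ≤ 1 / 12) (hξ : 100000 ≤ ξ) (hρ0 : 0 < ρ)
    (hρ : ρ < 1 / 1000) (hξρ : ξ < 128 / ρ ^ 2)
    {h z : ℕ → Ω → Sig n} {s : ℕ → Ω → ℕ}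
    (hrun : IsPMGD P 𝓕 L (1 / (128 * (n : ℝ) ^ 3))
        (θ ^ 2 * (1 - 3 * θ) ^ 2 / (ξ ^ 2 * (n : ℝ) ^ 6 * Real.log n ^ 2))
        (ξ * (n : ℝ) ^ 3 * Real.log n / (25 * θ * (1 - 3 * θ)))
        (θ * (1 - 3 * θ) * ρ ^ 2 / (2 * n)) h z s)
    {F : Sig n → ℝ} (hFm : Measurable F) {Ω₀ : Set Ω}
    (hΩ₀ : MeasurableSet[𝓕 0] Ω₀) (hLF : ∀ ω ∈ Ω₀, L ω = F)
    {S : Sig n → Sig n → Sig n → Sig n} {C ε : ℝ}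
    (hS : SymmQuartic S (1.01 * n * (θ * (1 - 3 * θ)))) (hF : AgreesOnSphere F S C)
    (b : OrthonormalBasis (ZMod n) ℝ (Sig n))
    (hε : ε ≤ θ * (1 - 3 * θ) * ρ ^ 2 / (100 * n))
    (hE : ∀ x y z, ‖S x y z - diagCubic b (n * (θ * (1 - 3 * θ))) x y z‖
      ≤ ε * ‖x‖ * ‖y‖ * ‖z‖) :
    P (Ω₀ ∩ {ω | ∀ t : ℕ, 1 ≤ t →
        (t : ℝ) ≤ 5000 * (n : ℝ) ^ 8 / (θ ^ 2 * (1 - 3 * θ) ^ 2 * ρ ^ 4)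
          + ξ ^ 4 * (n : ℝ) ^ 12 * Real.log n ^ 4 / (800 * θ ^ 4 * (1 - 3 * θ) ^ 4) →
        ∀ j, inner ℝ (b j) (h t ω) ^ 2 < 1 - ρ})
      ≤ ENNReal.ofReal (ξ ^ 4 * (n : ℝ) ^ (13 - ξ / 10000) * Real.log n ^ 4 /
            (8 * θ ^ 4 * (1 - 3 * θ) ^ 4)) * P Ω₀ := by
  set a := θ * (1 - 3 * θ) with hadef
  have hnR : (4 : ℝ) ≤ n := by exact_mod_cast hn
  have hp := paramBounds_of hnR ha ha' hξ hρ0 hρ hξρ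
  set l := Real.log n with hl
  set q := a / (ξ * (n : ℝ) ^ 3) with hq
  set c := a * ρ ^ 2 / (2 * n) with hc
  have hn0 : (0 : ℝ) < n := hp.n_pos
  have hl0 := hp.l_pos
  have hq0 := hp.q_pos
  have hc0 := hp.c_pos
  have hξ0 : 0 < ξ := by linarith
  have hD : θ ^ 2 * (1 - 3 * θ) ^ 2 / (ξ ^ 2 * (n : ℝ) ^ 6 * l ^ 2) = q ^ 2 / l ^ 2 := by
    rw [hq, ← mul_pow, ← hadef]; field_simp
  have h𝒯 : ξ * (n : ℝ) ^ 3 * l / (25 * θ * (1 - 3 * θ)) = l / (25 * q) := by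
    rw [mul_assoc 25 θ, ← hadef, hq]; field_simp
  rw [hD, h𝒯] at hrun
  have hT1 : 5000 * (n : ℝ) ^ 8 / (θ ^ 2 * (1 - 3 * θ) ^ 2 * ρ ^ 4) = 1250 * (n : ℝ) ^ 6 / c ^ 2 := by
    rw [← mul_pow, ← hadef, hc]; field_simp; norm_num
  have hT2 : ξ ^ 4 * (n : ℝ) ^ 12 * l ^ 4 / (800 * θ ^ 4 * (1 - 3 * θ) ^ 4)
      = l ^ 4 / (800 * q ^ 4) := by
    rw [mul_assoc 800, ← mul_pow θ, ← hadef, hq]; field_simp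
  set w := (n : ℝ) ^ (-(ξ / 10000)) with hw
  have hw0 : 0 < w := Real.rpow_pos_of_pos hn0 _
  have hfail : ξ ^ 4 * (n : ℝ) ^ (13 - ξ / 10000) * l ^ 4 / (8 * θ ^ 4 * (1 - 3 * θ) ^ 4)
      = n * w * l ^ 4 / (8 * q ^ 4) := by
    rw [mul_assoc 8, ← mul_pow θ, ← hadef, hq, sub_eq_add_neg, Real.rpow_add hn0, ← hw]
    rw [show (n : ℝ) ^ (13 : ℝ) = (n : ℝ) ^ 13 by exact_mod_cast Real.rpow_natCast (n : ℝ) 13]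
    field_simp
  rw [hT1, hT2, hfail]
  set K := ⌊l / (25 * q)⌋₊ with hK
  have hKle : (K : ℝ) ≤ l / (25 * q) := Nat.floor_le (by positivity)
  have hKlt : l / (25 * q) < K + 1 := Nat.lt_floor_add_one _
  set m := ⌊1.01 * n * a / 2 / (2 * (64 * q ^ 3 * n ^ 2 / l ^ 2))⌋₊ + 1 with hm
  set T := ⌊1250 * (n : ℝ) ^ 6 / c ^ 2 + l ^ 4 / (800 * q ^ 4)⌋₊ with hT
  set σ := 2 * (64 * q ^ 3 * n ^ 2 / l ^ 2) with hσ
  have hσ0 : 0 < σ := hp.decrease_pos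
  have hγ0 : 0 ≤ 1 / (128 * (n : ℝ) ^ 3) := by positivity
  have hγK : 1 / (128 * (n : ℝ) ^ 3) * K ≤ l * ξ / (3200 * a) := by
    calc 1 / (128 * (n : ℝ) ^ 3) * K ≤ 1 / (128 * (n : ℝ) ^ 3) * (l / (25 * q)) := by gcongr
      _ = l * ξ / (3200 * a) := by rw [hq]; field_simp; norm_num
  have hM0 : 0 ≤ 1.01 * n * a := by positivity
  -- The choice `τ = q n^(-ξ/10000)` makes the growth carry a separation `τ` to at least `q`, more
  -- than the diameter `2q/5` of the localization ball.
  have hgrow : 2 * (q / 5) < (1 + 1 / (128 * (n : ℝ) ^ 3) * (1.5 * a / 2)) ^ K * (q * w) := by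
    have h1 : (n : ℝ) ^ (ξ / 10000) ≤ (1 + 1 / (128 * (n : ℝ) ^ 3) * (1.5 * a / 2)) ^ K := by
      apply growth_ge hnR ha ha' hξ
      convert hKlt using 1
      rw [hq, ← hl]; field_simp
    have h2 : (n : ℝ) ^ (ξ / 10000) * w = 1 := by
      rw [hw, ← Real.rpow_add hn0, add_neg_cancel, Real.rpow_zero]
    calc 2 * (q / 5) < q := by linarith
      _ = (n : ℝ) ^ (ξ / 10000) * (q * w) := by rw [mul_left_comm, h2, mul_one]
      _ ≤ _ := by gcongr
  set H : Set (Sig n) := ⋃ j, {u | 1 - ρ ≤ inner ℝ (b j) u ^ 2} with hH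
  have hHm : MeasurableSet H := MeasurableSet.iUnion fun j =>
    measurableSet_le (f := fun _ => 1 - ρ) (g := fun u : Sig n => inner ℝ (b j) u ^ 2)
      measurable_const (by fun_prop)
  have hnotH : ∀ u, u ∉ H ↔ ∀ j, inner ℝ (b j) u ^ 2 < 1 - ρ := fun u => by
    rw [hH]
    simp only [Set.mem_iUnion, not_exists]
    exact forall_congr' fun j => by rw [Set.mem_ofPred_eq, not_le]
  have hstepval : ∀ u : Sig n, ‖u‖ = 1 →
      ‖mgdStep F (1 / (128 * (n : ℝ) ^ 3)) u‖ = 1 ∧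
      F (mgdStep F (1 / (128 * (n : ℝ) ^ 3)) u)
        ≤ F u - 0.9 * (1 / (128 * (n : ℝ) ^ 3)) * ‖riemGrad F u‖ ^ 2 := fun u hu => by
    have h1 := hS.norm_sphStep (1 / (128 * (n : ℝ) ^ 3)) hu
    have h2 := hS.quartic_sphStep_ge hγ0 hM0 hp.stepSize_mul_le hu
    rw [hF.mgdStep_eq _ hu, hF.value u hu, hF.value _ h1, hF.grad u hu]
    exact ⟨h1, by linarith⟩
  -- The objective is minus a quarter of the quartic form: hence the gain `0.9 = 3.6/4` per step and
  -- the oscillation `M/2` for values in `[-M, M]`.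
  have hmain := prob_avoid_le hrun hFm hΩ₀ hLF (g := 0.9 * (1 / (128 * (n : ℝ) ^ 3)) * c ^ 2)
    (e := σ) (σ := σ) (E := 1.01 * n * a / 2) (K := K) (m := m) (T := T)
    (by positivity) hσ0.le hKle hσ0 (by
      rw [hm, ← div_lt_iff₀' hσ0]; push_cast; exact Nat.lt_floor_add_one _)
    (fun u hu => ⟨(hstepval u hu).1, (hstepval u hu).2.trans (by
      have : 0 ≤ 0.9 * (1 / (128 * (n : ℝ) ^ 3)) * ‖riemGrad F u‖ ^ 2 := by positivity
      linarith)⟩)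
    (fun u hu hcu => (hstepval u hu).2.trans (by
      have : 0.9 * (1 / (128 * (n : ℝ) ^ 3)) * c ^ 2
        ≤ 0.9 * (1 / (128 * (n : ℝ) ^ 3)) * ‖riemGrad F u‖ ^ 2 := by gcongr
      linarith))
    (fun u hu u' hu' => by
      have h1 := abs_le.1 (hS.abs_quartic_le_one hu)
      have h2 := abs_le.1 (hS.abs_quartic_le_one hu')
      rw [hF.value u hu, hF.value u' hu']
      linarith)
    (fun u hu hcu z hz hzD => by
      have hD1 : q ^ 2 / l ^ 2 ≤ 1 / 10 := by linarith [hp.perturb_radius_le, hp.radius_le]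
      have hpn := norm_perturb hu hz (hzD.trans (hD1.trans (by norm_num)))
      refine ⟨hpn, ?_⟩
      rw [hF.value u hu, hF.value _ hpn]
      have hgu : ‖sphGrad S u‖ ≤ c := by rw [← hF.grad u hu]; exact hcu.le
      have h1 := hS.quartic_perturb_ge hM0 hu hz (hzD.trans hD1) hgu
      have h2 := hp.perturb_cost_le
      have h3 : 4 * c * ‖z‖ ≤ 4 * c * (q ^ 2 / l ^ 2) := by gcongr
      have h4 : 32 * (1.01 * n * a) * ‖z‖ ^ 2 ≤ 32 * (1.01 * n * a) * (q ^ 2 / l ^ 2) ^ 2 := by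
        gcongr
      rw [← hσ] at h2
      linarith)
    hHm (δ := ENNReal.ofReal (3 * n * (q * w) / (q ^ 2 / l ^ 2)))
    (fun u hu hcu huH => by
      have hcard : (Fintype.card (ZMod n) : ℝ) = n := by rw [ZMod.card]
      have hcurv := exists_negative_curvature (ε := ε) hS b ha hρ0 hρ (by rwa [hcard])
        (by rwa [hcard]) hu (by rw [hcard, ← hF.grad u hu]; exact hcu.le) ((hnotH u).1 huH)
      have hlam : 1.5 * a ≤ 4 * (1.01 * n * a) := by
        have := mul_le_mul_of_nonneg_right hp.n_ge ha.le
        linarith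
      have hlam0 : (0 : ℝ) ≤ 1.5 * a := by positivity
      have hcost : 4 * c * (q ^ 2 / l ^ 2) + 32 * (1.01 * n * a) * (q ^ 2 / l ^ 2) ^ 2 + 4 * σ
          ≤ 16 * (64 * q ^ 3 * n ^ 2 / l ^ 2) := by
        have := hp.perturb_cost_le
        rw [hσ]
        linarith
      exact escape_probability_le hFm hS hF hγ0 hM0 hp.stepSize_mul_le hp.radius_le
        (by positivity) (by linarith [hp.perturb_radius_le, hp.radius_le]) hc0.le
        hp.grad_near_le_lipschitz hlam0 hlam hp.error_rate_le_curvature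
        (hp.total_error_le hγ0 K.cast_nonneg hγK hp.error_rate_le)
        (hp.localization hγK) hcost (by positivity) hgrow hu hcu hcurv)
    (by
      refine (hp.time_le hm).trans_le ?_
      rw [sub_le_iff_le_add]
      exact (Nat.lt_floor_add_one _).le)
  refine (measure_mono ?_).trans (hmain.trans ?_)
  · rintro ω ⟨hω, hav⟩
    refine ⟨hω, fun t ht htT => (hnotH _).2 (hav t ht ?_)⟩
    exact (Nat.cast_le.2 htT).trans (Nat.floor_le (by positivity))
  · gcongr
    rw [← ENNReal.ofReal_natCast, ← ENNReal.ofReal_mul (Nat.cast_nonneg _)]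
    exact ENNReal.ofReal_le_ofReal (hp.failure_le hw0.le (hp.count_le hm))

end Assembly

/-! ### The preconditioner cancels the signal up to a rotation. -/

section Preconditioner

variable {n : ℕ} [NeZero n] {N : ℕ}

lemma circ_conv (x f : Sig n) : circ (conv x f) = circ x * circ f :=
  (Matrix.circulant_mul _ _).symm

lemma circ_mul_comm (x y : Sig n) : circ x * circ y = circ y * circ x :=
  Matrix.circulant_mul_comm _ _

lemma transpose_circ (x : Sig n) : (circ x)ᵀ = circ (WithLp.toLp 2 fun j => x (-j)) :=
  Matrix.transpose_circulant _

/-- The matrix `(θ n N)⁻¹ ∑ᵢ C_{xᵢ}ᵀ C_{xᵢ}`. -/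
def gram (θ : ℝ) (x : Fin N → Sig n) : Matrix (ZMod n) (ZMod n) ℝ :=
  (1 / (θ * n * N)) • ∑ i, (circ (x i))ᵀ * circ (x i)

lemma commute_circ_transpose_mul (x y : Sig n) : Commute (circ x) ((circ y)ᵀ * circ y) := by
  rw [transpose_circ]
  exact Commute.mul_right (circ_mul_comm _ _) (circ_mul_comm _ _)

lemma commute_circ_gram (θ : ℝ) (x : Fin N → Sig n) (y : Sig n) :
    Commute (circ y) (gram θ x) :=
  Commute.smul_right (Commute.sum_right _ _ _ fun i _ => commute_circ_transpose_mul y (x i)) _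

lemma commute_gram_mul_gram (θ : ℝ) (x : Fin N → Sig n) (f : Sig n) :
    Commute ((circ f)ᵀ * circ f) (gram θ x) := by
  rw [transpose_circ]
  exact Commute.mul_left (commute_circ_gram _ _ _) (commute_circ_gram _ _ _)

lemma gram_conv (θ : ℝ) (x : Fin N → Sig n) (f : Sig n) :
    gram θ (fun i => conv (x i) f) = (circ f)ᵀ * gram θ x * circ f := by
  rw [gram, gram, Matrix.mul_smul, Matrix.smul_mul, Matrix.mul_sum, Matrix.sum_mul]
  congr 1
  refine Finset.sum_congr rfl fun i _ => ?_
  rw [circ_conv, Matrix.transpose_mul]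
  simp only [Matrix.mul_assoc]

lemma gram_conv' (θ : ℝ) (x : Fin N → Sig n) (f : Sig n) :
    gram θ (fun i => conv (x i) f) = ((circ f)ᵀ * circ f) * gram θ x := by
  rw [gram_conv, Matrix.mul_assoc, ← (commute_circ_gram θ x f).eq, Matrix.mul_assoc]

lemma transpose_gram (θ : ℝ) (x : Fin N → Sig n) : (gram θ x)ᵀ = gram θ x := by
  simp [gram, Matrix.transpose_smul, Matrix.transpose_sum, Matrix.transpose_mul]

lemma precond_eq (θ : ℝ) (y : Fin N → Sig n) :
    precond θ y = cfc (fun t : ℝ => t ^ (-(1 / 2) : ℝ)) (gram θ y) := rfl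

open scoped MatrixOrder in
lemma posSemidef_cfc {ι : Type*} [Fintype ι] [DecidableEq ι] (A : Matrix ι ι ℝ) {g : ℝ → ℝ}
    (hg : ∀ t, 0 ≤ t → 0 ≤ g t) (hA : A.PosSemidef) : (cfc g A).PosSemidef := by
  rw [← Matrix.nonneg_iff_posSemidef]
  refine cfc_nonneg fun t ht => hg t ?_
  exact spectrum_nonneg_of_nonneg (Matrix.nonneg_iff_posSemidef.2 hA) ht

open scoped MatrixOrder in
lemma spectrum_nonneg_of_posSemidef {ι : Type*} [Fintype ι] [DecidableEq ι] {A : Matrix ι ι ℝ}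
    (hA : A.PosSemidef) {t : ℝ} (ht : t ∈ spectrum ℝ A) : 0 ≤ t :=
  spectrum_nonneg_of_nonneg (Matrix.nonneg_iff_posSemidef.2 hA) ht

/-- The spectrum is finite, so the functional calculus accepts every function, including powers
singular at zero. -/
lemma continuousOn_spectrum {ι : Type*} [Fintype ι] [DecidableEq ι] (A : Matrix ι ι ℝ)
    (g : ℝ → ℝ) : ContinuousOn g (spectrum ℝ A) :=
  (Matrix.finite_real_spectrum (A := A)).continuousOn g

lemma sqrt_mul_sqrt_cfc {ι : Type*} [Fintype ι] [DecidableEq ι] {A : Matrix ι ι ℝ}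
    (hA : A.PosSemidef) : cfc Real.sqrt A * cfc Real.sqrt A = A := by
  have hsa : IsSelfAdjoint A := hA.isHermitian
  rw [← cfc_mul _ _ A (continuousOn_spectrum _ _) (continuousOn_spectrum _ _)]
  conv_rhs => rw [← cfc_id ℝ A hsa]
  exact cfc_congr fun t ht => Real.mul_self_sqrt (spectrum_nonneg_of_posSemidef hA ht)

lemma rpow_cfc_mul {ι : Type*} [Fintype ι] [DecidableEq ι] {A : Matrix ι ι ℝ}
    (hA : A.PosDef) : cfc (fun t : ℝ => t ^ (-(1 / 2) : ℝ)) A *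
      cfc (fun t : ℝ => t ^ (-(1 / 2) : ℝ)) A * A = 1 := by
  have hsa : IsSelfAdjoint A := hA.isHermitian
  rw [← cfc_mul _ _ A (continuousOn_spectrum _ _) (continuousOn_spectrum _ _)]
  conv_lhs => enter [2]; rw [← cfc_id ℝ A hsa]
  rw [← cfc_mul _ _ A (continuousOn_spectrum _ _) (continuousOn_spectrum _ _), ← cfc_one ℝ A hsa]
  refine cfc_congr fun t ht => ?_
  have ht0 : 0 < t := by
    refine lt_of_le_of_ne (spectrum_nonneg_of_posSemidef hA.posSemidef ht) fun h => ?_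
    subst h
    exact spectrum.zero_notMem ℝ hA.isUnit ht
  simp only [id, Pi.one_apply]
  rw [← Real.rpow_add ht0]
  norm_num
  rw [Real.rpow_neg_one, inv_mul_cancel₀ ht0.ne']

/-- The rotation is an orthogonal matrix. -/
lemma transpose_rotation_mul {f : Sig n} (hf : IsUnit (circ f)) :
    (rotation f)ᵀ * rotation f = 1 := by
  have hG : ((circ f)ᵀ * circ f).PosSemidef := Matrix.posSemidef_conjTranspose_mul_self _
  have hs : (cfc Real.sqrt ((circ f)ᵀ * circ f))ᵀ = cfc Real.sqrt ((circ f)ᵀ * circ f) :=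
    (posSemidef_cfc _ (fun t _ => Real.sqrt_nonneg t) hG).isHermitian
  have hdet : IsUnit (circ f).det := (Matrix.isUnit_iff_isUnit_det _).1 hf
  rw [rotation, Matrix.transpose_mul, hs, Matrix.mul_assoc, ← Matrix.mul_assoc (cfc _ _) (cfc _ _),
    sqrt_mul_sqrt_cfc hG, Matrix.mul_assoc, Matrix.mul_nonsing_inv _ hdet, Matrix.mul_one,
    ← Matrix.transpose_mul, Matrix.mul_nonsing_inv _ hdet, Matrix.transpose_one]

/-- The preconditioned convolution by `f` is the rotation of a positive semidefinite square root
of the inverse of the Gram matrix of the channels. -/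
lemma exists_sqrt_inv_gram {θ : ℝ} {x : Fin N → Sig n} {f : Sig n} (hf : IsUnit (circ f))
    (hM : (gram θ x).PosDef) : ∃ X : Matrix (ZMod n) (ZMod n) ℝ, X.PosSemidef ∧
      X * X * gram θ x = 1 ∧
      circ f * precond θ (fun i => conv (x i) f) = (rotation f)ᵀ * X := by
  set G := (circ f)ᵀ * circ f with hGdef
  have hG : G.PosSemidef := Matrix.posSemidef_conjTranspose_mul_self _
  set B := gram θ (fun i => conv (x i) f) with hB
  have hdet : IsUnit (circ f).det := (Matrix.isUnit_iff_isUnit_det _).1 hf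
  have hBpd : B.PosDef := by
    rw [hB, gram_conv]
    exact hM.conjTranspose_mul_mul_same (Matrix.mulVec_injective_of_isUnit hf)
  set s := cfc Real.sqrt G with hs
  set r := cfc Real.sqrt s with hr
  set R := precond θ (fun i => conv (x i) f) with hR
  have hsp : s.PosSemidef := posSemidef_cfc _ (fun t _ => Real.sqrt_nonneg t) hG
  have hrp : r.PosSemidef := posSemidef_cfc _ (fun t _ => Real.sqrt_nonneg t) hsp
  have hRp : R.PosSemidef := by
    rw [hR, precond_eq]
    exact posSemidef_cfc _ (fun t ht => Real.rpow_nonneg ht _) hBpd.posSemidef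
  have hGB : Commute G B := by
    rw [hB, gram_conv']
    exact (Commute.refl G).mul_right (commute_gram_mul_gram θ x f)
  have hsB : Commute s B := hGB.cfc_real _
  have hRs : Commute R s := by
    rw [hR, precond_eq]
    exact hsB.symm.cfc_real _
  have hRr : Commute r R := hRs.symm.cfc_real _
  have hRG : Commute R G := by
    rw [hR, precond_eq]
    exact hGB.symm.cfc_real _
  have hss : s * s = G := sqrt_mul_sqrt_cfc hG
  have hrr : r * r = s := sqrt_mul_sqrt_cfc hsp
  have hRRB : R * R * B = 1 := by
    rw [hR, precond_eq]
    exact rpow_cfc_mul hBpd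
  -- With `s = (C_fᵀ C_f)^{1/2}`, the product `s R` of commuting positive matrices is written as `r
  -- R r` with `r² = s`, which shows that it is positive semidefinite.
  refine ⟨s * R, ?_, ?_, ?_⟩
  · have : s * R = rᴴ * R * r := by
      rw [hrp.isHermitian.eq, ← hrr, Matrix.mul_assoc, Matrix.mul_assoc, hRr.eq]
    rw [this]
    exact hRp.conjTranspose_mul_mul_same r
  · calc s * R * (s * R) * gram θ x = s * (R * s) * R * gram θ x := by simp only [Matrix.mul_assoc]
      _ = (s * s) * R * R * gram θ x := by rw [hRs.eq]; simp only [Matrix.mul_assoc]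
      _ = R * R * (G * gram θ x) := by
        rw [hss, ← hRG.eq, Matrix.mul_assoc R, ← hRG.eq]; simp only [Matrix.mul_assoc]
      _ = 1 := by rw [← gram_conv', hRRB]
  · have h1 : rotation f * circ f = s := by
      rw [rotation, Matrix.mul_assoc, Matrix.nonsing_inv_mul _ hdet, Matrix.mul_one]
    rw [← h1, Matrix.mul_assoc, ← Matrix.mul_assoc, transpose_rotation_mul hf, Matrix.one_mul]

/-- If a positive semidefinite `X` satisfies `X² M = 1` where `M` is close to the identity, then so
is `X`. -/
lemma norm_sqrt_inv_sub_le {X M : Matrix (ZMod n) (ZMod n) ℝ} (hX : X.PosSemidef)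
    (hXM : X * X * M = 1) {δ : ℝ} (hδ : δ ≤ 1 / 2)
    (hM : ∀ v : Sig n, ‖Matrix.toEuclideanCLM (𝕜 := ℝ) M v - v‖ ≤ δ * ‖v‖) (v : Sig n) :
    ‖Matrix.toEuclideanCLM (𝕜 := ℝ) X v - v‖ ≤ 2 * δ * ‖v‖ := by
  set x := Matrix.toEuclideanCLM (𝕜 := ℝ) X with hx
  set m := Matrix.toEuclideanCLM (𝕜 := ℝ) M with hm
  have hMX : m (x (x v)) = v := by
    have h1 : M * (X * X) = 1 := mul_eq_one_comm.1 hXM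
    have h2 : m * (x * x) = 1 := by rw [hm, hx, ← map_mul, ← map_mul, h1, map_one]
    exact congrArg (fun T : Sig n →L[ℝ] Sig n => T v) h2
  have hpos : ∀ w : Sig n, 0 ≤ inner ℝ (x w) w := by
    have := (Matrix.isPositive_toEuclideanLin_iff (𝕜 := ℝ)).2 hX
    exact fun w => this.2 w
  set w := x v - v with hw
  -- From `(X + 1)(X - 1) = X² - 1` and `X ≥ 0`: the factor `X + 1` does not shrink vectors, so `X -
  -- 1` is controlled by `X² - 1`, that is by `M - 1`.
  have h1 : ‖w‖ ≤ ‖x w + w‖ := by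
    rcases (norm_nonneg w).eq_or_lt with h0 | h0
    · rw [← h0]; exact norm_nonneg _
    have h2 : ‖w‖ * ‖w‖ ≤ ‖x w + w‖ * ‖w‖ := by
      calc ‖w‖ * ‖w‖ ≤ inner ℝ (x w + w) w := by
            rw [inner_add_left, real_inner_self_eq_norm_mul_norm]
            linarith [hpos w]
        _ ≤ _ := real_inner_le_norm _ _
    exact le_of_mul_le_mul_right h2 h0
  set u := x (x v) with hu
  have h2 : x w + w = u - v := by rw [hw, map_sub]; abel
  have h3 : ‖u - v‖ ≤ δ * ‖u‖ := by
    rw [norm_sub_rev]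
    have := hM u
    rwa [hMX] at this
  have h4 : ‖u‖ ≤ ‖u - v‖ + ‖v‖ := by
    simpa using norm_add_le (u - v) v
  rw [h2] at h1
  have hδ0 : 0 ≤ δ * ‖u‖ := (norm_nonneg _).trans h3
  have h5 : ‖u‖ ≤ 2 * ‖v‖ := by nlinarith [norm_nonneg u]
  rcases (norm_nonneg u).eq_or_lt with h0 | h0
  · have : v = 0 := by rw [← hMX, norm_eq_zero.1 h0.symm, map_zero]
    rw [this] at h1 ⊢
    rw [norm_zero, mul_zero]
    rw [hw, this, map_zero, sub_zero, norm_zero]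
  have hδ' : 0 ≤ δ := by
    by_contra h; nlinarith
  nlinarith

end Preconditioner

/-! ### Cubic maps attached to sums of fourth powers. -/

section CubicSum

variable {V : Type*} [NormedAddCommGroup V] [InnerProductSpace ℝ V] {ι : Type*} [Fintype ι]

/-- The trilinear map `κ ∑ᵢ ⟨aᵢ, x⟩ ⟨aᵢ, y⟩ ⟨aᵢ, z⟩ aᵢ`. -/
def cubicSum (κ : ℝ) (a : ι → V) (x y z : V) : V :=
  κ • ∑ i, (inner ℝ (a i) x * inner ℝ (a i) y * inner ℝ (a i) z) • a i

/-- The symmetric trilinear map `⟨x, y⟩ z + ⟨y, z⟩ x + ⟨x, z⟩ y`. -/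
def symCubic (x y z : V) : V :=
  inner ℝ x y • z + inner ℝ y z • x + inner ℝ x z • y

lemma inner_cubicSum (κ : ℝ) (a : ι → V) (x y z w : V) :
    inner ℝ (cubicSum κ a x y z) w
      = κ * ∑ i, inner ℝ (a i) x * inner ℝ (a i) y * inner ℝ (a i) z * inner ℝ (a i) w := by
  simp only [cubicSum, inner_smul_left, sum_inner, RCLike.conj_to_real]

lemma inner_symCubic (x y z w : V) :
    inner ℝ (symCubic x y z) w = inner ℝ x y * inner ℝ z w + inner ℝ x z * inner ℝ y w
      + inner ℝ x w * (inner ℝ y z : ℝ) := by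
  simp only [symCubic, inner_smul_left, inner_add_left, RCLike.conj_to_real]
  ring

lemma symmQuartic_cubicSum_sub {κ μ M : ℝ} {a : ι → V}
    (hM : ∀ x y z, ‖cubicSum κ a x y z - μ • symCubic x y z‖ ≤ M * ‖x‖ * ‖y‖ * ‖z‖) :
    SymmQuartic (fun x y z => cubicSum κ a x y z - μ • symCubic x y z) M where
  add_left x x' y z := by
    simp only [cubicSum, symCubic, inner_add_right, inner_add_left, add_mul, add_smul,
      Finset.sum_add_distrib, smul_add]
    abel
  smul_left t x y z := by
    have h1 : ∀ i, (inner ℝ (a i) (t • x) * inner ℝ (a i) y * inner ℝ (a i) z) • a i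
        = t • ((inner ℝ (a i) x * inner ℝ (a i) y * inner ℝ (a i) z) • a i) := fun i => by
      rw [inner_smul_right, smul_smul]; congr 1; ring
    simp only [cubicSum, h1, ← Finset.smul_sum]
    simp only [symCubic, inner_smul_left, RCLike.conj_to_real]
    module
  swap_left x y z := by
    simp only [cubicSum, symCubic, real_inner_comm x y, mul_comm (inner ℝ (a _) x)]
    abel_nf
  swap_right x y z := by
    simp only [cubicSum, symCubic, real_inner_comm y z, mul_assoc, mul_comm (inner ℝ (a _) y)]
    abel_nf
  swap_inner x y z w := by
    simp only [inner_sub_left, inner_cubicSum, inner_smul_left, inner_symCubic, RCLike.conj_to_real]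
    rw [real_inner_comm z w]
    congr 2
    · exact Finset.sum_congr rfl fun i _ => by ring
    · ring
  bound := hM

variable [CompleteSpace V]

/-- The gradient of `-(κ / 4) ∑ᵢ ⟨aᵢ, h⟩⁴`. -/
lemma hasGradientAt_neg_sum_pow_four (κ : ℝ) (a : ι → V) (h : V) :
    HasGradientAt (fun h => -(1 / 4) * (κ * ∑ i, inner ℝ (a i) h ^ 4)) (-cubicSum κ a h h h) h := by
  rw [hasGradientAt_iff_hasFDerivAt]
  have h1 : ∀ i, HasFDerivAt (fun h => inner ℝ (a i) h ^ 4)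
      ((4 * inner ℝ (a i) h ^ 3) • innerSL ℝ (a i)) h := fun i => by
    refine ((innerSL ℝ (a i)).hasFDerivAt (x := h) |>.pow 4).congr_fderiv ?_
    refine ContinuousLinearMap.ext fun w => ?_
    simp [mul_assoc]
  have h2 := (HasFDerivAt.fun_sum (u := Finset.univ) fun i _ => h1 i).const_mul κ
    |>.const_mul (-(1 / 4))
  refine h2.congr_fderiv (ContinuousLinearMap.ext fun w => ?_)
  simp only [InnerProductSpace.toDual_apply_apply, inner_neg_left, inner_cubicSum,
    smul_apply, sum_apply, innerSL_apply_apply, smul_eq_mul]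
  rw [Finset.mul_sum, Finset.mul_sum, Finset.mul_sum, ← Finset.sum_neg_distrib]
  exact Finset.sum_congr rfl fun i _ => by ring

end CubicSum

/-! ### Removing the part of the objective that is constant on the sphere. -/

section Agreement

variable {n : ℕ} [NeZero n] {ι : Type*} [Fintype ι]

/-- On the sphere `symCubic u u u = 3u`: subtracting `μ` times it changes the value by a constant
and the gradient only radially. This frees the form of its isotropic part without changing the
dynamics. -/
lemma agreesOnSphere_neg_sum_pow_four (κ μ : ℝ) (a : ι → Sig n) :
    AgreesOnSphere (fun h => -(1 / 4) * (κ * ∑ i, inner ℝ (a i) h ^ 4))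
      (fun x y z => cubicSum κ a x y z - μ • symCubic x y z) (-(3 / 4) * μ) := by
  have hsym : ∀ u : Sig n, ‖u‖ = 1 → symCubic u u u = (3 : ℝ) • u := fun u hu => by
    rw [symCubic, real_inner_self_eq_norm_sq, hu]; module
  have hself : ∀ u : Sig n, ‖u‖ = 1 → inner ℝ u u = (1 : ℝ) := fun u hu => by
    rw [real_inner_self_eq_norm_sq, hu, one_pow]
  have hq : ∀ u : Sig n, ‖u‖ = 1 → quartic (fun x y z => cubicSum κ a x y z - μ • symCubic x y z) u
      = inner ℝ (cubicSum κ a u u u) u - 3 * μ := fun u hu => by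
    rw [quartic, hsym u hu, inner_sub_left, inner_smul_left, inner_smul_left, hself u hu]
    simp; ring
  refine ⟨fun u hu => ?_, fun u hu => ?_⟩
  · rw [hq u hu, inner_cubicSum]
    have : ∀ i, inner ℝ (a i) u * inner ℝ (a i) u * inner ℝ (a i) u * inner ℝ (a i) u
      = inner ℝ (a i) u ^ 4 := fun i => by ring
    simp only [this]
    ring
  · rw [riemGrad, (hasGradientAt_neg_sum_pow_four κ a u).gradient, sphGrad, hq u hu, hsym u hu,
      inner_neg_right, real_inner_comm]
    module

end Agreement

/-! ### Quadrilinear forms: Hilbert–Schmidt bounds and the model form. -/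

section Tensor

variable {ι : Type*} [Fintype ι]

/-- The quadrilinear form of a tensor of order four. -/
def tensorForm (T : ι × ι × ι × ι → ℝ) (u v w p : ι → ℝ) : ℝ :=
  ∑ q, T q * (u q.1 * v q.2.1 * w q.2.2.1 * p q.2.2.2)

lemma sum_prod_four (u v w p : ι → ℝ) :
    ∑ q : ι × ι × ι × ι, u q.1 * v q.2.1 * w q.2.2.1 * p q.2.2.2
      = (∑ j, u j) * (∑ j, v j) * (∑ j, w j) * ∑ j, p j := by
  simp only [Fintype.sum_prod_type]
  simp only [← Finset.mul_sum, ← Finset.sum_mul]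

/-- Cauchy–Schwarz against the rank-one tensor: the operator norm is at most the Hilbert–Schmidt
norm, which entrywise moment bounds control. -/
lemma abs_tensorForm_le {T : ι × ι × ι × ι → ℝ} {τ : ℝ} (hτ : 0 ≤ τ) (hT : ∑ q, T q ^ 2 ≤ τ ^ 2)
    (u v w p : EuclideanSpace ℝ ι) :
    |tensorForm T u v w p| ≤ τ * ‖u‖ * ‖v‖ * ‖w‖ * ‖p‖ := by
  apply abs_le_of_sq_le_sq _ (by positivity)
  calc tensorForm T u v w p ^ 2
      ≤ (∑ q, T q ^ 2) * ∑ q : ι × ι × ι × ι, (u q.1 * v q.2.1 * w q.2.2.1 * p q.2.2.2) ^ 2 :=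
        Finset.sum_mul_sq_le_sq_mul_sq _ _ _
    _ ≤ τ ^ 2 * (‖u‖ ^ 2 * ‖v‖ ^ 2 * ‖w‖ ^ 2 * ‖p‖ ^ 2) := by
        refine mul_le_mul hT (le_of_eq ?_) (by positivity) (by positivity)
        simp only [mul_pow, EuclideanSpace.norm_sq_eq, Real.norm_eq_abs, sq_abs]
        exact sum_prod_four (fun j => u j ^ 2) (fun j => v j ^ 2) (fun j => w j ^ 2)
          (fun j => p j ^ 2)
    _ = _ := by ring

/-- Cauchy–Schwarz for the pairs `(u v, w p)`, then the `ℓ²` norm of a pointwise product is at most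
the product of the norms. -/
lemma abs_sum_four_le (u v w p : EuclideanSpace ℝ ι) :
    |∑ j, u j * v j * w j * p j| ≤ ‖u‖ * ‖v‖ * ‖w‖ * ‖p‖ := by
  apply abs_le_of_sq_le_sq _ (by positivity)
  have key : ∀ a b : EuclideanSpace ℝ ι, ∑ j, (a j * b j) ^ 2 ≤ ‖a‖ ^ 2 * ‖b‖ ^ 2 := fun a b => by
    rw [EuclideanSpace.norm_sq_eq, EuclideanSpace.norm_sq_eq, Finset.sum_mul]
    simp only [Real.norm_eq_abs, sq_abs, mul_pow]
    refine Finset.sum_le_sum fun j _ => ?_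
    gcongr
    exact Finset.single_le_sum (f := fun i => b i ^ 2) (fun i _ => sq_nonneg _) (Finset.mem_univ j)
  calc (∑ j, u j * v j * w j * p j) ^ 2 = (∑ j, (u j * v j) * (w j * p j)) ^ 2 := by
        simp only [mul_assoc]
    _ ≤ (∑ j, (u j * v j) ^ 2) * ∑ j, (w j * p j) ^ 2 := Finset.sum_mul_sq_le_sq_mul_sq _ _ _
    _ ≤ (‖u‖ ^ 2 * ‖v‖ ^ 2) * (‖w‖ ^ 2 * ‖p‖ ^ 2) :=
        mul_le_mul (key u v) (key w p) (by positivity) (by positivity)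
    _ = _ := by ring

/-- The quadrilinear form `α ∑ⱼ uⱼ vⱼ wⱼ pⱼ + β (⟨u, v⟩⟨w, p⟩ + ⟨u, w⟩⟨v, p⟩ + ⟨u, p⟩⟨v, w⟩)`. -/
def modelForm (α β : ℝ) (u v w p : EuclideanSpace ℝ ι) : ℝ :=
  α * ∑ j, u j * v j * w j * p j
    + β * (inner ℝ u v * inner ℝ w p + inner ℝ u w * inner ℝ v p + inner ℝ u p * inner ℝ v w)

lemma abs_modelForm_le {α β : ℝ} (hα : 0 ≤ α) (hβ : 0 ≤ β) (u v w p : EuclideanSpace ℝ ι) :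
    |modelForm α β u v w p| ≤ (α + 3 * β) * (‖u‖ * ‖v‖ * ‖w‖ * ‖p‖) := by
  have h1 : |α * ∑ j, u j * v j * w j * p j| ≤ α * (‖u‖ * ‖v‖ * ‖w‖ * ‖p‖) := by
    rw [abs_mul, abs_of_nonneg hα]
    gcongr
    exact abs_sum_four_le u v w p
  have key : ∀ a b c d : EuclideanSpace ℝ ι, |(inner ℝ a b * inner ℝ c d : ℝ)|
      ≤ (‖a‖ * ‖b‖) * (‖c‖ * ‖d‖) := fun a b c d => by
    rw [abs_mul]
    gcongr <;> exact abs_real_inner_le_norm _ _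
  have h2 : |β * (inner ℝ u v * inner ℝ w p + inner ℝ u w * inner ℝ v p
      + inner ℝ u p * inner ℝ v w)| ≤ β * (3 * (‖u‖ * ‖v‖ * ‖w‖ * ‖p‖)) := by
    rw [abs_mul, abs_of_nonneg hβ]
    gcongr
    refine (abs_add_three _ _ _).trans ?_
    have k1 := key u v w p
    have k2 := key u w v p
    have k3 := key u p v w
    nlinarith
  refine (abs_add_le _ _).trans ?_
  linarith

lemma modelForm_sub_eq (α β : ℝ) (u v w p u' v' w' p' : EuclideanSpace ℝ ι) :
    modelForm α β u' v' w' p' - modelForm α β u v w p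
      = modelForm α β (u' - u) v' w' p' + modelForm α β u (v' - v) w' p'
        + modelForm α β u v (w' - w) p' + modelForm α β u v w (p' - p) := by
  have h1 : ∑ j, u' j * v' j * w' j * p' j - ∑ j, u j * v j * w j * p j
      = ∑ j, (u' - u) j * v' j * w' j * p' j + ∑ j, u j * (v' - v) j * w' j * p' j
        + ∑ j, u j * v j * (w' - w) j * p' j + ∑ j, u j * v j * w j * (p' - p) j := by
    rw [← Finset.sum_sub_distrib, ← Finset.sum_add_distrib, ← Finset.sum_add_distrib,
      ← Finset.sum_add_distrib]
    refine Finset.sum_congr rfl fun j _ => ?_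
    simp only [PiLp.sub_apply]
    ring
  simp only [modelForm, inner_sub_left, inner_sub_right]
  linear_combination α * h1

/-- The effect on a `modelForm` of a near-isometric perturbation of its arguments. -/
lemma abs_modelForm_sub_le {α β η : ℝ} (hα : 0 ≤ α) (hβ : 0 ≤ β) (hη0 : 0 ≤ η) (hη : η ≤ 1 / 10)
    {u v w p u' v' w' p' : EuclideanSpace ℝ ι} (hu : ‖u' - u‖ ≤ η * ‖u‖) (hv : ‖v' - v‖ ≤ η * ‖v‖)
    (hw : ‖w' - w‖ ≤ η * ‖w‖) (hp : ‖p' - p‖ ≤ η * ‖p‖) :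
    |modelForm α β u' v' w' p' - modelForm α β u v w p|
      ≤ 5 * η * (α + 3 * β) * (‖u‖ * ‖v‖ * ‖w‖ * ‖p‖) := by
  have key : ∀ a a' : EuclideanSpace ℝ ι, ‖a' - a‖ ≤ η * ‖a‖ → ‖a'‖ ≤ (11 / 10) * ‖a‖ := by
    intro a a' h
    have h1 : ‖a'‖ ≤ ‖a' - a‖ + ‖a‖ := by simpa using norm_add_le (a' - a) a
    nlinarith [norm_nonneg a]
  have hv' := key _ _ hv
  have hw' := key _ _ hw
  have hp' := key _ _ hp
  rw [modelForm_sub_eq]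
  have hκ : 0 ≤ α + 3 * β := by positivity
  have h1 : |modelForm α β (u' - u) v' w' p'| ≤ (α + 3 * β) *
      ((η * ‖u‖) * (11 / 10 * ‖v‖) * (11 / 10 * ‖w‖) * (11 / 10 * ‖p‖)) :=
    (abs_modelForm_le hα hβ _ _ _ _).trans (by gcongr)
  have h2 : |modelForm α β u (v' - v) w' p'| ≤ (α + 3 * β) *
      (‖u‖ * (η * ‖v‖) * (11 / 10 * ‖w‖) * (11 / 10 * ‖p‖)) :=
    (abs_modelForm_le hα hβ _ _ _ _).trans (by gcongr)
  have h3 : |modelForm α β u v (w' - w) p'| ≤ (α + 3 * β) *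
      (‖u‖ * ‖v‖ * (η * ‖w‖) * (11 / 10 * ‖p‖)) :=
    (abs_modelForm_le hα hβ _ _ _ _).trans (by gcongr)
  have h4 : |modelForm α β u v w (p' - p)| ≤ (α + 3 * β) *
      (‖u‖ * ‖v‖ * ‖w‖ * (η * ‖p‖)) :=
    (abs_modelForm_le hα hβ _ _ _ _).trans (by gcongr)
  have h5 : 0 ≤ (α + 3 * β) * η * (‖u‖ * ‖v‖ * ‖w‖ * ‖p‖) := by positivity
  refine (abs_add_le _ _).trans ?_
  refine (add_le_add_left (abs_add_three _ _ _) _).trans ?_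
  linarith

variable [DecidableEq ι]

/-- The tensor of a `modelForm`. -/
def modelTensor (α β : ℝ) (q : ι × ι × ι × ι) : ℝ :=
  α * (if q.1 = q.2.1 ∧ q.1 = q.2.2.1 ∧ q.1 = q.2.2.2 then 1 else 0)
    + β * ((if q.1 = q.2.1 ∧ q.2.2.1 = q.2.2.2 then 1 else 0)
      + (if q.1 = q.2.2.1 ∧ q.2.1 = q.2.2.2 then 1 else 0)
      + (if q.1 = q.2.2.2 ∧ q.2.1 = q.2.2.1 then 1 else 0))

lemma tensorForm_modelTensor (α β : ℝ) (u v w p : EuclideanSpace ℝ ι) :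
    tensorForm (modelTensor α β) u v w p = modelForm α β u v w p := by
  have h0 : ∑ q : ι × ι × ι × ι, (if q.1 = q.2.1 ∧ q.1 = q.2.2.1 ∧ q.1 = q.2.2.2 then (1 : ℝ) else 0)
      * (u q.1 * v q.2.1 * w q.2.2.1 * p q.2.2.2) = ∑ j, u j * v j * w j * p j := by
    simp [Fintype.sum_prod_type, ite_and]
  have h1 : ∑ q : ι × ι × ι × ι, (if q.1 = q.2.1 ∧ q.2.2.1 = q.2.2.2 then (1 : ℝ) else 0)
      * (u q.1 * v q.2.1 * w q.2.2.1 * p q.2.2.2) = inner ℝ u v * inner ℝ w p := by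
    simp only [Fintype.sum_prod_type, ite_and, PiLp.inner_apply, RCLike.inner_apply,
      RCLike.conj_to_real, Finset.sum_mul_sum]
    simp
    exact Finset.sum_congr rfl fun i _ => Finset.sum_congr rfl fun j _ => by ring
  have h2 : ∑ q : ι × ι × ι × ι, (if q.1 = q.2.2.1 ∧ q.2.1 = q.2.2.2 then (1 : ℝ) else 0)
      * (u q.1 * v q.2.1 * w q.2.2.1 * p q.2.2.2) = inner ℝ u w * inner ℝ v p := by
    simp only [Fintype.sum_prod_type, ite_and, PiLp.inner_apply, RCLike.inner_apply,
      RCLike.conj_to_real, Finset.sum_mul_sum]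
    simp
    exact Finset.sum_congr rfl fun i _ => Finset.sum_congr rfl fun j _ => by ring
  have h3 : ∑ q : ι × ι × ι × ι, (if q.1 = q.2.2.2 ∧ q.2.1 = q.2.2.1 then (1 : ℝ) else 0)
      * (u q.1 * v q.2.1 * w q.2.2.1 * p q.2.2.2) = inner ℝ u p * inner ℝ v w := by
    simp only [Fintype.sum_prod_type, ite_and, PiLp.inner_apply, RCLike.inner_apply,
      RCLike.conj_to_real, Finset.sum_mul_sum]
    simp
    exact Finset.sum_congr rfl fun i _ => Finset.sum_congr rfl fun j _ => by ring
  rw [modelForm, ← h0, ← h1, ← h2, ← h3, tensorForm]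
  simp only [Finset.mul_sum, ← Finset.sum_add_distrib]
  refine Finset.sum_congr rfl fun q _ => ?_
  rw [modelTensor]
  ring

end Tensor

/-! ### The objective is close to the model in the rotated basis. -/

section NearModel

variable {n : ℕ} [NeZero n] {N : ℕ}

lemma norm_toEuclideanCLM_le {A : Matrix (ZMod n) (ZMod n) ℝ} {δ : ℝ} (hδ : 0 ≤ δ)
    (hA : ∑ q : ZMod n × ZMod n, A q.1 q.2 ^ 2 ≤ δ ^ 2) (v : Sig n) :
    ‖Matrix.toEuclideanCLM (𝕜 := ℝ) A v‖ ≤ δ * ‖v‖ := by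
  apply le_of_sq_le_sq _ (by positivity)
  have h1 : ∀ j, (Matrix.toEuclideanCLM (𝕜 := ℝ) A v) j ^ 2 ≤ (∑ k, A j k ^ 2) * ‖v‖ ^ 2 := by
    intro j
    rw [EuclideanSpace.norm_sq_eq]
    simp only [Real.norm_eq_abs, sq_abs]
    exact Finset.sum_mul_sq_le_sq_mul_sq Finset.univ (fun k => A j k) (fun k => v k)
  calc ‖Matrix.toEuclideanCLM (𝕜 := ℝ) A v‖ ^ 2
      = ∑ j, (Matrix.toEuclideanCLM (𝕜 := ℝ) A v) j ^ 2 := by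
        rw [EuclideanSpace.norm_sq_eq]; simp only [Real.norm_eq_abs, sq_abs]
    _ ≤ ∑ j, (∑ k, A j k ^ 2) * ‖v‖ ^ 2 := Finset.sum_le_sum fun j _ => h1 j
    _ = (∑ q : ZMod n × ZMod n, A q.1 q.2 ^ 2) * ‖v‖ ^ 2 := by
        rw [Fintype.sum_prod_type, Finset.sum_mul]
    _ ≤ δ ^ 2 * ‖v‖ ^ 2 := by gcongr
    _ = (δ * ‖v‖) ^ 2 := by ring

lemma posDef_of_norm_sub_le {M : Matrix (ZMod n) (ZMod n) ℝ} (hM : Mᵀ = M) {δ : ℝ} (hδ : δ < 1)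
    (h : ∀ v : Sig n, ‖Matrix.toEuclideanCLM (𝕜 := ℝ) M v - v‖ ≤ δ * ‖v‖) : M.PosDef := by
  refine Matrix.PosDef.of_dotProduct_mulVec_pos hM fun u hu => ?_
  set v : Sig n := WithLp.toLp 2 u with hv
  have hv0 : 0 < ‖v‖ := by
    rw [norm_pos_iff]
    intro h0
    exact hu (by simpa [hv] using congrArg WithLp.ofLp h0)
  have h1 : star u ⬝ᵥ (M *ᵥ u) = inner ℝ v (Matrix.toEuclideanCLM (𝕜 := ℝ) M v) := by
    rw [PiLp.inner_apply]
    simp only [dotProduct, RCLike.inner_apply, RCLike.conj_to_real, star_trivial]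
    exact Finset.sum_congr rfl fun i _ => mul_comm _ _
  have h2 : inner ℝ v (Matrix.toEuclideanCLM (𝕜 := ℝ) M v)
      = inner ℝ v (Matrix.toEuclideanCLM (𝕜 := ℝ) M v - v) + ‖v‖ ^ 2 := by
    rw [inner_sub_right, real_inner_self_eq_norm_sq]; ring
  rw [h1, h2]
  have h3 := (abs_le.1 (abs_real_inner_le_norm v (Matrix.toEuclideanCLM (𝕜 := ℝ) M v - v))).1
  have h4 : ‖v‖ * ‖Matrix.toEuclideanCLM (𝕜 := ℝ) M v - v‖ ≤ ‖v‖ * (δ * ‖v‖) := by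
    gcongr
    exact h v
  nlinarith [mul_pos hv0 hv0]

/-- The columns of the rotation form an orthonormal basis. -/
lemma exists_basis_rotation {f : Sig n} (hf : IsUnit (circ f)) :
    ∃ b : OrthonormalBasis (ZMod n) ℝ (Sig n),
      (∀ j v, inner ℝ (b j) v = Matrix.toEuclideanCLM (𝕜 := ℝ) (rotation f)ᵀ v j) ∧
      (∀ v, ‖Matrix.toEuclideanCLM (𝕜 := ℝ) (rotation f)ᵀ v‖ = ‖v‖) ∧
      (∀ v, Matrix.toEuclideanCLM (𝕜 := ℝ) (rotation f)
        (Matrix.toEuclideanCLM (𝕜 := ℝ) (rotation f)ᵀ v) = v) := by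
  set Q := Matrix.toEuclideanCLM (𝕜 := ℝ) (rotation f) with hQ
  have hadj : ContinuousLinearMap.adjoint Q = Matrix.toEuclideanCLM (𝕜 := ℝ) (rotation f)ᵀ := by
    rw [hQ, ← ContinuousLinearMap.star_eq_adjoint, ← map_star]
    rfl
  rw [← hadj]
  have h1 : ContinuousLinearMap.adjoint Q * Q = 1 := by
    rw [hadj, hQ, ← map_mul, transpose_rotation_mul hf, map_one]
  have h2 : Q * ContinuousLinearMap.adjoint Q = 1 := by
    rw [hadj, hQ, ← map_mul, mul_eq_one_comm.1 (transpose_rotation_mul hf), map_one]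
  have h1' : ∀ v, ContinuousLinearMap.adjoint Q (Q v) = v := fun v =>
    congrArg (fun T : Sig n →L[ℝ] Sig n => T v) h1
  have h2' : ∀ v, Q (ContinuousLinearMap.adjoint Q v) = v := fun v =>
    congrArg (fun T : Sig n →L[ℝ] Sig n => T v) h2
  have hnorm : ∀ v, ‖Q v‖ = ‖v‖ := fun v => by
    have : ‖Q v‖ ^ 2 = ‖v‖ ^ 2 := by
      rw [← real_inner_self_eq_norm_sq, ← ContinuousLinearMap.adjoint_inner_left, h1',
        real_inner_self_eq_norm_sq]
    exact (pow_left_inj₀ (norm_nonneg _) (norm_nonneg _) two_ne_zero).1 this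
  let e : Sig n →ₗᵢ[ℝ] Sig n := ⟨Q.toLinearMap, hnorm⟩
  refine ⟨(EuclideanSpace.basisFun (ZMod n) ℝ).map (e.toLinearIsometryEquiv rfl), fun j v => ?_,
    fun v => ?_, h2'⟩
  · have : ((EuclideanSpace.basisFun (ZMod n) ℝ).map (e.toLinearIsometryEquiv rfl)) j
        = Q (EuclideanSpace.single j 1) := by
      simp [e]
    rw [this, ← ContinuousLinearMap.adjoint_inner_right]
    simp [EuclideanSpace.inner_single_left]
  · rw [← hnorm, h2']

/-- The empirical fourth moment tensor of the rows of the circulant matrices. -/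
def momentTensor (x : Fin N → Sig n) (q : ZMod n × ZMod n × ZMod n × ZMod n) : ℝ :=
  (1 / (N : ℝ)) * ∑ i, ∑ s, circ (x i) s q.1 * circ (x i) s q.2.1 * circ (x i) s q.2.2.1
    * circ (x i) s q.2.2.2

/-- The rows of the matrices `C_{xᵢ} W`. -/
def channelRow (x : Fin N → Sig n) (W : Matrix (ZMod n) (ZMod n) ℝ) (p : Fin N × ZMod n) : Sig n :=
  WithLp.toLp 2 fun j => (circ (x p.1) * W) p.2 j

lemma inner_channelRow (x : Fin N → Sig n) (W : Matrix (ZMod n) (ZMod n) ℝ) (p : Fin N × ZMod n)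
    (h : Sig n) : inner ℝ (channelRow x W p) h
      = ∑ j, circ (x p.1) p.2 j * Matrix.toEuclideanCLM (𝕜 := ℝ) W h j := by
  have h1 : inner ℝ (channelRow x W p) h = ((circ (x p.1) * W) *ᵥ h.ofLp) p.2 := by
    rw [PiLp.inner_apply]
    simp only [RCLike.inner_apply, RCLike.conj_to_real, Matrix.mulVec, dotProduct, channelRow]
    exact Finset.sum_congr rfl fun i _ => mul_comm _ _
  rw [h1, ← Matrix.mulVec_mulVec]
  rfl

/-- Moves the preconditioned matrix from the rows to the arguments, so that the random tensor
depends on the channels alone. -/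
lemma inner_cubicSum_channelRow (x : Fin N → Sig n) (W : Matrix (ZMod n) (ZMod n) ℝ)
    (u v w p : Sig n) : inner ℝ (cubicSum (1 / (N : ℝ)) (channelRow x W) u v w) p
      = tensorForm (momentTensor x) (Matrix.toEuclideanCLM (𝕜 := ℝ) W u)
        (Matrix.toEuclideanCLM (𝕜 := ℝ) W v) (Matrix.toEuclideanCLM (𝕜 := ℝ) W w)
        (Matrix.toEuclideanCLM (𝕜 := ℝ) W p) := by
  rw [inner_cubicSum]
  simp only [inner_channelRow, ← sum_prod_four, tensorForm, momentTensor]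
  rw [Fintype.sum_prod_type]
  simp only [mul_assoc, Finset.sum_mul, ← Finset.mul_sum]
  congr 1
  conv_rhs => rw [Finset.sum_comm]
  refine Finset.sum_congr rfl fun i _ => ?_
  conv_rhs => rw [Finset.sum_comm]
  refine Finset.sum_congr rfl fun s _ => Finset.sum_congr rfl fun q _ => by ring

lemma objective_conv_eq (θ : ℝ) (x : Fin N → Sig n) (f : Sig n) :
    objective θ (fun i => conv (x i) f) = fun h => -(1 / 4) * (1 / (N : ℝ) *
      ∑ p, inner ℝ (channelRow x (circ f * precond θ (fun i => conv (x i) f)) p) h ^ 4) := by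
  ext h
  have h1 : ∀ i s, (circ (conv (x i) f) *ᵥ (precond θ (fun i => conv (x i) f) *ᵥ fun j => h j)) s
      = inner ℝ (channelRow x (circ f * precond θ (fun i => conv (x i) f)) (i, s)) h := by
    intro i s
    rw [inner_channelRow, circ_conv, Matrix.mulVec_mulVec, Matrix.mul_assoc, ← Matrix.mulVec_mulVec]
    rfl
  simp only [objective, phi, h1]
  rw [Fintype.sum_prod_type, ← Finset.mul_sum]
  ring

lemma measurable_objective_conv (θ : ℝ) (x : Fin N → Sig n) (f : Sig n) :
    Measurable (objective θ (fun i => conv (x i) f)) := by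
  rw [objective_conv_eq]
  fun_prop

/-- If the empirical second and fourth moments of the channels are close to their means, the
objective is close to the `ℓ⁴` objective in the basis given by the rotation. -/
theorem exists_near_model {θ a τ δ : ℝ} {x : Fin N → Sig n} {f : Sig n} (hf : IsUnit (circ f))
    (hθ0 : 0 ≤ θ) (hθ : θ ≤ 1 / 3) (ha : a = θ * (1 - 3 * θ)) (hτ0 : 0 ≤ τ) (hδ0 : 0 ≤ δ)
    (hδ : δ ≤ 1 / 20)
    (hT : ∑ q, (momentTensor x q - modelTensor (n * a) (n * θ ^ 2) q) ^ 2 ≤ τ ^ 2)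
    (hM : ∑ q : ZMod n × ZMod n, (gram θ x - 1) q.1 q.2 ^ 2 ≤ δ ^ 2)
    (b : OrthonormalBasis (ZMod n) ℝ (Sig n))
    (hb : ∀ j v, inner ℝ (b j) v = Matrix.toEuclideanCLM (𝕜 := ℝ) (rotation f)ᵀ v j)
    (hbn : ∀ v, ‖Matrix.toEuclideanCLM (𝕜 := ℝ) (rotation f)ᵀ v‖ = ‖v‖)
    (hε : 2 * τ + 4 * n * δ ≤ 0.01 * n * a) :
    ∃ S : Sig n → Sig n → Sig n → Sig n, SymmQuartic S (1.01 * n * a) ∧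
      AgreesOnSphere (objective θ (fun i => conv (x i) f)) S (-(3 / 4) * (n * θ ^ 2)) ∧
      ∀ u v w, ‖S u v w - diagCubic b (n * a) u v w‖
        ≤ (2 * τ + 4 * n * δ) * ‖u‖ * ‖v‖ * ‖w‖ := by
  set W := circ f * precond θ (fun i => conv (x i) f) with hW
  set Q := Matrix.toEuclideanCLM (𝕜 := ℝ) (rotation f)ᵀ with hQ
  set w := Matrix.toEuclideanCLM (𝕜 := ℝ) W with hw
  have hn0 : (0 : ℝ) ≤ n := Nat.cast_nonneg n
  have ha0 : 0 ≤ a := by rw [ha]; exact mul_nonneg hθ0 (by linarith)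
  have hMv : ∀ v : Sig n, ‖Matrix.toEuclideanCLM (𝕜 := ℝ) (gram θ x) v - v‖ ≤ δ * ‖v‖ := fun v => by
    have := norm_toEuclideanCLM_le hδ0 hM v
    rwa [map_sub, map_one] at this
  have hMpd := posDef_of_norm_sub_le (transpose_gram θ x) (by linarith) hMv
  obtain ⟨X, hXp, hXM, hWX⟩ := exists_sqrt_inv_gram hf hMpd
  have hXv := norm_sqrt_inv_sub_le hXp hXM (by linarith) hMv
  have hwQ : ∀ v, ‖w v - Q v‖ ≤ 2 * δ * ‖Q v‖ := fun v => by
    have h1 : w v = Q (Matrix.toEuclideanCLM (𝕜 := ℝ) X v) := by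
      rw [hw, hW, hWX, map_mul]; rfl
    rw [h1, ← map_sub, hbn, hbn]
    exact hXv v
  have hwn : ∀ v, ‖w v‖ ≤ 11 / 10 * ‖v‖ := fun v => by
    have h1 : ‖w v‖ ≤ ‖w v - Q v‖ + ‖Q v‖ := by simpa using norm_add_le (w v - Q v) (Q v)
    have h2 := hwQ v
    rw [hbn] at h1 h2
    nlinarith [norm_nonneg v]
  have hQin : ∀ u v, inner ℝ (Q u) (Q v) = (inner ℝ u v : ℝ) := fun u v => by
    rw [PiLp.inner_apply, ← b.sum_inner_mul_inner u v]
    refine Finset.sum_congr rfl fun j _ => ?_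
    rw [real_inner_comm (b j), hb, hb]
    simp [mul_comm]
  set S : Sig n → Sig n → Sig n → Sig n := fun u v y =>
    cubicSum (1 / (N : ℝ)) (channelRow x W) u v y - (n * θ ^ 2) • symCubic u v y with hS
  have hmodel : ∀ u v y p, modelForm (n * a) (n * θ ^ 2) (Q u) (Q v) (Q y) (Q p)
      = inner ℝ (diagCubic b (n * a) u v y + (n * θ ^ 2) • symCubic u v y) p := fun u v y p => by
    rw [modelForm, inner_add_left, inner_diagCubic, inner_smul_left, inner_symCubic]
    simp only [hQin, hb, RCLike.conj_to_real]
  have hinner : ∀ u v y p, |(inner ℝ (S u v y - diagCubic b (n * a) u v y) p : ℝ)|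
      ≤ (2 * τ + 4 * n * δ) * ‖u‖ * ‖v‖ * ‖y‖ * ‖p‖ := fun u v y p => by
    -- Two errors: the deviation of the empirical tensor from its mean, and the deviation of `W`
    -- from the orthogonal `Q`. The isotropic part of the mean is cancelled by `symCubic`.
    have e1 : (inner ℝ (S u v y - diagCubic b (n * a) u v y) p : ℝ)
        = tensorForm (fun q => momentTensor x q - modelTensor (n * a) (n * θ ^ 2) q)
          (w u) (w v) (w y) (w p)
          + (modelForm (n * a) (n * θ ^ 2) (w u) (w v) (w y) (w p)
            - modelForm (n * a) (n * θ ^ 2) (Q u) (Q v) (Q y) (Q p)) := by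
      rw [hmodel, ← tensorForm_modelTensor, hS]
      simp only [inner_sub_left, inner_add_left, inner_cubicSum_channelRow]
      rw [← hw]
      simp only [tensorForm, sub_mul, Finset.sum_sub_distrib]
      ring
    have h1 := abs_tensorForm_le hτ0 hT (w u) (w v) (w y) (w p)
    have h2 := abs_modelForm_sub_le (α := n * a) (β := n * θ ^ 2) (η := 2 * δ) (by positivity)
      (by positivity) (by positivity) (by linarith) (hwQ u) (hwQ v) (hwQ y) (hwQ p)
    rw [hbn, hbn, hbn, hbn] at h2
    have h3 : τ * ‖w u‖ * ‖w v‖ * ‖w y‖ * ‖w p‖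
        ≤ τ * (11 / 10 * ‖u‖) * (11 / 10 * ‖v‖) * (11 / 10 * ‖y‖) * (11 / 10 * ‖p‖) := by
      gcongr <;> exact hwn _
    -- The numbers behind `2τ + 4nδ`: `1.1⁴ ≤ 2` for the first error and `10 n δ / 3 ≤ 4 n δ` for
    -- the second.
    have h4 : n * a + 3 * (n * θ ^ 2) ≤ n * (1 / 3) := by
      have : n * a + 3 * (n * θ ^ 2) = n * θ := by rw [ha]; ring
      rw [this]; gcongr
    have h5 : 5 * (2 * δ) * (n * a + 3 * (n * θ ^ 2)) * (‖u‖ * ‖v‖ * ‖y‖ * ‖p‖)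
        ≤ 5 * (2 * δ) * (n * (1 / 3)) * (‖u‖ * ‖v‖ * ‖y‖ * ‖p‖) := by gcongr
    have h6 : 0 ≤ τ * (‖u‖ * ‖v‖ * ‖y‖ * ‖p‖) := by positivity
    have h7 : 0 ≤ n * δ * (‖u‖ * ‖v‖ * ‖y‖ * ‖p‖) := by positivity
    rw [e1]
    refine (abs_add_le _ _).trans ?_
    linarith
  have hE : ∀ u v y, ‖S u v y - diagCubic b (n * a) u v y‖
      ≤ (2 * τ + 4 * n * δ) * ‖u‖ * ‖v‖ * ‖y‖ := fun u v y => by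
    -- Testing the quadrilinear bound against the vector itself gives the bound on its norm.
    have h1 := hinner u v y (S u v y - diagCubic b (n * a) u v y)
    rw [real_inner_self_eq_norm_sq, abs_of_nonneg (by positivity), sq] at h1
    rcases (norm_nonneg (S u v y - diagCubic b (n * a) u v y)).eq_or_lt with h0 | h0
    · rw [← h0]; positivity
    · exact le_of_mul_le_mul_right h1 h0
  refine ⟨S, symmQuartic_cubicSum_sub fun u v y => ?_, ?_, hE⟩
  · have h1 : ‖diagCubic b (n * a) u v y‖ ≤ (n * a) * ‖u‖ * ‖v‖ * ‖y‖ := by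
      set d := diagCubic b (n * a) u v y with hd
      have h2 : ‖d‖ * ‖d‖ ≤ (n * a) * ‖u‖ * ‖v‖ * ‖y‖ * ‖d‖ := by
        rw [← real_inner_self_eq_norm_mul_norm]
        conv_lhs => rw [hd, inner_diagCubic, ← hd]
        simp only [hb]
        have h3 := (abs_le.1 (abs_sum_four_le (Q u) (Q v) (Q y) (Q d))).2
        rw [hbn, hbn, hbn, hbn] at h3
        calc _ ≤ (n * a) * (‖u‖ * ‖v‖ * ‖y‖ * ‖d‖) := by gcongr
          _ = _ := by ring
      rcases (norm_nonneg d).eq_or_lt with h0 | h0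
      · rw [← h0]; positivity
      · exact le_of_mul_le_mul_right h2 h0
    have h2 : ‖S u v y‖ ≤ ‖S u v y - diagCubic b (n * a) u v y‖ + ‖diagCubic b (n * a) u v y‖ := by
      simpa using norm_add_le (S u v y - diagCubic b (n * a) u v y) (diagCubic b (n * a) u v y)
    have h3 : (2 * τ + 4 * n * δ) * ‖u‖ * ‖v‖ * ‖y‖ ≤ (0.01 * n * a) * ‖u‖ * ‖v‖ * ‖y‖ := by gcongr
    have h4 := hE u v y
    change ‖S u v y‖ ≤ _
    linarith
  · rw [objective_conv_eq]
    exact agreesOnSphere_neg_sum_pow_four _ _ _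

end NearModel

/-! ### Integrals of two-valued variables. -/

section TwoPoint

variable {Ω : Type*} [mΩ : MeasurableSpace Ω] {P : Measure Ω} [IsProbabilityMeasure P]

lemma ae_eq_or_eq {X : Ω → ℝ} (hX : Measurable X) {u v p : ℝ} (huv : u ≠ v) (hp0 : 0 ≤ p)
    (hp1 : p ≤ 1) (hu : P {ω | X ω = u} = ENNReal.ofReal p)
    (hv : P {ω | X ω = v} = ENNReal.ofReal (1 - p)) : ∀ᵐ ω ∂P, X ω = u ∨ X ω = v := by
  have hmu : MeasurableSet {ω | X ω = u} := hX (measurableSet_singleton u)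
  have hmv : MeasurableSet {ω | X ω = v} := hX (measurableSet_singleton v)
  have hd : Disjoint {ω | X ω = u} {ω | X ω = v} := by
    rw [Set.disjoint_left]
    intro ω h1 h2
    exact huv (h1.symm.trans h2)
  have h1 : P ({ω | X ω = u} ∪ {ω | X ω = v}) = 1 := by
    rw [measure_union hd hmv, hu, hv, ← ENNReal.ofReal_add hp0 (by linarith)]
    simp
  rw [← prob_compl_eq_zero_iff (hmu.union hmv)] at h1
  rw [ae_iff]
  convert h1 using 2
  ext ω
  simp

lemma integral_comp_of_two_point {X : Ω → ℝ} (hX : Measurable X) {u v p : ℝ} (huv : u ≠ v)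
    (hp0 : 0 ≤ p) (hp1 : p ≤ 1) (hu : P {ω | X ω = u} = ENNReal.ofReal p)
    (hv : P {ω | X ω = v} = ENNReal.ofReal (1 - p)) (g : ℝ → ℝ) :
    ∫ ω, g (X ω) ∂P = p * g u + (1 - p) * g v := by
  have hmu : MeasurableSet {ω | X ω = u} := hX (measurableSet_singleton u)
  have hmv : MeasurableSet {ω | X ω = v} := hX (measurableSet_singleton v)
  have h1 : (fun ω => g (X ω)) =ᵐ[P] fun ω => {ω | X ω = u}.indicator (fun _ => g u) ω
      + {ω | X ω = v}.indicator (fun _ => g v) ω := by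
    filter_upwards [ae_eq_or_eq hX huv hp0 hp1 hu hv] with ω hω
    rcases hω with h | h
    · simp [Set.indicator, h, huv]
    · simp [Set.indicator, h, huv.symm]
  rw [integral_congr_ae h1, integral_add ((integrable_const _).indicator hmu)
    ((integrable_const _).indicator hmv), integral_indicator_const _ hmu,
    integral_indicator_const _ hmv, measureReal_def, measureReal_def, hu, hv,
    ENNReal.toReal_ofReal hp0, ENNReal.toReal_ofReal (by linarith), smul_eq_mul, smul_eq_mul]

end TwoPoint

/-! ### Moments and independence of the channel entries. -/

namespace IsBernoulliRademacher

variable {n : ℕ} [NeZero n] {N : ℕ} {Ω : Type*} [mΩ : MeasurableSpace Ω] {P : Measure Ω}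
  [IsProbabilityMeasure P] {θ : ℝ} {x : Fin N → Ω → Sig n}

lemma measurable (hx : IsBernoulliRademacher P θ x) (i : Fin N) : Measurable (x i) := by
  obtain ⟨A, B, hA, hB, -, -, -, -, -, hAB⟩ := hx
  have : x i = fun ω => WithLp.toLp 2 fun j => A (i, j) ω * B (i, j) ω := by
    ext ω j; exact hAB i j ω
  rw [this]
  exact (MeasurableEquiv.toLp 2 _).measurable.comp
    (measurable_pi_lambda _ fun j => (hA _).mul (hB _))

lemma ae_mem (hx : IsBernoulliRademacher P θ x) (hθ0 : 0 ≤ θ) (hθ1 : θ ≤ 1) :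
    ∀ᵐ ω ∂P, ∀ i j, x i ω j = -1 ∨ x i ω j = 0 ∨ x i ω j = 1 := by
  obtain ⟨A, B, hA, hB, -, hA1, hA2, hB1, hB2, hAB⟩ := hx
  rw [ae_all_iff]; intro i
  rw [ae_all_iff]; intro j
  filter_upwards [ae_eq_or_eq (hA (i, j)) (u := 1) (v := -1) (p := 1 / 2) (by norm_num)
    (by norm_num) (by norm_num) (hA1 _) (by rw [hA2]; norm_num),
    ae_eq_or_eq (hB (i, j)) (by norm_num) hθ0 hθ1 (hB1 _) (hB2 _)]
    with ω h1 h2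
  rw [hAB]
  rcases h1 with h1 | h1 <;> rcases h2 with h2 | h2 <;> simp [h1, h2]

/-- The moment of order `e` of an entry. -/
def entryMoment (θ : ℝ) (e : ℕ) : ℝ := if e = 0 then 1 else if Even e then θ else 0

/-- Independence factors every monomial into moments of single entries: odd moments vanish by the
sign, and even positive ones equal `θ`. -/
lemma integral_prod_pow (hx : IsBernoulliRademacher P θ x) (hθ0 : 0 ≤ θ) (hθ1 : θ ≤ 1)
    (e : Fin N × ZMod n → ℕ) :
    ∫ ω, ∏ p, x p.1 ω p.2 ^ e p ∂P = ∏ p, entryMoment θ (e p) := by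
  obtain ⟨A, B, hA, hB, hind, hA1, hA2, hB1, hB2, hAB⟩ := hx
  have hm : ∀ σ, Measurable (Sum.elim A B σ) := by
    rintro (p | p)
    · exact hA p
    · exact hB p
  have h1 := hind.integral_fun_prod_comp (fun σ => (hm σ).aemeasurable)
    (f := fun (σ : (Fin N × ZMod n) ⊕ (Fin N × ZMod n)) (t : ℝ) => t ^ (Sum.elim e e σ))
    (fun σ => (measurable_id.pow_const _).aestronglyMeasurable)
  simp only [Fintype.prod_sum_type, Sum.elim_inl, Sum.elim_inr, ← Finset.prod_mul_distrib,
    ← mul_pow] at h1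
  simp only [hAB]
  rw [h1]
  refine Finset.prod_congr rfl fun p _ => ?_
  rw [integral_comp_of_two_point (hA p) (u := 1) (v := -1) (p := 1 / 2) (by norm_num) (by norm_num)
    (by norm_num) (hA1 p) (by rw [hA2]; norm_num) (fun t => t ^ e p),
    integral_comp_of_two_point (hB p) (by norm_num) hθ0 hθ1 (hB1 _) (hB2 _) (fun t => t ^ e p),
    entryMoment]
  rcases Nat.eq_zero_or_pos (e p) with h0 | h0
  · simp [h0]
  · rw [if_neg h0.ne', zero_pow h0.ne', one_pow]
    split_ifs with he
    · rw [he.neg_one_pow]; ring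
    · rw [(Nat.not_even_iff_odd.1 he).neg_one_pow]; ring

lemma entryMoment_zero : entryMoment θ 0 = 1 := by simp [entryMoment]
lemma entryMoment_one : entryMoment θ 1 = 0 := by simp [entryMoment]
lemma entryMoment_two : entryMoment θ 2 = θ := by simp [entryMoment]
lemma entryMoment_three : entryMoment θ 3 = 0 := by
  simp [entryMoment, show ¬ Even 3 by decide]
lemma entryMoment_four : entryMoment θ 4 = θ := by
  simp [entryMoment, show Even 4 by decide]

lemma prod_pow_single {ι : Type*} [Fintype ι] [DecidableEq ι] (y : ι → ℝ) (k : ι) :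
    ∏ p, y p ^ (if k = p then 1 else 0) = y k := by
  rw [Finset.prod_eq_single k]
  · simp
  · intro p _ hp; simp [hp.symm]
  · simp

/-- The covariance of two entries. -/
lemma integral_mul (hx : IsBernoulliRademacher P θ x) (hθ0 : 0 ≤ θ) (hθ1 : θ ≤ 1)
    (p q : Fin N × ZMod n) :
    ∫ ω, x p.1 ω p.2 * x q.1 ω q.2 ∂P = if p = q then θ else 0 := by
  have h1 := hx.integral_prod_pow hθ0 hθ1
    fun k => (if p = k then 1 else 0) + (if q = k then 1 else 0)
  have h2 : ∀ ω, ∏ k, x k.1 ω k.2 ^ ((if p = k then 1 else 0) + (if q = k then 1 else 0))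
      = x p.1 ω p.2 * x q.1 ω q.2 := fun ω => by
    simp only [pow_add, Finset.prod_mul_distrib,
      prod_pow_single (fun k : Fin N × ZMod n => x k.1 ω k.2)]
  simp only [h2] at h1
  rw [h1]
  split_ifs with hpq
  · subst hpq
    rw [Finset.prod_eq_single p]
    · simp [entryMoment_two]
    · intro k _ hk; simp [hk.symm, entryMoment_zero]
    · simp
  · exact Finset.prod_eq_zero (Finset.mem_univ p) (by simp [Ne.symm hpq, entryMoment_one])

/-- The fourth moments of the entries. -/
lemma integral_mul_four (hx : IsBernoulliRademacher P θ x) (hθ0 : 0 ≤ θ) (hθ1 : θ ≤ 1)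
    (p q r s : Fin N × ZMod n) :
    ∫ ω, x p.1 ω p.2 * x q.1 ω q.2 * x r.1 ω r.2 * x s.1 ω s.2 ∂P
      = modelTensor (θ * (1 - 3 * θ)) (θ ^ 2) (p, q, r, s) := by
  have h1 := hx.integral_prod_pow hθ0 hθ1
    fun k => (if p = k then 1 else 0) + (if q = k then 1 else 0) + (if r = k then 1 else 0)
      + (if s = k then 1 else 0)
  have h2 : ∀ ω, ∏ k, x k.1 ω k.2 ^ ((if p = k then 1 else 0) + (if q = k then 1 else 0)
      + (if r = k then 1 else 0) + (if s = k then 1 else 0))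
      = x p.1 ω p.2 * x q.1 ω q.2 * x r.1 ω r.2 * x s.1 ω s.2 := fun ω => by
    simp only [pow_add, Finset.prod_mul_distrib,
      prod_pow_single (fun k : Fin N × ZMod n => x k.1 ω k.2)]
  simp only [h2] at h1
  rw [h1]
  clear h1 h2
  -- Only the coincidence pattern of the four indices matters: two distinct pairs give `θ²`, an
  -- index of odd multiplicity gives `0`, and four equal indices give `θ = θ(1-3θ) + 3θ²`, as three
  -- pairings coincide.
  have pair : ∀ p q : Fin N × ZMod n, p ≠ q → ∀ e : Fin N × ZMod n → ℕ, e p = 2 → e q = 2 →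
      (∀ k, k ≠ p → k ≠ q → e k = 0) → ∏ k, entryMoment θ (e k) = θ ^ 2 := by
    intro p q hpq e hp hq he
    rw [Finset.prod_eq_mul p q hpq]
    · rw [hp, hq, entryMoment_two]; ring
    · intro k _ hk; rw [he k hk.1 hk.2, entryMoment_zero]
    · simp
    · simp
  have single : ∀ e : Fin N × ZMod n → ℕ, ∀ k, (e k = 1 ∨ e k = 3) →
      ∏ k, entryMoment θ (e k) = 0 := by
    intro e k hk
    refine Finset.prod_eq_zero (Finset.mem_univ k) ?_
    rcases hk with hk | hk
    · rw [hk, entryMoment_one]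
    · rw [hk, entryMoment_three]
  by_cases hpq : p = q
  · subst hpq
    by_cases hrs : r = s
    · subst hrs
      by_cases hpr : p = r
      · subst hpr
        rw [Finset.prod_eq_single p]
        · simp [modelTensor, entryMoment_four]; ring
        · intro k _ hk; simp [hk.symm, entryMoment_zero]
        · simp
      · rw [pair p r hpr]
        · simp [modelTensor, hpr]
        · simp [Ne.symm hpr]
        · simp [hpr]
        · intro k h1 h2; simp [h1.symm, h2.symm]
    · by_cases hpr : p = r
      · subst hpr
        rw [single _ s (by simp [hrs])]
        simp [modelTensor, hrs]
      · rw [single _ r (by simp [hpr, Ne.symm hrs])]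
        simp [modelTensor, hpr, hrs]
  · by_cases hpr : p = r
    · subst hpr
      by_cases hqs : q = s
      · subst hqs
        rw [pair p q hpq]
        · simp [modelTensor, hpq]
        · simp [Ne.symm hpq]
        · simp [hpq]
        · intro k h1 h2; simp [h1.symm, h2.symm]
      · rw [single _ q (by simp [hpq, Ne.symm hqs])]
        simp [modelTensor, hpq, hqs, Ne.symm hpq]
    · by_cases hps : p = s
      · subst hps
        by_cases hqr : q = r
        · subst hqr
          rw [pair p q hpq]
          · simp [modelTensor, hpq]
          · simp [Ne.symm hpq]
          · simp [hpq]
          · intro k h1 h2; simp [h1.symm, h2.symm]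
        · rw [single _ q (by simp [hpq, Ne.symm hqr])]
          simp [modelTensor, hpq, hqr, hpr]
      · rw [single _ p (by simp [Ne.symm hpq, Ne.symm hpr, Ne.symm hps])]
        simp [modelTensor, hpq, hpr, hps]

/-- Different channels are independent. -/
lemma indepFun (hx : IsBernoulliRademacher P θ x) {i i' : Fin N} (hi : i ≠ i') :
    IndepFun (x i) (x i') P := by
  obtain ⟨A, B, hA, hB, hind, -, -, -, -, hAB⟩ := hx
  have hm : ∀ σ, Measurable (Sum.elim A B σ) := by
    rintro (p | p)
    · exact hA p
    · exact hB p
  -- The sign and support variables of channel `i`; distinct channels use disjoint blocks of one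
  -- independent family.
  let S : Fin N → Finset ((Fin N × ZMod n) ⊕ (Fin N × ZMod n)) := fun i =>
    Finset.univ.filter fun σ => (Sum.elim Prod.fst Prod.fst σ : Fin N) = i
  have hS : Disjoint (S i) (S i') := by
    rw [Finset.disjoint_left]
    intro σ h1 h2
    exact hi ((Finset.mem_filter.1 h1).2.symm.trans (Finset.mem_filter.1 h2).2)
  have hl : ∀ (i : Fin N) (j : ZMod n), Sum.inl (i, j) ∈ S i := fun i j => by simp [S]
  have hr : ∀ (i : Fin N) (j : ZMod n), Sum.inr (i, j) ∈ S i := fun i j => by simp [S]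
  let φ : ∀ i : Fin N, ((σ : S i) → ℝ) → Sig n := fun i v =>
    WithLp.toLp 2 fun j => v ⟨Sum.inl (i, j), hl i j⟩ * v ⟨Sum.inr (i, j), hr i j⟩
  have hφ : ∀ i, Measurable (φ i) := fun i =>
    (MeasurableEquiv.toLp 2 _).measurable.comp
      (measurable_pi_lambda _ fun j => (measurable_pi_apply _).mul (measurable_pi_apply _))
  have hxi : ∀ i, x i = φ i ∘ fun ω (σ : S i) => Sum.elim A B σ ω := fun i => by
    ext ω j; exact hAB i j ω
  rw [hxi i, hxi i']
  exact (hind.indepFun_finset (S i) (S i') hS hm).comp (hφ i) (hφ i')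

end IsBernoulliRademacher

/-! ### Chebyshev's inequality for families of empirical means. -/

section Concentration

variable {Ω : Type*} [mΩ : MeasurableSpace Ω] {P : Measure Ω} [IsProbabilityMeasure P]

lemma integral_sq_sub_le {N : ℕ} {Y : Fin N → Ω → ℝ} (hm : ∀ i, Measurable (Y i)) {B : ℝ}
    (hb : ∀ i, ∀ᵐ ω ∂P, |Y i ω| ≤ B) (hind : ∀ i j, i ≠ j → IndepFun (Y i) (Y j) P) (κ c : ℝ)
    (hc : ∫ ω, κ * ∑ i, Y i ω ∂P = c) :
    ∫ ω, (κ * ∑ i, Y i ω - c) ^ 2 ∂P ≤ κ ^ 2 * (N * B ^ 2) := by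
  have hmem : ∀ i, MemLp (Y i) 2 P := fun i => MemLp.of_bound (hm i).aestronglyMeasurable B (hb i)
  have h1 : Var[fun ω => κ * (∑ i, Y i) ω; P] = κ ^ 2 * ∑ i, Var[Y i; P] := by
    rw [variance_const_mul, IndepFun.variance_sum (fun i _ => hmem i)
      fun i _ j _ hij => hind i j hij]
  have h2 : ∀ i, Var[Y i; P] ≤ B ^ 2 := fun i => by
    refine (variance_le_expectation_sq (hm i).aestronglyMeasurable).trans ?_
    have h3 : ∫ ω, (Y i ^ 2) ω ∂P ≤ ∫ _, B ^ 2 ∂P := by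
      refine integral_mono_ae (hmem i).integrable_sq (integrable_const _) ?_
      filter_upwards [hb i] with ω hω
      exact sq_le_sq' (abs_le.1 hω).1 (abs_le.1 hω).2
    simpa using h3
  have h4 : Var[fun ω => κ * (∑ i, Y i) ω; P] = ∫ ω, (κ * ∑ i, Y i ω - c) ^ 2 ∂P := by
    rw [variance_eq_integral (by fun_prop)]
    simp only [Finset.sum_apply, hc]
  rw [← h4, h1]
  gcongr
  calc ∑ i, Var[Y i; P] ≤ ∑ _ : Fin N, B ^ 2 := Finset.sum_le_sum fun i _ => h2 i
    _ = N * B ^ 2 := by simp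

/-- Concentration of a family of empirical means of bounded independent variables. -/
lemma measureReal_sum_sq_gt_le {N : ℕ} {ι : Type*} [Fintype ι] {Y : ι → Fin N → Ω → ℝ}
    (hm : ∀ q i, Measurable (Y q i)) {B : ℝ} (hb : ∀ q i, ∀ᵐ ω ∂P, |Y q i ω| ≤ B)
    (hind : ∀ q i j, i ≠ j → IndepFun (Y q i) (Y q j) P) (κ : ℝ) (c : ι → ℝ)
    (hc : ∀ q, ∫ ω, κ * ∑ i, Y q i ω ∂P = c q) {τ : ℝ} (hτ : 0 < τ) :
    P.real {ω | ¬ ∑ q, (κ * ∑ i, Y q i ω - c q) ^ 2 ≤ τ ^ 2}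
      ≤ Fintype.card ι * (κ ^ 2 * (N * B ^ 2)) / τ ^ 2 := by
  have hint : ∀ q, Integrable (fun ω => (κ * ∑ i, Y q i ω - c q) ^ 2) P := fun q => by
    have h0 : MemLp (fun ω => ∑ i, Y q i ω) 2 P :=
      memLp_finsetSum Finset.univ fun i _ =>
        MemLp.of_bound (hm q i).aestronglyMeasurable B (hb q i)
    have h1 : MemLp (fun ω => κ * ∑ i, Y q i ω - c q) 2 P :=
      (h0.const_mul κ).sub (memLp_const (c q))
    exact h1.integrable_sq
  rw [le_div_iff₀ (by positivity), mul_comm]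
  calc τ ^ 2 * P.real {ω | ¬ ∑ q, (κ * ∑ i, Y q i ω - c q) ^ 2 ≤ τ ^ 2}
      ≤ τ ^ 2 * P.real {ω | τ ^ 2 ≤ ∑ q, (κ * ∑ i, Y q i ω - c q) ^ 2} := by
        refine mul_le_mul_of_nonneg_left (measureReal_mono ?_) (sq_nonneg τ)
        exact fun ω hω => (not_le.1 hω).le
    -- Markov's inequality for the total squared deviation controls all entries at once; its mean is
    -- a sum of variances.
    _ ≤ ∫ ω, ∑ q, (κ * ∑ i, Y q i ω - c q) ^ 2 ∂P := mul_meas_ge_le_integral_of_nonneg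
        (Filter.Eventually.of_forall fun ω => Finset.sum_nonneg fun q _ => sq_nonneg _)
        (integrable_finsetSum _ fun q _ => hint q) _
    _ = ∑ q, ∫ ω, (κ * ∑ i, Y q i ω - c q) ^ 2 ∂P := integral_finsetSum _ fun q _ => hint q
    _ ≤ ∑ _ : ι, κ ^ 2 * (N * B ^ 2) := Finset.sum_le_sum fun q _ =>
        integral_sq_sub_le (hm q) (hb q) (hind q) κ (c q) (hc q)
    _ = Fintype.card ι * (κ ^ 2 * (N * B ^ 2)) := by simp

end Concentration

/-! ### Moment tensors of a single circulant matrix. -/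

section ChannelMoments

variable {n : ℕ} [NeZero n]

/-- The fourth moment tensor of the rows of a circulant matrix. -/
def rowTensor (q : ZMod n × ZMod n × ZMod n × ZMod n) (v : Sig n) : ℝ :=
  ∑ s, circ v s q.1 * circ v s q.2.1 * circ v s q.2.2.1 * circ v s q.2.2.2

/-- The entries of `C_vᵀ C_v`. -/
def rowGram (q : ZMod n × ZMod n) (v : Sig n) : ℝ := ∑ s, circ v s q.1 * circ v s q.2

lemma measurable_rowTensor (q : ZMod n × ZMod n × ZMod n × ZMod n) :
    Measurable (rowTensor q) := by
  unfold rowTensor circ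
  simp only [Matrix.circulant_apply]
  fun_prop

lemma measurable_rowGram (q : ZMod n × ZMod n) : Measurable (rowGram q) := by
  unfold rowGram circ
  simp only [Matrix.circulant_apply]
  fun_prop

lemma abs_rowTensor_le (q : ZMod n × ZMod n × ZMod n × ZMod n) {v : Sig n}
    (hv : ∀ j, |v j| ≤ 1) : |rowTensor q v| ≤ n := by
  refine (Finset.abs_sum_le_sum_abs _ _).trans ?_
  calc ∑ s, |circ v s q.1 * circ v s q.2.1 * circ v s q.2.2.1 * circ v s q.2.2.2|
      ≤ ∑ _ : ZMod n, (1 : ℝ) * 1 * 1 * 1 := by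
        refine Finset.sum_le_sum fun s _ => ?_
        simp only [abs_mul]
        gcongr <;> exact hv _
    _ = n := by simp [ZMod.card]

lemma abs_rowGram_le (q : ZMod n × ZMod n) {v : Sig n} (hv : ∀ j, |v j| ≤ 1) :
    |rowGram q v| ≤ n := by
  refine (Finset.abs_sum_le_sum_abs _ _).trans ?_
  calc ∑ s, |circ v s q.1 * circ v s q.2| ≤ ∑ _ : ZMod n, (1 : ℝ) * 1 := by
        refine Finset.sum_le_sum fun s _ => ?_
        simp only [abs_mul]
        gcongr <;> exact hv _
    _ = n := by simp [ZMod.card]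

lemma momentTensor_eq {N : ℕ} (x : Fin N → Sig n) (q : ZMod n × ZMod n × ZMod n × ZMod n) :
    momentTensor x q = (1 / (N : ℝ)) * ∑ i, rowTensor q (x i) := rfl

lemma gram_apply {N : ℕ} (θ : ℝ) (x : Fin N → Sig n) (q : ZMod n × ZMod n) :
    gram θ x q.1 q.2 = (1 / (θ * n * N)) * ∑ i, rowGram q (x i) := by
  simp [gram, rowGram, Matrix.sum_apply, Matrix.mul_apply]

end ChannelMoments

/-! ### Means and concentration of the empirical moments. -/

namespace IsBernoulliRademacher

variable {n : ℕ} [NeZero n] {N : ℕ} {Ω : Type*} [mΩ : MeasurableSpace Ω] {P : Measure Ω}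
  [IsProbabilityMeasure P] {θ : ℝ} {x : Fin N → Ω → Sig n}

lemma ae_abs_le (hx : IsBernoulliRademacher P θ x) (hθ0 : 0 ≤ θ) (hθ1 : θ ≤ 1) (i : Fin N) :
    ∀ᵐ ω ∂P, ∀ j, |x i ω j| ≤ 1 := by
  filter_upwards [hx.ae_mem hθ0 hθ1] with ω hω j
  rcases hω i j with h | h | h <;> simp [h]

lemma measurable_apply (hx : IsBernoulliRademacher P θ x) (i : Fin N) (j : ZMod n) :
    Measurable fun ω => x i ω j := by
  have := hx.measurable i
  fun_prop

lemma integral_rowTensor (hx : IsBernoulliRademacher P θ x) (hθ0 : 0 ≤ θ) (hθ1 : θ ≤ 1)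
    (i : Fin N) (q : ZMod n × ZMod n × ZMod n × ZMod n) :
    ∫ ω, rowTensor q (x i ω) ∂P
      = modelTensor (n * (θ * (1 - 3 * θ))) (n * θ ^ 2) q := by
  have h1 : ∀ j k l m : ZMod n, Integrable (fun ω => x i ω j * x i ω k * x i ω l * x i ω m) P := by
    intro j k l m
    have hj := hx.measurable_apply i
    refine Integrable.of_bound
      ((((hj j).mul (hj k)).mul (hj l)).mul (hj m)).aestronglyMeasurable 1 ?_
    filter_upwards [hx.ae_abs_le hθ0 hθ1 i] with ω hω
    rw [Real.norm_eq_abs]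
    simp only [abs_mul]
    calc _ ≤ (1 : ℝ) * 1 * 1 * 1 := by gcongr <;> exact hω _
      _ = 1 := by norm_num
  -- The map `j ↦ s - j` preserves the coincidence pattern of the indices, so all `n` rows
  -- contribute the same mean.
  have h2 : ∀ s : ZMod n, modelTensor (θ * (1 - 3 * θ)) (θ ^ 2)
      ((i, s - q.1), (i, s - q.2.1), (i, s - q.2.2.1), (i, s - q.2.2.2))
      = modelTensor (θ * (1 - 3 * θ)) (θ ^ 2) q := fun s => by
    simp [modelTensor]
  unfold rowTensor circ
  simp only [Matrix.circulant_apply]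
  rw [integral_finsetSum _ fun s _ => h1 (s - q.1) (s - q.2.1) (s - q.2.2.1) (s - q.2.2.2)]
  have h3 : ∀ s : ZMod n, ∫ ω, x i ω (s - q.1) * x i ω (s - q.2.1) * x i ω (s - q.2.2.1)
      * x i ω (s - q.2.2.2) ∂P = modelTensor (θ * (1 - 3 * θ)) (θ ^ 2) q := fun s => by
    rw [← h2 s]
    exact hx.integral_mul_four hθ0 hθ1 (i, s - q.1) (i, s - q.2.1) (i, s - q.2.2.1) (i, s - q.2.2.2)
  simp only [h3, Finset.sum_const, Finset.card_univ, ZMod.card, nsmul_eq_mul, modelTensor]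
  ring

lemma integral_rowGram (hx : IsBernoulliRademacher P θ x) (hθ0 : 0 ≤ θ) (hθ1 : θ ≤ 1)
    (i : Fin N) (q : ZMod n × ZMod n) :
    ∫ ω, rowGram q (x i ω) ∂P = n * θ * (1 : Matrix (ZMod n) (ZMod n) ℝ) q.1 q.2 := by
  have h1 : ∀ j k : ZMod n, Integrable (fun ω => x i ω j * x i ω k) P := by
    intro j k
    have hj := hx.measurable_apply i
    refine Integrable.of_bound ((hj j).mul (hj k)).aestronglyMeasurable 1 ?_
    filter_upwards [hx.ae_abs_le hθ0 hθ1 i] with ω hω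
    rw [Real.norm_eq_abs, abs_mul]
    calc _ ≤ (1 : ℝ) * 1 := by gcongr <;> exact hω _
      _ = 1 := by norm_num
  unfold rowGram circ
  simp only [Matrix.circulant_apply]
  rw [integral_finsetSum _ fun s _ => h1 (s - q.1) (s - q.2)]
  have h3 : ∀ s : ZMod n, ∫ ω, x i ω (s - q.1) * x i ω (s - q.2) ∂P
      = θ * (1 : Matrix (ZMod n) (ZMod n) ℝ) q.1 q.2 := fun s => by
    have := hx.integral_mul hθ0 hθ1 (i, s - q.1) (i, s - q.2)
    simp only at this
    rw [this, Matrix.one_apply]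
    simp
  simp only [h3, Finset.sum_const, Finset.card_univ, ZMod.card, nsmul_eq_mul]
  ring

lemma integrable_rowTensor (hx : IsBernoulliRademacher P θ x) (hθ0 : 0 ≤ θ) (hθ1 : θ ≤ 1)
    (i : Fin N) (q : ZMod n × ZMod n × ZMod n × ZMod n) :
    Integrable (fun ω => rowTensor q (x i ω)) P := by
  refine Integrable.of_bound
    ((measurable_rowTensor q).comp (hx.measurable i)).aestronglyMeasurable n ?_
  filter_upwards [hx.ae_abs_le hθ0 hθ1 i] with ω hω using abs_rowTensor_le q hω

lemma integrable_rowGram (hx : IsBernoulliRademacher P θ x) (hθ0 : 0 ≤ θ) (hθ1 : θ ≤ 1)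
    (i : Fin N) (q : ZMod n × ZMod n) :
    Integrable (fun ω => rowGram q (x i ω)) P := by
  refine Integrable.of_bound
    ((measurable_rowGram q).comp (hx.measurable i)).aestronglyMeasurable n ?_
  filter_upwards [hx.ae_abs_le hθ0 hθ1 i] with ω hω using abs_rowGram_le q hω

lemma integral_momentTensor (hx : IsBernoulliRademacher P θ x) (hθ0 : 0 ≤ θ) (hθ1 : θ ≤ 1)
    (hN : 0 < N) (q : ZMod n × ZMod n × ZMod n × ZMod n) :
    ∫ ω, momentTensor (fun i => x i ω) q ∂P
      = modelTensor (n * (θ * (1 - 3 * θ))) (n * θ ^ 2) q := by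
  have hN' : (N : ℝ) ≠ 0 := by positivity
  simp only [momentTensor_eq]
  rw [integral_const_mul, integral_finsetSum _ fun i _ => hx.integrable_rowTensor hθ0 hθ1 i q]
  simp only [hx.integral_rowTensor hθ0 hθ1, Finset.sum_const, Finset.card_univ, Fintype.card_fin,
    nsmul_eq_mul]
  field_simp

lemma integral_gram (hx : IsBernoulliRademacher P θ x) (hθ0 : 0 < θ) (hθ1 : θ ≤ 1)
    (hN : 0 < N) (q : ZMod n × ZMod n) :
    ∫ ω, gram θ (fun i => x i ω) q.1 q.2 ∂P = (1 : Matrix (ZMod n) (ZMod n) ℝ) q.1 q.2 := by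
  have hN' : (N : ℝ) ≠ 0 := by positivity
  have hn' : (n : ℝ) ≠ 0 := Nat.cast_ne_zero.2 (NeZero.ne n)
  simp only [gram_apply]
  rw [integral_const_mul, integral_finsetSum _ fun i _ => hx.integrable_rowGram hθ0.le hθ1 i q]
  simp only [hx.integral_rowGram hθ0.le hθ1, Finset.sum_const, Finset.card_univ, Fintype.card_fin,
    nsmul_eq_mul]
  field_simp

/-- Concentration of the empirical fourth moments. -/
lemma measureReal_momentTensor_le (hx : IsBernoulliRademacher P θ x) (hθ0 : 0 ≤ θ) (hθ1 : θ ≤ 1)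
    (hN : 0 < N) {τ : ℝ} (hτ : 0 < τ) :
    P.real {ω | ¬ ∑ q, (momentTensor (fun i => x i ω) q
      - modelTensor (n * (θ * (1 - 3 * θ))) (n * θ ^ 2) q) ^ 2 ≤ τ ^ 2}
      ≤ n ^ 6 / (N * τ ^ 2) := by
  have hN' : (0 : ℝ) < N := by positivity
  have h1 := hx.integral_momentTensor hθ0 hθ1 hN
  simp only [momentTensor_eq] at h1 ⊢
  refine (measureReal_sum_sq_gt_le (Y := fun q i ω => rowTensor q (x i ω))
    (fun q i => (measurable_rowTensor q).comp (hx.measurable i)) (B := n) (fun q i => ?_)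
    (fun q i j hij => (hx.indepFun hij).comp (measurable_rowTensor q) (measurable_rowTensor q))
    _ _ h1 hτ).trans (le_of_eq ?_)
  · filter_upwards [hx.ae_abs_le hθ0 hθ1 i] with ω hω using abs_rowTensor_le q hω
  -- There are `n⁴` entries, each of variance at most `n²/N`.
  · rw [Fintype.card_prod, Fintype.card_prod, Fintype.card_prod, ZMod.card]
    push_cast
    field_simp

/-- Concentration of the empirical second moments. -/
lemma measureReal_gram_le (hx : IsBernoulliRademacher P θ x) (hθ0 : 0 < θ) (hθ1 : θ ≤ 1)
    (hN : 0 < N) {δ : ℝ} (hδ : 0 < δ) :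
    P.real {ω | ¬ ∑ q : ZMod n × ZMod n, (gram θ (fun i => x i ω) - 1) q.1 q.2 ^ 2 ≤ δ ^ 2}
      ≤ n ^ 2 / (N * θ ^ 2 * δ ^ 2) := by
  have hN' : (0 : ℝ) < N := by positivity
  have hn' : (n : ℝ) ≠ 0 := Nat.cast_ne_zero.2 (NeZero.ne n)
  have h1 := hx.integral_gram hθ0 hθ1 hN
  simp only [Matrix.sub_apply, gram_apply] at h1 ⊢
  refine (measureReal_sum_sq_gt_le (Y := fun q i ω => rowGram q (x i ω))
    (fun q i => (measurable_rowGram q).comp (hx.measurable i)) (B := n) (fun q i => ?_)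
    (fun q i j hij => (hx.indepFun hij).comp (measurable_rowGram q) (measurable_rowGram q))
    _ _ h1 hδ).trans (le_of_eq ?_)
  · filter_upwards [hx.ae_abs_le hθ0.le hθ1 i] with ω hω using abs_rowGram_le q hω
  · rw [Fintype.card_prod, ZMod.card]
    push_cast
    field_simp

end IsBernoulliRademacher

/-! ### The expected objective and the target region. -/

section Stationary

variable {n : ℕ} [NeZero n] {N : ℕ}

lemma channelObjective_eq (x : Fin N → Sig n) (h : Sig n) :
    channelObjective x h = -(1 / 4) * tensorForm (momentTensor x) h h h h := by
  have h1 := inner_cubicSum_channelRow x 1 h h h h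
  rw [map_one, inner_cubicSum, Fintype.sum_prod_type] at h1
  simp only [inner_channelRow, map_one] at h1
  change _ = tensorForm (momentTensor x) h h h h at h1
  rw [← h1]
  simp only [channelObjective, phi]
  rw [← Finset.mul_sum]
  have h2 : ∀ i s, (circ (x i) *ᵥ fun j => h j) s ^ 4
      = (∑ j, circ (x i) s j * h j) * (∑ j, circ (x i) s j * h j) * (∑ j, circ (x i) s j * h j)
        * ∑ j, circ (x i) s j * h j := fun i s => by
    simp only [Matrix.mulVec, dotProduct]; ring
  simp only [h2]
  change _ = -(1 / 4) * (1 / (N : ℝ) * ∑ i, ∑ s, (∑ j, circ (x i) s j * h j)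
    * (∑ j, circ (x i) s j * h j) * (∑ j, circ (x i) s j * h j) * ∑ j, circ (x i) s j * h j)
  ring

lemma modelForm_self (α β : ℝ) (h : Sig n) : modelForm α β h h h h
    = α * ∑ j, inner ℝ (EuclideanSpace.basisFun (ZMod n) ℝ j) h ^ 4 + 3 * β * (‖h‖ ^ 2) ^ 2 := by
  have h1 : ∀ j, h j * h j * h j * h j
      = inner ℝ (EuclideanSpace.basisFun (ZMod n) ℝ j) h ^ 4 := fun j => by
    rw [EuclideanSpace.basisFun_apply, EuclideanSpace.inner_single_left]
    simp; ring
  simp only [modelForm, h1, real_inner_self_eq_norm_sq]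
  ring

/-- The vectors of the standard basis are stationary points of the model objective. -/
lemma isStationary_modelForm (α β : ℝ) (j : ZMod n) :
    IsStationary (fun h => -(1 / 4) * modelForm α β h h h h) (EuclideanSpace.single j 1) := by
  set e : Sig n := EuclideanSpace.single j 1 with he
  have hnorm : ‖e‖ = 1 := by simp [he]
  refine ⟨hnorm, ?_⟩
  have h1 := hasGradientAt_neg_sum_pow_four α (EuclideanSpace.basisFun (ZMod n) ℝ) e
  have h2 : HasFDerivAt (fun h : Sig n => (‖h‖ ^ 2) ^ 2) ((4 : ℝ) • innerSL ℝ e) e := by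
    refine ((hasStrictFDerivAt_norm_sq e).hasFDerivAt.pow 2).congr_fderiv ?_
    refine ContinuousLinearMap.ext fun w => ?_
    simp [hnorm]
    ring
  have h3 : cubicSum α (EuclideanSpace.basisFun (ZMod n) ℝ) e e e = α • e := by
    rw [cubicSum, Finset.sum_eq_single j]
    · simp [he]
    · intro k _ hk
      simp [he, EuclideanSpace.inner_single_left, hk]
    · simp
  rw [h3, hasGradientAt_iff_hasFDerivAt] at h1
  have h4 : HasGradientAt (fun h => -(1 / 4) * modelForm α β h h h h) (-(α + 3 * β) • e) e := by
    rw [hasGradientAt_iff_hasFDerivAt]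
    have h5 := h1.add (h2.const_mul (-(3 / 4) * β))
    refine (h5.congr_fderiv ?_).congr_of_eventuallyEq (Filter.Eventually.of_forall fun h => ?_)
    · refine ContinuousLinearMap.ext fun w => ?_
      simp only [add_apply, smul_apply, InnerProductSpace.toDual_apply_apply,
        innerSL_apply_apply, inner_neg_left, inner_smul_left, smul_eq_mul, RCLike.conj_to_real]
      ring
    · simp only [modelForm_self, Pi.add_apply]
      ring
  rw [riemGrad, h4.gradient, inner_smul_right, real_inner_self_eq_norm_sq, hnorm]
  simp

namespace IsBernoulliRademacher

variable {Ω : Type*} [mΩ : MeasurableSpace Ω] {P : Measure Ω}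
  [IsProbabilityMeasure P] {θ : ℝ} {x : Fin N → Ω → Sig n}

/-- Both sides are linear in the fourth moment tensor, whose mean is the model tensor. Thus the
basis vectors are stationary for the expected objective itself. -/
lemma meanObjective_eq (hx : IsBernoulliRademacher P θ x) (hθ0 : 0 ≤ θ) (hθ1 : θ ≤ 1)
    (hN : 0 < N) : meanObjective P x
      = fun h => -(1 / 4) * modelForm (n * (θ * (1 - 3 * θ))) (n * θ ^ 2) h h h h := by
  ext h
  simp only [meanObjective, channelObjective_eq]
  rw [integral_const_mul, ← tensorForm_modelTensor]
  simp only [tensorForm]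
  rw [integral_finsetSum]
  · congr 1
    refine Finset.sum_congr rfl fun q _ => ?_
    rw [integral_mul_const, hx.integral_momentTensor hθ0 hθ1 hN]
  · intro q _
    refine Integrable.mul_const ?_ _
    simp only [momentTensor_eq]
    exact (integrable_finsetSum _ fun i _ => hx.integrable_rowTensor hθ0 hθ1 i q).const_mul _

/-- A unit vector with one dominant coordinate in the rotated basis is in the region `ℋ₁`. -/
lemma mem_regionH1 (hx : IsBernoulliRademacher P θ x) (hθ0 : 0 ≤ θ) (hθ1 : θ ≤ 1)
    (hN : 0 < N) {f : Sig n} {ρ : ℝ}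
    (hbn : ∀ v, ‖Matrix.toEuclideanCLM (𝕜 := ℝ) (rotation f)ᵀ v‖ = ‖v‖)
    (hQQ : ∀ v, Matrix.toEuclideanCLM (𝕜 := ℝ) (rotation f)
        (Matrix.toEuclideanCLM (𝕜 := ℝ) (rotation f)ᵀ v) = v)
    {u : Sig n} (hu : ‖u‖ = 1) {j : ZMod n}
    (hj : 1 - ρ ≤ Matrix.toEuclideanCLM (𝕜 := ℝ) (rotation f)ᵀ u j ^ 2) :
    u ∈ regionH1 P x f ρ := by
  set v := Matrix.toEuclideanCLM (𝕜 := ℝ) (rotation f)ᵀ u with hv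
  have hvn : ‖v‖ = 1 := by rw [hv, hbn, hu]
  have hsum : ∑ k, v k ^ 2 = 1 := by
    have := EuclideanSpace.norm_sq_eq v
    rw [hvn] at this
    simpa using this.symm
  refine ⟨v, ⟨hvn, EuclideanSpace.single j 1, ?_, ?_, fun k => ?_⟩, hQQ u⟩
  · rw [hx.meanObjective_eq hθ0 hθ1 hN]
    exact isStationary_modelForm _ _ j
  · rw [Set.ncard_eq_one]
    refine ⟨j, ?_⟩
    ext k
    by_cases hk : k = j <;> simp [hk]
  · have h1 : v j ^ 2 ≤ 1 := by
      rw [← hsum]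
      exact Finset.single_le_sum (f := fun i => v i ^ 2) (fun i _ => sq_nonneg _)
        (Finset.mem_univ j)
    rw [Nat.cast_one, div_one]
    by_cases hk : k = j
    · subst hk
      simp only [PiLp.single_apply, if_true]
      rw [abs_le]
      constructor <;> linarith
    · have h2 : v j ^ 2 + v k ^ 2 ≤ 1 := by
        rw [← hsum, ← Finset.sum_pair (f := fun i => v i ^ 2) (Ne.symm hk)]
        exact Finset.sum_le_sum_of_subset_of_nonneg (Finset.subset_univ _)
          fun i _ _ => sq_nonneg _
      simp only [PiLp.single_apply, hk, if_false]
      rw [zero_pow two_ne_zero, sub_zero, abs_of_nonneg (sq_nonneg _)]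
      linarith

end IsBernoulliRademacher

end Stationary

/-! ### Conditioning on the values of the channels. -/

section Conclusion

variable {n : ℕ} [NeZero n] {N : ℕ} {Ω : Type*} [mΩ : MeasurableSpace Ω]

/-- Supplies unit norm for iterates with `t ≥ 1` without information on the perturbation; only a
zero numerator has to be excluded. -/
lemma norm_mgdStep_of_ne_zero {F : Sig n → ℝ} {γ : ℝ} {u : Sig n} (h : mgdStep F γ u ≠ 0) :
    ‖mgdStep F γ u‖ = 1 := by
  rw [mgdStep] at h ⊢
  have h1 : u - γ • riemGrad F u ≠ 0 := fun h0 => h (by rw [h0, smul_zero])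
  rw [norm_smul, norm_inv, norm_norm, inv_mul_cancel₀ (norm_ne_zero_iff.2 h1)]

/-- The channels for which the empirical moments are close to their means. -/
def NearMeans (θ τ δ : ℝ) (v : Fin N → Sig n) : Prop :=
  ∑ q, (momentTensor v q - modelTensor (n * (θ * (1 - 3 * θ))) (n * θ ^ 2) q) ^ 2 ≤ τ ^ 2 ∧
    ∑ q : ZMod n × ZMod n, (gram θ v - 1) q.1 q.2 ^ 2 ≤ δ ^ 2

/-- A bound for the probability of an event from bounds conditional on the values of finitely
supported random variables. -/
lemma measure_le_of_values {P : Measure Ω} [IsProbabilityMeasure P] {x : Fin N → Ω → Sig n}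
    (hx : ∀ i, Measurable (x i)) (hae : ∀ᵐ ω ∂P, ∀ i j, x i ω j = -1 ∨ x i ω j = 0 ∨ x i ω j = 1)
    (G : (Fin N → Sig n) → Prop) {U : Set Ω} {ε : ENNReal}
    (hU : ∀ v, G v → P ({ω | ∀ i, x i ω = v i} ∩ U) ≤ ε * P {ω | ∀ i, x i ω = v i}) :
    P U ≤ P {ω | ¬ G fun i => x i ω} + ε := by
  classical
  -- Almost surely the entries lie in `{-1, 0, 1}`, so finitely many disjoint atoms carry the good
  -- event and the bounds on them add up.
  let V : Finset (Fin N → Sig n) := ((Fintype.piFinset fun _ : Fin N => Fintype.piFinset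
    fun _ : ZMod n => ({-1, 0, 1} : Finset ℝ)).image fun w i => WithLp.toLp 2 (w i)).filter G
  have hm : ∀ v : Fin N → Sig n, MeasurableSet {ω | ∀ i, x i ω = v i} := fun v => by
    rw [Set.ofPred_forall]
    exact MeasurableSet.iInter fun i => hx i (measurableSet_singleton _)
  have hV : ∀ ω, (∀ i j, x i ω j = -1 ∨ x i ω j = 0 ∨ x i ω j = 1) → (G fun i => x i ω) →
      (fun i => x i ω) ∈ V := fun ω hω hG => by
    refine Finset.mem_filter.2 ⟨Finset.mem_image.2 ⟨fun i j => x i ω j, ?_, rfl⟩, hG⟩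
    simpa [Fintype.mem_piFinset] using hω
  have hdisj : Set.PairwiseDisjoint (V : Set (Fin N → Sig n)) fun v => {ω | ∀ i, x i ω = v i} := by
    intro v _ w _ hvw
    refine Set.disjoint_left.2 fun ω h1 h2 => hvw ?_
    funext i
    exact (h1 i).symm.trans (h2 i)
  have hsub : U ⊆ {ω | ¬ ∀ i j, x i ω j = -1 ∨ x i ω j = 0 ∨ x i ω j = 1}
      ∪ ({ω | ¬ G fun i => x i ω} ∪ ⋃ v ∈ V, ({ω | ∀ i, x i ω = v i} ∩ U)) := fun ω hω => by
    by_cases h1 : ∀ i j, x i ω j = -1 ∨ x i ω j = 0 ∨ x i ω j = 1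
    · by_cases h2 : G fun i => x i ω
      · refine Or.inr (Or.inr (Set.mem_iUnion₂.2 ⟨fun i => x i ω, hV ω h1 h2, fun i => rfl, hω⟩))
      · exact Or.inr (Or.inl h2)
    · exact Or.inl h1
  calc P U ≤ _ := measure_mono hsub
    _ ≤ P {ω | ¬ ∀ i j, x i ω j = -1 ∨ x i ω j = 0 ∨ x i ω j = 1}
        + (P {ω | ¬ G fun i => x i ω} + P (⋃ v ∈ V, ({ω | ∀ i, x i ω = v i} ∩ U))) :=
      (measure_union_le _ _).trans (add_le_add_right (measure_union_le _ _) _)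
    _ = P {ω | ¬ G fun i => x i ω} + P (⋃ v ∈ V, ({ω | ∀ i, x i ω = v i} ∩ U)) := by
      rw [ae_iff.1 hae, zero_add]
    _ ≤ P {ω | ¬ G fun i => x i ω} + ε := by
      gcongr
      calc P (⋃ v ∈ V, ({ω | ∀ i, x i ω = v i} ∩ U))
          ≤ ∑ v ∈ V, P ({ω | ∀ i, x i ω = v i} ∩ U) := measure_biUnion_finset_le _ _
        _ ≤ ∑ v ∈ V, ε * P {ω | ∀ i, x i ω = v i} :=
            Finset.sum_le_sum fun v hv => hU v (Finset.mem_filter.1 hv).2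
        _ = ε * P (⋃ v ∈ V, {ω | ∀ i, x i ω = v i}) := by
            rw [← Finset.mul_sum, measure_biUnion_finset hdisj fun v _ => hm v]
        _ ≤ ε * 1 := by gcongr; exact prob_le_one
        _ = ε := mul_one ε

end Conclusion

/-! ### Assembly of the probabilistic estimates. -/

section Main

variable {n : ℕ} [NeZero n] {N : ℕ} {Ω : Type*} [mΩ : MeasurableSpace Ω]

/-- With enough channels, the empirical moments are close to their means with high probability. -/
lemma IsBernoulliRademacher.measure_not_nearMeans_le {P : Measure Ω} [IsProbabilityMeasure P]
    {θ ρ : ℝ} {x : Fin N → Ω → Sig n} (hx : IsBernoulliRademacher P θ x) (hθ0 : 0 < θ)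
    (hθ : θ < 1 / 3) (hn : 1 / (n : ℝ) ≤ θ) (hρ0 : 0 < ρ)
    (hN : 800000 / (θ * (1 - 3 * θ)) ^ 2 * (n : ℝ) ^ 9 / ρ ^ 4 < N) :
    P {ω | ¬ NearMeans θ (θ * (1 - 3 * θ) * ρ ^ 2 / (400 * n))
        (θ * (1 - 3 * θ) * ρ ^ 2 / (800 * n ^ 2)) fun i => x i ω} ≤ ENNReal.ofReal (1 / n) := by
  have hn0 : (0 : ℝ) < n := Nat.cast_pos.2 (NeZero.pos n)
  set a := θ * (1 - 3 * θ) with ha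
  have ha0 : 0 < a := mul_pos hθ0 (by linarith)
  have hN0 : (0 : ℝ) < N := lt_trans (by positivity) hN
  have hN0' : 0 < N := Nat.cast_pos.1 hN0
  set τ := a * ρ ^ 2 / (400 * n) with hτ
  set δ := a * ρ ^ 2 / (800 * n ^ 2) with hδ
  have hτ0 : 0 < τ := by positivity
  have hδ0 : 0 < δ := by positivity
  have h1 := hx.measureReal_momentTensor_le hθ0.le (by linarith) hN0' hτ0
  have h2 := hx.measureReal_gram_le hθ0 (by linarith) hN0' hδ0
  have hsub : {ω | ¬ NearMeans θ τ δ fun i => x i ω}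
      ⊆ {ω | ¬ ∑ q, (momentTensor (fun i => x i ω) q
          - modelTensor (n * (θ * (1 - 3 * θ))) (n * θ ^ 2) q) ^ 2 ≤ τ ^ 2}
        ∪ {ω | ¬ ∑ q : ZMod n × ZMod n,
          (gram θ (fun i => x i ω) - 1) q.1 q.2 ^ 2 ≤ δ ^ 2} := fun ω hω => by
    by_contra h
    rw [Set.mem_union, not_or] at h
    exact hω ⟨not_not.1 h.1, not_not.1 h.2⟩
  rw [← ofReal_measureReal]
  refine ENNReal.ofReal_le_ofReal ((measureReal_mono hsub).trans
    ((measureReal_union_le _ _).trans ((add_le_add h1 h2).trans ?_)))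
  have e1 : (n : ℝ) ^ 6 / (N * τ ^ 2) = 160000 * n ^ 8 / (a ^ 2 * ρ ^ 4 * N) := by
    rw [hτ]; field_simp; norm_num
  have e2 : (n : ℝ) ^ 2 / (N * θ ^ 2 * δ ^ 2) ≤ 640000 * n ^ 8 / (a ^ 2 * ρ ^ 4 * N) := by
    have h3 : (n : ℝ) ^ 2 / (N * θ ^ 2 * δ ^ 2)
        = 640000 * n ^ 6 / (a ^ 2 * ρ ^ 4 * N) * (1 / θ) ^ 2 := by
      rw [hδ]; field_simp; norm_num
    -- The assumption `1/n ≤ θ` trades the factor `θ⁻²` for `n²`, bringing the second moments to the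
    -- rate `n⁸` of the fourth ones.
    have h4 : 1 / θ ≤ n := by
      rw [div_le_iff₀ hθ0]
      rwa [div_le_iff₀ hn0, mul_comm] at hn
    calc (n : ℝ) ^ 2 / (N * θ ^ 2 * δ ^ 2)
        = 640000 * n ^ 6 / (a ^ 2 * ρ ^ 4 * N) * (1 / θ) ^ 2 := h3
      _ ≤ 640000 * n ^ 6 / (a ^ 2 * ρ ^ 4 * N) * (n : ℝ) ^ 2 := by gcongr
      _ = _ := by ring
  have e3 : 160000 * (n : ℝ) ^ 8 / (a ^ 2 * ρ ^ 4 * N) + 640000 * n ^ 8 / (a ^ 2 * ρ ^ 4 * N)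
      = 800000 * n ^ 8 / (a ^ 2 * ρ ^ 4 * N) := by ring
  rw [e1]
  refine (add_le_add_right e2 _).trans ?_
  rw [e3, div_le_div_iff₀ (by positivity) hn0]
  have e4 : 800000 / a ^ 2 * (n : ℝ) ^ 9 / ρ ^ 4 = 800000 * n ^ 9 / (a ^ 2 * ρ ^ 4) := by
    field_simp
  rw [e4, div_lt_iff₀ (by positivity)] at hN
  linarith

/-- The failure probability of perturbed manifold gradient descent on the objective built from
fixed channels with typical empirical moments. -/
lemma measure_avoid_regionH1_le {P : Measure Ω} [IsProbabilityMeasure P] {𝓕 : Filtration ℕ mΩ}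
    {θ ρ ξ : ℝ} {x : Fin N → Ω → Sig n} (hx : IsBernoulliRademacher P θ x)
    (hx0 : ∀ i, Measurable[𝓕 0] (x i)) (hθ0 : 0 < θ) (hθ : θ < 1 / 3) (hn : 4 ≤ n)
    (hN : 0 < N) (hξ : 100000 ≤ ξ) (hρ0 : 0 < ρ) (hρ : ρ < 1 / 1000) (hξρ : ξ < 128 / ρ ^ 2)
    {f : Sig n} (hf : IsUnit (circ f)) {h z : ℕ → Ω → Sig n} {s : ℕ → Ω → ℕ}
    (hrun : IsPMGD P 𝓕 (fun ω => objective θ (fun i => conv (x i ω) f))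
        (1 / (128 * (n : ℝ) ^ 3))
        (θ ^ 2 * (1 - 3 * θ) ^ 2 / (ξ ^ 2 * (n : ℝ) ^ 6 * Real.log n ^ 2))
        (ξ * (n : ℝ) ^ 3 * Real.log n / (25 * θ * (1 - 3 * θ)))
        (θ * (1 - 3 * θ) * ρ ^ 2 / (2 * n)) h z s)
    {v : Fin N → Sig n} (hv : NearMeans θ (θ * (1 - 3 * θ) * ρ ^ 2 / (400 * n))
        (θ * (1 - 3 * θ) * ρ ^ 2 / (800 * n ^ 2)) v) :
    P ({ω | ∀ i, x i ω = v i} ∩ {ω | ¬ ∃ t : ℕ, 1 ≤ t ∧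
        (t : ℝ) ≤ 5000 * (n : ℝ) ^ 8 / (θ ^ 2 * (1 - 3 * θ) ^ 2 * ρ ^ 4)
          + ξ ^ 4 * (n : ℝ) ^ 12 * Real.log n ^ 4 / (800 * θ ^ 4 * (1 - 3 * θ) ^ 4) ∧
        h t ω ∈ regionH1 P x f ρ})
      ≤ ENNReal.ofReal (ξ ^ 4 * (n : ℝ) ^ (13 - ξ / 10000) * Real.log n ^ 4 /
            (8 * θ ^ 4 * (1 - 3 * θ) ^ 4)) * P {ω | ∀ i, x i ω = v i} := by
  have ha : 0 < θ * (1 - 3 * θ) := mul_pos hθ0 (by linarith)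
  have ha' : θ * (1 - 3 * θ) ≤ 1 / 12 := by nlinarith [sq_nonneg (θ - 1 / 6)]
  have hnR : (4 : ℝ) ≤ n := by exact_mod_cast hn
  have hn0 : (0 : ℝ) < n := by linarith
  obtain ⟨b, hb, hbn, hQQ⟩ := exists_basis_rotation hf
  set a := θ * (1 - 3 * θ) with hadef
  have hρ2 : ρ ^ 2 ≤ 1 := pow_le_one₀ hρ0.le (by linarith)
  have haρ : a * ρ ^ 2 ≤ a * 1 := by gcongr
  -- The two tolerances are chosen so that the total model error is exactly the one allowed in
  -- `exists_negative_curvature`.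
  have e : 2 * (a * ρ ^ 2 / (400 * n)) + 4 * n * (a * ρ ^ 2 / (800 * n ^ 2))
      = a * ρ ^ 2 / (100 * n) := by field_simp; norm_num
  have hε : a * ρ ^ 2 / (100 * n) ≤ 0.01 * n * a := by
    rw [div_le_iff₀ (by positivity)]
    have : 1 ≤ (n : ℝ) ^ 2 := one_le_pow₀ (by linarith)
    nlinarith
  have hδ : a * ρ ^ 2 / (800 * (n : ℝ) ^ 2) ≤ 1 / 20 := by
    rw [div_le_iff₀ (by positivity)]
    have : 1 ≤ (n : ℝ) ^ 2 := one_le_pow₀ (by linarith)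
    nlinarith
  obtain ⟨S, hS, hF, hE⟩ := exists_near_model hf hθ0.le hθ.le hadef (by positivity)
    (by positivity) hδ hv.1 hv.2 b hb hbn (by rw [e]; exact hε)
  rw [e] at hE
  have hΩ₀ : MeasurableSet[𝓕 0] {ω | ∀ i, x i ω = v i} := by
    rw [Set.ofPred_forall]
    exact MeasurableSet.iInter fun i => hx0 i (measurableSet_singleton _)
  refine (measure_mono ?_).trans (prob_avoid_le_of_near_model hn ha ha' hξ hρ0 hρ hξρ hrun
    (measurable_objective_conv θ v f) hΩ₀
    (fun ω hω => by simp only [show ∀ i, x i ω = v i from hω]) hS hF b le_rfl hE)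
  rintro ω ⟨hω, hav⟩
  refine ⟨hω, fun t ht htT j => ?_⟩
  by_contra! hj
  refine hav ⟨t, ht, htT, ?_⟩
  refine hx.mem_regionH1 hθ0.le (by linarith) hN hbn hQQ ?_ (j := j) (by rwa [← hb])
  -- An iterate with `t ≥ 1` is the output of a step. It is not zero, because its dominant
  -- coordinate has square at least `1 - ρ > 0`.
  obtain ⟨t, rfl⟩ := Nat.exists_eq_add_of_le' ht
  rw [hrun.iterate_step]
  refine norm_mgdStep_of_ne_zero fun h0 => ?_
  rw [hrun.iterate_step, h0, inner_zero_right, zero_pow two_ne_zero] at hj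
  linarith

end Main

end MSBD

end

theorem theorem3 :
    ∃ ξ₀ : ℝ, 130000 < ξ₀ ∧ ξ₀ < 128000000 ∧
    ∀ θ : ℝ, 0 < θ → θ < 1 / 3 →
    ∃ c₁ c₁' : ℝ, 0 < c₁ ∧ 0 < c₁' ∧
    ∀ (n : ℕ) [NeZero n], 1 / (n : ℝ) ≤ θ →
    ∀ ρ : ℝ, 0 < ρ → ρ < 1 / 1000 →
    ∀ ξ : ℝ, ξ₀ ≤ ξ → ξ < 128 / ρ ^ 2 →
    ∀ f : MSBD.Sig n, IsUnit (MSBD.circ f) →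
    ∀ N : ℕ, (N : ℝ) > max
        (c₁ * (n : ℝ) ^ 9 / ρ ^ 4 * Real.log (n / ρ))
        (c₁ * MSBD.condNumber f ^ 8 * (n : ℝ) ^ 8 / ρ ^ 4 * Real.log n) →
    ∀ {Ω : Type*} [mΩ : MeasurableSpace Ω] (P : Measure Ω) [IsProbabilityMeasure P]
      (𝓕 : Filtration ℕ mΩ) (x : Fin N → Ω → MSBD.Sig n),
      MSBD.IsBernoulliRademacher P θ x →
      (∀ i, Measurable[𝓕 0] (x i)) →
    ∀ (h z : ℕ → Ω → MSBD.Sig n) (s : ℕ → Ω → ℕ),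
      MSBD.IsPMGD P 𝓕 (fun ω => MSBD.objective θ (fun i => MSBD.conv (x i ω) f))
        (1 / (128 * (n : ℝ) ^ 3))
        (θ ^ 2 * (1 - 3 * θ) ^ 2 / (ξ ^ 2 * (n : ℝ) ^ 6 * Real.log n ^ 2))
        (ξ * (n : ℝ) ^ 3 * Real.log n / (25 * θ * (1 - 3 * θ)))
        (θ * (1 - 3 * θ) * ρ ^ 2 / (2 * n))
        h z s →
    1 - (n : ℝ) ^ (-c₁')
        - ξ ^ 4 * (n : ℝ) ^ (13 - ξ / 10000) * Real.log n ^ 4 /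
            (8 * θ ^ 4 * (1 - 3 * θ) ^ 4) ≤
      P.real {ω | ∃ t : ℕ, 1 ≤ t ∧
        (t : ℝ) ≤ 5000 * (n : ℝ) ^ 8 / (θ ^ 2 * (1 - 3 * θ) ^ 2 * ρ ^ 4)
          + ξ ^ 4 * (n : ℝ) ^ 12 * Real.log n ^ 4 / (800 * θ ^ 4 * (1 - 3 * θ) ^ 4) ∧
        h t ω ∈ MSBD.regionH1 P x f ρ} := by
  -- Any admissible threshold from `10⁵` on would satisfy the parameter bounds, and `10⁶` lies in
  -- the required window.
  refine ⟨1000000, by norm_num, by norm_num, fun θ hθ0 hθ => ?_⟩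
  have ha : 0 < θ * (1 - 3 * θ) := mul_pos hθ0 (by linarith)
  -- Chebyshev's bound is of order `n⁸/(a²ρ⁴N)`; the ninth power of `n` in the sample size turns it
  -- into `1/n`, hence the exponent `1`.
  refine ⟨800000 / (θ * (1 - 3 * θ)) ^ 2, 1, by positivity, one_pos, ?_⟩
  intro n _ hn ρ hρ0 hρ ξ hξ hξρ f hf N hN Ω mΩ P _ 𝓕 x hx hx0 h z s hrun
  have hn0 : (0 : ℝ) < n := Nat.cast_pos.2 (NeZero.pos n)
  -- `1/n ≤ θ < 1/3` forces `n ≥ 4`, so that `log n ≥ 1`.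
  have hn3 : (3 : ℝ) < n := by
    rw [div_le_iff₀ hn0] at hn
    nlinarith
  have hn4 : 4 ≤ n := by
    have : 3 < n := by exact_mod_cast hn3
    omega
  have hlog : 1 ≤ Real.log (n / ρ) := by
    rw [Real.le_log_iff_exp_le (by positivity), le_div_iff₀ hρ0]
    nlinarith [Real.exp_one_lt_three, Real.exp_pos 1]
  have hNlt : 800000 / (θ * (1 - 3 * θ)) ^ 2 * (n : ℝ) ^ 9 / ρ ^ 4 < N := by
    refine lt_of_le_of_lt ?_ (lt_of_le_of_lt (le_max_left _ _) hN)
    exact le_mul_of_one_le_right (by positivity) hlog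
  have hNpos : 0 < N := by
    have : (0 : ℝ) < N := lt_of_le_of_lt (by positivity) hNlt
    exact_mod_cast this
  have hfail := MSBD.measure_le_of_values hx.measurable (hx.ae_mem hθ0.le (by linarith)) _
    fun v hv => MSBD.measure_avoid_regionH1_le hx hx0 hθ0 hθ hn4 hNpos (by linarith) hρ0 hρ hξρ hf
      hrun (v := v) hv
  have hmeans := hx.measure_not_nearMeans_le hθ0 hθ hn hρ0 hNlt
  set ε := ξ ^ 4 * (n : ℝ) ^ (13 - ξ / 10000) * Real.log n ^ 4 /
    (8 * θ ^ 4 * (1 - 3 * θ) ^ 4) with hε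
  have hε0 : 0 ≤ ε := by
    have : 0 < 1 - 3 * θ := by linarith
    have : 0 < ξ := by linarith
    positivity
  set H := {ω | ∃ t : ℕ, 1 ≤ t ∧
        (t : ℝ) ≤ 5000 * (n : ℝ) ^ 8 / (θ ^ 2 * (1 - 3 * θ) ^ 2 * ρ ^ 4)
          + ξ ^ 4 * (n : ℝ) ^ 12 * Real.log n ^ 4 / (800 * θ ^ 4 * (1 - 3 * θ) ^ 4) ∧
        h t ω ∈ MSBD.regionH1 P x f ρ} with hH
  have hc : P Hᶜ ≤ ENNReal.ofReal (1 / n + ε) := by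
    rw [ENNReal.ofReal_add (by positivity) hε0]
    exact hfail.trans (add_le_add_left hmeans _)
  have hc' : P.real Hᶜ ≤ 1 / n + ε := ENNReal.toReal_le_of_le_ofReal (by positivity) hc
  have htotal : 1 ≤ P.real H + P.real Hᶜ := by
    rw [← probReal_univ (μ := P), ← Set.union_compl_self H]
    exact measureReal_union_le _ _
  rw [Real.rpow_neg_one, ← one_div]
  linarith
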